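/- Let $N\ge 1$ and let $\mathcal R\subset\mathbb R^N$ be a (possibly empty) root system: a finite set of vectors with $\|\alpha\|^2=2$ that satisfies $-\alpha\in\mathcal R$, $\mathbb R\alpha\cap\mathcal R=\{\pm\alpha\}$ and $\sigma_\alpha(\mathcal R)=\mathcal R$ for all $\alpha\in\mathcal R$, where $\sigma_\alpha$ is the orthogonal reflection in $\alpha^\perp$. Let $\mu:\mathcal R\to[0,\infty)$ be invariant under the group generated by the $\sigma_\alpha$. Let $E_\mu:\mathbb C^N\times\mathbb C^N\to\mathbb C$ be the Dunkl kernel, that is, the entire function with $E_\mu(0,y)=1$ and $T_\xi^xE_\mu(x,y)=\langle\xi,y\rangle E_\mu(x,y)$ for $x,y,\xi\in\mathbb R^N$, where $$T_\xi f(x)=\partial_\xi f(x)+\tfrac12\sum_{\alpha\in\mathcal R}\mu(\alpha)\frac{\langle\alpha,\xi\rangle}{\langle\alpha,x\rangle}\big(f(x)-f(\sigma_\alpha x)\big)$$ (with the quotient extended continuously to $\langle\alpha,x\rangle=0$). For $t>0$ put $$\gamma_\mu=\tfrac12\sum_{\alpha\in\mathcal R}\mu(\alpha),\qquad \tilde\omega_{\mu,t}(x)=t^{-(\gamma_\mu+N/2)}\prod_{\alpha\in\mathcal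 R}|\langle\alpha,x\rangle|^{\mu(\alpha)},$$ $$c_\mu=\int_{\mathbb R^N}e^{-\|x\|^2/2}\,\tilde\omega_{\mu,1}(x)\,dx,\qquad \omega_{\mu,t}=c_\mu^{-1}\tilde\omega_{\mu,t},$$ and use the same symbols for the measures on $\mathbb R^N$ with these densities with respect to Lebesgue measure. Let $\mathcal B_{\mu,1}$ be the Hilbert space of functions on $\mathbb C^N$ with reproducing kernel $K_w(z)=E_\mu(\bar w,z)$ (this kernel is positive semidefinite). With $z^2=\sum_j z_j^2$, let $A_{\mu,1}:L^2(\omega_{\mu,1})\to\mathcal B_{\mu,1}$ and $BSO:L^2(\tilde\omega_{\mu,1})\to\mathcal B_{\mu,1}$ be the bounded operators given by the (absolutely convergent) integrals $$A_{\mu,1}\psi(z)=\int_{\mathbb R^N} e^{-z^2/2-\|q\|^2/4}E_\mu(z,q)\,\psi(q)\,d\omega_{\mu,1}(q),$$ $$BSO\,\varphi(z)=\int_{\mathbb R^N} 2^{\gamma_\mu+N/2}c_\mu^{-1/2}e^{-z^2/2-\|y\|^2}E_\mu(\sqrt2\,y,\sqrt2\,z)\,\varphi(y)\,d\tilde\omega_{\mu,1}(y),$$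 the latter being the Segal–Bargmann transform of Ben Saïd and Ørsted. Then the rescaling $R\varphi=c_\mu^{1/2}2^{-(\gamma_\mu+N/2)}\varphi$ is a unitary isomorphism $L^2(\tilde\omega_{\mu,1})\to L^2(\omega_{\mu,1/4})$, the dilation $\delta_{1/2}\psi(x)=\psi(x/2)$ is a unitary isomorphism $L^2(\omega_{\mu,1/4})\to L^2(\omega_{\mu,1})$, the operators $A_{\mu,1}$ and $BSO$ are well defined with values in $\mathcal B_{\mu,1}$, and $$BSO=A_{\mu,1}\,\delta_{1/2}\,R .$$ So $BSO$ and $A_{\mu,1}$ differ by the unitary isomorphism $\delta_{1/2}R:L^2(\tilde\omega_{\mu,1})\to L^2(\omega_{\mu,1})$, a rescaling followed by a dilation on configuration space. -/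

import Mathlib

open MeasureTheory
open scoped RealInnerProductSpace

noncomputable section

namespace Dunkl

/-- The configuration space `ℝ^N` with its Euclidean structure. -/
abbrev ConfigSpace (N : ℕ) : Type := EuclideanSpace ℝ (Fin N)

/-- The phase space `ℂ^N`. -/
abbrev PhaseSpace (N : ℕ) : Type := EuclideanSpace ℂ (Fin N)

/-- The inclusion of `ℝ^N` in `ℂ^N`. -/
def toPhase {N : ℕ} (x : ConfigSpace N) : PhaseSpace N :=
  WithLp.toLp 2 fun j => (x j : ℂ)

/-- The componentwise complex conjugate of a point of `ℂ^N`. -/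
def conjPhase {N : ℕ} (z : PhaseSpace N) : PhaseSpace N :=
  WithLp.toLp 2 fun j => (starRingEnd ℂ) (z j)

/-- The holomorphic square `z² = ∑ⱼ zⱼ²` on `ℂ^N`. -/
def holoSq {N : ℕ} (z : PhaseSpace N) : ℂ := ∑ j, z j ^ 2

/-- The orthogonal reflection `σ_α` in the hyperplane orthogonal to `α`. -/
def refl {N : ℕ} (α : ConfigSpace N) : ConfigSpace N ≃ₗᵢ[ℝ] ConfigSpace N :=
  (Submodule.span ℝ {α})ᗮ.reflection

/-- Root systems in `ℝ^N`: finite sets of non-zero vectors, normalized by `‖α‖² = 2`. The empty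
set is allowed, and the roots need not span `ℝ^N`. -/
structure IsRootSystem {N : ℕ} (𝓡 : Finset (ConfigSpace N)) : Prop where
  ne_zero : ∀ α ∈ 𝓡, α ≠ 0
  neg_mem : ∀ α ∈ 𝓡, -α ∈ 𝓡
  eq_one_or_neg_one : ∀ α ∈ 𝓡, ∀ r : ℝ, r • α ∈ 𝓡 → r = 1 ∨ r = -1
  image_refl : ∀ α ∈ 𝓡, (refl α) '' (𝓡 : Set (ConfigSpace N)) = 𝓡
  norm_sq : ∀ α ∈ 𝓡, ‖α‖ ^ 2 = 2

/-- The Coxeter group `G(𝓡)`, generated by the reflections in the roots. -/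
def coxeterGroup {N : ℕ} (𝓡 : Finset (ConfigSpace N)) :
    Subgroup (ConfigSpace N ≃ₗᵢ[ℝ] ConfigSpace N) :=
  Subgroup.closure (refl '' (𝓡 : Set (ConfigSpace N)))

/-- Non-negative multiplicity functions on `𝓡`. Only the values of `μ` on `𝓡` are ever used. -/
structure IsMultiplicity {N : ℕ} (𝓡 : Finset (ConfigSpace N)) (μ : ConfigSpace N → ℝ) : Prop where
  invariant : ∀ g ∈ coxeterGroup 𝓡, ∀ α ∈ 𝓡, μ (g α) = μ α
  nonneg : ∀ α ∈ 𝓡, 0 ≤ μ α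

/-- The quotient `(f(x) - f(σ_α x)) / ⟨α, x⟩` of a `C¹` function `f`, with its continuous extension
`∂_α f(x)` to the hyperplane `⟨α, x⟩ = 0` (here `‖α‖² = 2`, so `σ_α x = x - ⟨α, x⟩ α`). -/
def diffQuot {N : ℕ} (α : ConfigSpace N) (f : ConfigSpace N → ℂ) (x : ConfigSpace N) : ℂ :=
  open Classical in
  if ⟪α, x⟫ = 0 then fderiv ℝ f x α else (f x - f (refl α x)) / (⟪α, x⟫ : ℂ)

/-- The Dunkl operator `T_{ξ,μ}`, with the sum written over all roots with the factor `1/2`. -/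
def dunklOp {N : ℕ} (𝓡 : Finset (ConfigSpace N)) (μ : ConfigSpace N → ℝ) (ξ : ConfigSpace N)
    (f : ConfigSpace N → ℂ) (x : ConfigSpace N) : ℂ :=
  fderiv ℝ f x ξ + (1 / 2 : ℂ) * ∑ α ∈ 𝓡, (μ α : ℂ) * (⟪α, ξ⟫ : ℂ) * diffQuot α f x

/-- `E` is the holomorphic extension to `ℂ^N × ℂ^N` of a solution on `ℝ^N × ℝ^N` of the joint
eigenvalue problem `T_ξ^x E(x,y) = ⟨ξ,y⟩ E(x,y)`, `E(0,y) = 1`. -/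
structure IsDunklKernel {N : ℕ} (𝓡 : Finset (ConfigSpace N)) (μ : ConfigSpace N → ℝ)
    (E : PhaseSpace N → PhaseSpace N → ℂ) : Prop where
  holomorphic : Differentiable ℂ fun p : PhaseSpace N × PhaseSpace N => E p.1 p.2
  eigen : ∀ ξ x y : ConfigSpace N,
    dunklOp 𝓡 μ ξ (fun x' => E (toPhase x') (toPhase y)) x =
      (⟪ξ, y⟫ : ℂ) * E (toPhase x) (toPhase y)
  at_zero : ∀ y : ConfigSpace N, E 0 (toPhase y) = 1

open Classical in
/-- The Dunkl kernel `E_μ : ℂ^N × ℂ^N → ℂ`. For a root system and a non-negative multiplicity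
function it is the one and only function satisfying `IsDunklKernel`. -/
def dunklKernel {N : ℕ} (𝓡 : Finset (ConfigSpace N)) (μ : ConfigSpace N → ℝ) :
    PhaseSpace N → PhaseSpace N → ℂ :=
  if h : ∃ E, IsDunklKernel 𝓡 μ E then h.choose else 0

/-- `γ_μ`, half of the sum of `μ` over all roots. -/
def gammaConst {N : ℕ} (𝓡 : Finset (ConfigSpace N)) (μ : ConfigSpace N → ℝ) : ℝ :=
  (1 / 2) * ∑ α ∈ 𝓡, μ α

/-- The weight `ω̃_{μ,t}`. -/
def weightTilde {N : ℕ} (𝓡 : Finset (ConfigSpace N)) (μ : ConfigSpace N → ℝ) (t : ℝ)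
    (x : ConfigSpace N) : ℝ :=
  t ^ (-(gammaConst 𝓡 μ + N / 2)) * ∏ α ∈ 𝓡, |⟪α, x⟫| ^ (μ α)

/-- The measure `dω̃_{μ,t}(x) = ω̃_{μ,t}(x) dx`. -/
def measureTilde {N : ℕ} (𝓡 : Finset (ConfigSpace N)) (μ : ConfigSpace N → ℝ) (t : ℝ) :
    Measure (ConfigSpace N) :=
  volume.withDensity fun x => ENNReal.ofReal (weightTilde 𝓡 μ t x)

/-- The Macdonald-Mehta-Selberg constant `c_μ = c_{μ,1}`. -/
def mehtaConst {N : ℕ} (𝓡 : Finset (ConfigSpace N)) (μ : ConfigSpace N → ℝ) : ℝ :=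
  ∫ x, Real.exp (-‖x‖ ^ 2 / 2) ∂(measureTilde 𝓡 μ 1)

/-- The normalized weight `ω_{μ,t} = c_μ⁻¹ ω̃_{μ,t}`. -/
def weight {N : ℕ} (𝓡 : Finset (ConfigSpace N)) (μ : ConfigSpace N → ℝ) (t : ℝ)
    (x : ConfigSpace N) : ℝ :=
  (mehtaConst 𝓡 μ)⁻¹ * weightTilde 𝓡 μ t x

/-- The measure `dω_{μ,t}(x) = ω_{μ,t}(x) dx`. -/
def measureOmega {N : ℕ} (𝓡 : Finset (ConfigSpace N)) (μ : ConfigSpace N → ℝ) (t : ℝ) :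
    Measure (ConfigSpace N) :=
  volume.withDensity fun x => ENNReal.ofReal (weight 𝓡 μ t x)

/-- The reproducing kernel of the Segal-Bargmann space. The entry at `(z, w)` is the value at `z`
of the kernel function `K_w`, that is, (multiplication by) `E_μ(w^* / √t, z / √t)`. -/
def sbKernel {N : ℕ} (𝓡 : Finset (ConfigSpace N)) (μ : ConfigSpace N → ℝ) (t : ℝ) :
    Matrix (PhaseSpace N) (PhaseSpace N) (ℂ →L[ℂ] ℂ) :=
  Matrix.of fun z w =>
    dunklKernel 𝓡 μ (((√t : ℝ) : ℂ)⁻¹ • conjPhase w) (((√t : ℝ) : ℂ)⁻¹ • z) •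
      ContinuousLinearMap.id ℂ ℂ

/-- The Segal-Bargmann space `𝓑_{μ,t}`: the Hilbert space of functions on `ℂ^N` with the above
reproducing kernel. It is formed as soon as the kernel is positive semidefinite. -/
abbrev SegalBargmannSpace {N : ℕ} (𝓡 : Finset (ConfigSpace N)) (μ : ConfigSpace N → ℝ) (t : ℝ)
    [Fact (sbKernel 𝓡 μ t).PosSemidef] : Type :=
  RKHS.OfKernel (sbKernel 𝓡 μ t)

/-- The kernel `A_{μ,t}(z,q) = exp(-z²/2t - q²/4t) E_μ(z/√t, q/√t)`. -/
def kernelA {N : ℕ} (𝓡 : Finset (ConfigSpace N)) (μ : ConfigSpace N → ℝ) (t : ℝ)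
    (z : PhaseSpace N) (q : ConfigSpace N) : ℂ :=
  Complex.exp (-holoSq z / (2 * t) - (‖q‖ ^ 2 : ℝ) / (4 * t)) *
    dunklKernel 𝓡 μ (((√t : ℝ) : ℂ)⁻¹ • z) (((√t : ℝ) : ℂ)⁻¹ • toPhase q)

/-- The integral kernel transform `A_{μ,t}` with respect to the measure `ω_{μ,t}`. -/
def transformA {N : ℕ} (𝓡 : Finset (ConfigSpace N)) (μ : ConfigSpace N → ℝ) (t : ℝ)
    (ψ : ConfigSpace N → ℂ) (z : PhaseSpace N) : ℂ :=
  ∫ q, kernelA 𝓡 μ t z q * ψ q ∂(measureOmega 𝓡 μ t)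

/-- The kernel of the Segal-Bargmann transform of Ben Saïd and Ørsted:
`BSO(z,y) = 2^(γ_μ + N/2) c_μ^(-1/2) exp(-z²/2 - y²) E_μ(√2 y, √2 z)`. -/
def kernelBSO {N : ℕ} (𝓡 : Finset (ConfigSpace N)) (μ : ConfigSpace N → ℝ)
    (z : PhaseSpace N) (y : ConfigSpace N) : ℂ :=
  ((2 ^ (gammaConst 𝓡 μ + N / 2) * mehtaConst 𝓡 μ ^ (-(1 / 2) : ℝ) : ℝ) : ℂ) *
    Complex.exp (-holoSq z / 2 - (‖y‖ ^ 2 : ℝ)) *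
    dunklKernel 𝓡 μ (((√2 : ℝ) : ℂ) • toPhase y) (((√2 : ℝ) : ℂ) • z)

/-- The transform `BSO`, an integral kernel transform with respect to the measure `ω̃_{μ,1}`. -/
def transformBSO {N : ℕ} (𝓡 : Finset (ConfigSpace N)) (μ : ConfigSpace N → ℝ)
    (φ : ConfigSpace N → ℂ) (z : PhaseSpace N) : ℂ :=
  ∫ y, kernelBSO 𝓡 μ z y * φ y ∂(measureTilde 𝓡 μ 1)

/-- The dilation `δ_r ψ(x) = ψ(r x)`. -/
def dilation {N : ℕ} (r : ℝ) (ψ : ConfigSpace N → ℂ) (x : ConfigSpace N) : ℂ := ψ (r • x)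

/-- The rescaling `R φ = c_μ^(1/2) 2^(-(γ_μ + N/2)) φ`. -/
def rescaling {N : ℕ} (𝓡 : Finset (ConfigSpace N)) (μ : ConfigSpace N → ℝ)
    (φ : ConfigSpace N → ℂ) (x : ConfigSpace N) : ℂ :=
  ((mehtaConst 𝓡 μ ^ (1 / 2 : ℝ) * 2 ^ (-(gammaConst 𝓡 μ + N / 2)) : ℝ) : ℂ) * φ x

end Dunkl

end

/-!
The radial part `∑ xᵢ Tᵢ` of the Dunkl operators is invertible on homogeneous polynomials of
positive degree, which yields `E_μ(·, y)` as a power series; a maximum principle for the radial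
equation bounds the homogeneous parts and gives uniqueness, and uniqueness gives the symmetries
of `E_μ`. Integrating by parts against the Gaussian weight,
`∫ E_μ(z, q) E_μ(w, q) e^(-q²/2) dω̃(q) = c_μ e^((z² + w²)/2) E_μ(z, w)`. Hence the reproducing
kernel of `𝓑_{μ,1}` is the Gram kernel of the kernel of `A_{μ,1}`, so it is positive semidefinite
and `A_{μ,1}` is a bounded operator. Since the kernel of `BSO` at `(z, y)` is a constant multiple of
that of `A_{μ,1}` at `(z, 2y)`, the substitution `q = 2y` turns `A_{μ,1} δ_{1/2} R` into `BSO`.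
-/

noncomputable section

namespace Dunkl

/-! ### Maximum principles for differential-reflection equations -/

section Radial

variable {V ι : Type*}

theorem mul_norm_le_of_mul_add_sum_sub_le [TopologicalSpace V] {C : Set V}
    (hC : IsCompact C) {g : V → ℂ} (hg : ContinuousOn g C) (s : Finset ι) {c : ι → ℝ}
    (hc : ∀ k ∈ s, 0 ≤ c k) {σ : ι → V → V} (hσ : ∀ k ∈ s, ∀ x ∈ C, σ k x ∈ C) {n B : ℝ}
    (hn : 0 < n) (h : ∀ x ∈ C, ‖(n : ℂ) * g x + ∑ k ∈ s, (c k : ℂ) * (g x - g (σ k x))‖ ≤ B) :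
    ∀ x ∈ C, n * ‖g x‖ ≤ B := by
  intro x hx
  obtain ⟨m, hm, hmax⟩ := hC.exists_isMaxOn ⟨x, hx⟩ hg.norm
  have hsplit : ((n + ∑ k ∈ s, c k : ℝ) : ℂ) * g m =
      ((n : ℂ) * g m + ∑ k ∈ s, (c k : ℂ) * (g m - g (σ k m))) +
        ∑ k ∈ s, (c k : ℂ) * g (σ k m) := by
    simp only [mul_sub, Finset.sum_sub_distrib, ← Finset.sum_mul]
    push_cast
    ring
  have hreflected : ‖∑ k ∈ s, (c k : ℂ) * g (σ k m)‖ ≤ (∑ k ∈ s, c k) * ‖g m‖ := by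
    rw [Finset.sum_mul]
    refine (norm_sum_le _ _).trans (Finset.sum_le_sum fun k hk => ?_)
    rw [norm_mul, Complex.norm_real, Real.norm_of_nonneg (hc k hk)]
    exact mul_le_mul_of_nonneg_left (hmax (hσ k hk m hm)) (hc k hk)
  have hbound : (n + ∑ k ∈ s, c k) * ‖g m‖ ≤ B + (∑ k ∈ s, c k) * ‖g m‖ :=
    calc (n + ∑ k ∈ s, c k) * ‖g m‖ = ‖((n + ∑ k ∈ s, c k : ℝ) : ℂ) * g m‖ := by
          rw [norm_mul, Complex.norm_real,
            Real.norm_of_nonneg (add_nonneg hn.le (Finset.sum_nonneg hc))]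
      _ ≤ _ := by
          rw [hsplit]
          exact norm_add_le_of_le (h m hm) hreflected
  have hle : ‖g x‖ ≤ ‖g m‖ := hmax hx
  nlinarith

theorem inner_self_sub_nonneg {E : Type*} [NormedAddCommGroup E] [InnerProductSpace ℝ E]
    {v w : E} (h : ‖w‖ ≤ ‖v‖) : 0 ≤ ⟪v, v - w⟫ := by
  rw [inner_sub_right, real_inner_self_eq_norm_sq]
  nlinarith [real_inner_le_norm v w, norm_nonneg v]

theorem nonneg_of_hasDerivAt_of_forall_Icc_le {f : ℝ → ℝ} {f' : ℝ} (hf : HasDerivAt f f' 1)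
    (hmax : ∀ t ∈ Set.Icc (0 : ℝ) 1, f t ≤ f 1) : 0 ≤ f' := by
  have hcone : (-1 : ℝ) ∈ posTangentConeAt (Set.Icc (0 : ℝ) 1) 1 :=
    mem_posTangentConeAt_of_segment_subset
      ((convex_Icc 0 1).segment_subset (by simp) (by simp))
  have hloc : IsLocalMaxOn f (Set.Icc 0 1) 1 :=
    Filter.eventually_of_mem self_mem_nhdsWithin hmax
  simpa using hloc.hasFDerivWithinAt_nonpos hf.hasFDerivAt.hasFDerivWithinAt hcone

section

variable [NormedAddCommGroup V] [NormedSpace ℝ V]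

theorem hasDerivAt_norm_smul (x : V) : HasDerivAt (fun t : ℝ => ‖t • x‖) ‖x‖ 1 := by
  have hlin : HasDerivAt (fun t : ℝ => t * ‖x‖) ‖x‖ 1 := by
    simpa using (hasDerivAt_id (1 : ℝ)).mul_const ‖x‖
  refine hlin.congr_of_eventuallyEq ?_
  filter_upwards [lt_mem_nhds (zero_lt_one' ℝ)] with t ht
  rw [norm_smul, Real.norm_of_nonneg ht.le]

/-- Continuous solutions of `x · ∇U(x) + ∑ₖ cₖ (U(x) - U(σₖ x)) = b(x) U(x)`. Only the derivative
along the ray through `x` is asked for, so that the equation makes sense for functions that are not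
known to be differentiable. -/
structure IsRadialSolution (s : Finset ι) (c : ι → ℝ) (σ : ι → V → V) (b U : V → ℂ) : Prop where
  continuous : Continuous U
  hasDerivAt : ∀ x, HasDerivAt (fun t : ℝ => U (t • x))
    (b x * U x - ∑ k ∈ s, (c k : ℂ) * (U x - U (σ k x))) 1

namespace IsRadialSolution

variable {s : Finset ι} {c : ι → ℝ} {σ : ι → V → V} {b U U' : V → ℂ}

theorem sub (h : IsRadialSolution s c σ b U) (h' : IsRadialSolution s c σ b U') :
    IsRadialSolution s c σ b (U - U') where
  continuous := h.continuous.sub h'.continuous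
  hasDerivAt x := by
    refine ((h.hasDerivAt x).sub (h'.hasDerivAt x)).congr_deriv ?_
    simp only [Pi.sub_apply, mul_sub, Finset.sum_sub_distrib]
    ring

theorem const_mul (h : IsRadialSolution s c σ b U) (a : ℂ) :
    IsRadialSolution s c σ b fun x => a * U x where
  continuous := h.continuous.const_mul a
  hasDerivAt x := by
    refine ((h.hasDerivAt x).const_mul a).congr_deriv ?_
    rw [mul_sub, mul_left_comm, Finset.mul_sum]
    simp only [← mul_sub, mul_left_comm a]

theorem cexp_mul (h : IsRadialSolution s c σ b U) {φ φ' : V → ℂ} (hφ : Continuous φ)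
    (hφ' : ∀ x, HasDerivAt (fun t : ℝ => φ (t • x)) (φ' x) 1)
    (hσ : ∀ k ∈ s, ∀ x, φ (σ k x) = φ x) :
    IsRadialSolution s c σ (fun x => b x + φ' x) fun x => Complex.exp (φ x) * U x where
  continuous := by
    have := h.continuous
    fun_prop
  hasDerivAt x := by
    refine ((hφ' x).cexp.mul (h.hasDerivAt x)).congr_deriv ?_
    have hσx : ∀ k ∈ s, (c k : ℂ) * (Complex.exp (φ x) * U x -
        Complex.exp (φ (σ k x)) * U (σ k x)) =
          Complex.exp (φ x) * ((c k : ℂ) * (U x - U (σ k x))) := fun k hk => by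
      rw [hσ k hk x]
      ring
    rw [Finset.sum_congr rfl hσx, ← Finset.mul_sum, one_smul]
    ring

variable [ProperSpace V]

theorem norm_le_norm_zero (h : IsRadialSolution s c σ b U) (hc : ∀ k ∈ s, 0 ≤ c k)
    (hσ : ∀ k ∈ s, ∀ x, ‖σ k x‖ = ‖x‖) (hb : ∀ x ≠ 0, (b x).re < 0) (x : V) :
    ‖U x‖ ≤ ‖U 0‖ := by
  obtain ⟨m, hm, hmax⟩ :=
    (isCompact_closedBall (0 : V) ‖x‖).exists_isMaxOn ⟨x, by simp⟩ h.continuous.norm.continuousOn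
  have hball : ∀ v, ‖v‖ ≤ ‖m‖ → ‖U v‖ ≤ ‖U m‖ := fun v hv =>
    hmax (mem_closedBall_zero_iff.mpr (hv.trans (mem_closedBall_zero_iff.mp hm)))
  have hxm : ‖U x‖ ≤ ‖U m‖ := hmax (by simp)
  rcases eq_or_ne m 0 with rfl | hm0
  · exact hxm
  rcases eq_or_ne (U m) 0 with hUm | hUm
  · exact hxm.trans (by simp [hUm])
  exfalso
  have hrise : 0 ≤ ⟪U m, b m * U m - ∑ k ∈ s, (c k : ℂ) * (U m - U (σ k m))⟫ := by
    have hle : ∀ t ∈ Set.Icc (0 : ℝ) 1, ‖U (t • m)‖ ^ 2 ≤ ‖U ((1 : ℝ) • m)‖ ^ 2 := fun t ht => by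
      have hnorm : ‖t • m‖ ≤ ‖m‖ := by
        rw [norm_smul, Real.norm_of_nonneg ht.1]
        exact mul_le_of_le_one_left (norm_nonneg m) ht.2
      rw [one_smul]
      exact pow_le_pow_left₀ (norm_nonneg _) (hball _ hnorm) 2
    have := nonneg_of_hasDerivAt_of_forall_Icc_le (h.hasDerivAt m).norm_sq hle
    rw [one_smul] at this
    linarith
  have hbm : ⟪U m, b m * U m⟫ = (b m).re * ‖U m‖ ^ 2 := by
    rw [Complex.inner, mul_assoc, Complex.mul_conj', ← Complex.ofReal_pow, Complex.re_mul_ofReal]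
  have hreflected : 0 ≤ ∑ k ∈ s, ⟪U m, (c k : ℂ) * (U m - U (σ k m))⟫ :=
    Finset.sum_nonneg fun k hk => by
      rw [← Complex.real_smul, real_inner_smul_right]
      exact mul_nonneg (hc k hk) (inner_self_sub_nonneg (hball _ (hσ k hk m).le))
  have hfall : (b m).re * ‖U m‖ ^ 2 < 0 :=
    mul_neg_of_neg_of_pos (hb m hm0) (pow_pos (norm_pos_iff.mpr hUm) 2)
  rw [inner_sub_right, hbm, inner_sum] at hrise
  linarith

theorem norm_le (h : IsRadialSolution s c σ b U) (hc : ∀ k ∈ s, 0 ≤ c k)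
    (hσ : ∀ k ∈ s, ∀ x, ‖σ k x‖ = ‖x‖) {K : ℝ} (hb : ∀ x, ‖b x‖ ≤ K * ‖x‖) (x : V) :
    ‖U x‖ ≤ ‖U 0‖ * Real.exp (K * ‖x‖) := by
  have hdamped : ∀ L > K, ‖U x‖ ≤ ‖U 0‖ * Real.exp (L * ‖x‖) := fun L hL => by
    have hre : ∀ v ≠ 0, (b v + -(L * ‖v‖ : ℝ)).re < 0 := fun v hv => by
      have := (Complex.re_le_norm (b v)).trans (hb v)
      have := mul_lt_mul_of_pos_right hL (norm_pos_iff.mpr hv)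
      rw [Complex.add_re, Complex.neg_re, Complex.ofReal_re]
      linarith
    have hdamp : IsRadialSolution s c σ (fun v => b v + -(L * ‖v‖ : ℝ))
        fun v => Complex.exp (-(L * ‖v‖ : ℝ)) * U v :=
      h.cexp_mul (by fun_prop) (fun v => ((hasDerivAt_norm_smul v).const_mul L).ofReal_comp.neg)
        fun k hk v => by rw [hσ k hk]
    have hmax := hdamp.norm_le_norm_zero hc hσ hre x
    simp only [norm_mul, Complex.norm_exp, Complex.neg_re, Complex.ofReal_re, norm_zero, mul_zero,
      neg_zero, Real.exp_zero, one_mul] at hmax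
    calc ‖U x‖ = Real.exp (-(L * ‖x‖)) * ‖U x‖ * Real.exp (L * ‖x‖) := by
          rw [mul_right_comm, ← Real.exp_add]
          simp
      _ ≤ ‖U 0‖ * Real.exp (L * ‖x‖) := by gcongr
  have hlim : Filter.Tendsto (fun L : ℝ => ‖U 0‖ * Real.exp (L * ‖x‖))
      (nhdsWithin K (Set.Ioi K)) (nhds (‖U 0‖ * Real.exp (K * ‖x‖))) :=
    (Continuous.tendsto (by fun_prop) K).mono_left nhdsWithin_le_nhds
  exact ge_of_tendsto hlim (Filter.eventually_of_mem self_mem_nhdsWithin hdamped)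

theorem eq_of_apply_zero_eq (h : IsRadialSolution s c σ b U) (h' : IsRadialSolution s c σ b U')
    (hc : ∀ k ∈ s, 0 ≤ c k) (hσ : ∀ k ∈ s, ∀ x, ‖σ k x‖ = ‖x‖) {K : ℝ}
    (hb : ∀ x, ‖b x‖ ≤ K * ‖x‖) (h0 : U 0 = U' 0) : U = U' := by
  funext x
  have := (h.sub h').norm_le hc hσ hb x
  simpa [h0, sub_eq_zero] using this

end IsRadialSolution

end

end Radial

/-! ### The complexification of `ℝ^N` -/

section Complexification

variable {N : ℕ}

/-- The inclusion `toPhase` of `ℝ^N` in `ℂ^N`, bundled as a linear isometry. -/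
def phaseEmbedding (N : ℕ) : ConfigSpace N →ₗᵢ[ℝ] PhaseSpace N where
  toFun := toPhase
  map_add' x y := by ext j; simp [toPhase]
  map_smul' c x := by ext j; simp [toPhase]
  norm_map' x := by simp [toPhase, EuclideanSpace.norm_eq]

@[simp] theorem toPhase_apply (x : ConfigSpace N) (j : Fin N) : toPhase x j = (x j : ℂ) := rfl

@[simp] theorem toPhase_zero : toPhase (0 : ConfigSpace N) = 0 := (phaseEmbedding N).map_zero

@[simp] theorem norm_toPhase (x : ConfigSpace N) : ‖toPhase x‖ = ‖x‖ :=
  (phaseEmbedding N).norm_map x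

theorem toPhase_smul (c : ℝ) (x : ConfigSpace N) : toPhase (c • x) = c • toPhase x :=
  (phaseEmbedding N).map_smul c x

@[fun_prop]
theorem continuous_toPhase : Continuous (toPhase (N := N)) := (phaseEmbedding N).continuous

@[simp] theorem conjPhase_apply (z : PhaseSpace N) (j : Fin N) :
    conjPhase z j = (starRingEnd ℂ) (z j) := rfl

@[simp] theorem norm_conjPhase (z : PhaseSpace N) : ‖conjPhase z‖ = ‖z‖ := by
  simp [EuclideanSpace.norm_eq]

@[simp] theorem conjPhase_conjPhase (z : PhaseSpace N) : conjPhase (conjPhase z) = z := by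
  ext j; simp

@[simp] theorem conjPhase_toPhase (x : ConfigSpace N) : conjPhase (toPhase x) = toPhase x := by
  ext j; simp

theorem conjPhase_smul (c : ℂ) (z : PhaseSpace N) :
    conjPhase (c • z) = (starRingEnd ℂ) c • conjPhase z := by
  ext j; simp

@[fun_prop]
theorem continuous_conjPhase : Continuous (conjPhase (N := N)) := by
  unfold conjPhase
  fun_prop

theorem map_eq_sum_single {M : Type*} [AddCommMonoid M] [Module ℂ M] (g : PhaseSpace N →ₗ[ℂ] M)
    (v : PhaseSpace N) : g v = ∑ i, v i • g (EuclideanSpace.single i 1) := by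
  have hv : v = ∑ i, v i • EuclideanSpace.single i (1 : ℂ) := by
    ext j
    simp [Pi.single_apply]
  conv_lhs => rw [hv]
  simp only [map_sum, map_smul]

/-- The complex bilinear extension to `ℂ^N` of the inner product of `ℝ^N`. -/
def bil : PhaseSpace N →ₗ[ℂ] PhaseSpace N →ₗ[ℂ] ℂ :=
  LinearMap.mk₂ ℂ (fun x y => ∑ j, x j * y j)
    (fun x x' y => by simp [add_mul, Finset.sum_add_distrib])
    (fun c x y => by simp [Finset.mul_sum, mul_assoc])
    (fun x y y' => by simp [mul_add, Finset.sum_add_distrib])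
    (fun c x y => by simp [Finset.mul_sum, mul_left_comm])

theorem bil_apply (x y : PhaseSpace N) : bil x y = ∑ j, x j * y j := rfl

theorem bil_comm (x y : PhaseSpace N) : bil x y = bil y x := by simp [bil_apply, mul_comm]

theorem bil_self (z : PhaseSpace N) : bil z z = holoSq z := by simp [bil_apply, holoSq, sq]

theorem bil_toPhase (x y : ConfigSpace N) : bil (toPhase x) (toPhase y) = (⟪x, y⟫ : ℂ) := by
  simp [bil_apply, PiLp.inner_apply, mul_comm]

theorem bil_conjPhase (x y : PhaseSpace N) :
    bil (conjPhase x) (conjPhase y) = (starRingEnd ℂ) (bil x y) := by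
  simp [bil_apply]

theorem bil_eq_inner (x y : PhaseSpace N) : bil x y = inner ℂ (conjPhase x) y := by
  simp [bil_apply, PiLp.inner_apply, mul_comm]

theorem norm_bil_le (x y : PhaseSpace N) : ‖bil x y‖ ≤ ‖x‖ * ‖y‖ := by
  rw [bil_eq_inner, ← norm_conjPhase x]
  exact norm_inner_le_norm _ _

theorem differentiable_holoSq : Differentiable ℂ (holoSq (N := N)) := by
  unfold holoSq
  fun_prop

theorem refl_apply {α : ConfigSpace N} (hα : ‖α‖ ^ 2 = 2) (x : ConfigSpace N) :
    refl α x = x - ⟪α, x⟫ • α := by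
  rw [refl, Submodule.reflection_orthogonal_apply, Submodule.reflection_singleton_apply,
    RCLike.ofReal_real_eq_id, id_eq, hα, neg_sub, ← Nat.cast_smul_eq_nsmul ℝ, smul_smul]
  congr 2
  push_cast
  ring

/-- The complex linear extension to `ℂ^N` of the reflection `σ_α` in a vector with `‖α‖² = 2`. -/
def phaseRefl (α : ConfigSpace N) : Module.End ℂ (PhaseSpace N) :=
  Module.preReflection (toPhase α) (bil (toPhase α))

theorem phaseRefl_apply (α : ConfigSpace N) (z : PhaseSpace N) :
    phaseRefl α z = z - bil (toPhase α) z • toPhase α := Module.preReflection_apply _ _ _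

theorem differentiable_phaseRefl (α : ConfigSpace N) : Differentiable ℂ (phaseRefl α) :=
  (LinearMap.toContinuousLinearMap (phaseRefl α)).differentiable

theorem phaseRefl_conjPhase (α : ConfigSpace N) (z : PhaseSpace N) :
    phaseRefl α (conjPhase z) = conjPhase (phaseRefl α z) := by
  have h : bil (toPhase α) (conjPhase z) = (starRingEnd ℂ) (bil (toPhase α) z) := by
    rw [← bil_conjPhase, conjPhase_toPhase]
  ext j
  simp [phaseRefl_apply, h]

theorem bil_phaseRefl_left (α : ConfigSpace N) (z w : PhaseSpace N) :
    bil (phaseRefl α z) w = bil z (phaseRefl α w) := by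
  simp only [phaseRefl_apply, map_sub, map_smul, LinearMap.sub_apply, LinearMap.smul_apply,
    smul_eq_mul, bil_comm z (toPhase α)]
  ring

section UnitRoot

variable {α : ConfigSpace N} (hα : ‖α‖ ^ 2 = 2)

include hα

theorem bil_toPhase_self : bil (toPhase α) (toPhase α) = 2 := by
  rw [bil_toPhase, real_inner_self_eq_norm_sq, hα]
  norm_num

theorem toPhase_refl (x : ConfigSpace N) : toPhase (refl α x) = phaseRefl α (toPhase x) := by
  rw [refl_apply hα, phaseRefl_apply, bil_toPhase]
  ext j
  simp

theorem phaseRefl_phaseRefl (z : PhaseSpace N) : phaseRefl α (phaseRefl α z) = z :=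
  Module.involutive_preReflection (bil_toPhase_self hα) z

theorem bil_phaseRefl_phaseRefl (z w : PhaseSpace N) :
    bil (phaseRefl α z) (phaseRefl α w) = bil z w := by
  rw [bil_phaseRefl_left, phaseRefl_phaseRefl hα]

theorem norm_phaseRefl (z : PhaseSpace N) : ‖phaseRefl α z‖ = ‖z‖ := by
  have h : inner ℂ (phaseRefl α z) (phaseRefl α z) = inner ℂ z z := by
    rw [← conjPhase_conjPhase (phaseRefl α z), ← bil_eq_inner, conjPhase_conjPhase,
      ← phaseRefl_conjPhase, bil_phaseRefl_phaseRefl hα, bil_eq_inner, conjPhase_conjPhase]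
  rw [inner_self_eq_norm_sq_to_K, inner_self_eq_norm_sq_to_K] at h
  exact (pow_left_inj₀ (norm_nonneg _) (norm_nonneg _) two_ne_zero).mp (by exact_mod_cast h)

theorem holoSq_phaseRefl (z : PhaseSpace N) : holoSq (phaseRefl α z) = holoSq z := by
  rw [← bil_self, bil_phaseRefl_phaseRefl hα, bil_self]

theorem phaseRefl_phaseRefl_eq_phaseRefl_refl (β : ConfigSpace N) (z : PhaseSpace N) :
    phaseRefl α (phaseRefl β z) = phaseRefl (refl α β) (phaseRefl α z) := by
  rw [phaseRefl_apply β, phaseRefl_apply (refl α β), toPhase_refl hα,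
    bil_phaseRefl_phaseRefl hα, map_sub, map_smul]

end UnitRoot

end Complexification

/-! ### Dunkl operators on polynomials -/

section PolynomialDunklOperators

variable {N : ℕ} {𝓡 : Finset (ConfigSpace N)} {μ : ConfigSpace N → ℝ}

@[to_additive]
theorem IsRootSystem.prod_comp_refl {M : Type*} [CommMonoid M] (h𝓡 : IsRootSystem 𝓡)
    {α : ConfigSpace N} (hα : α ∈ 𝓡) (f : ConfigSpace N → M) :
    ∏ β ∈ 𝓡, f (refl α β) = ∏ β ∈ 𝓡, f β := by
  have hmem : ∀ β ∈ 𝓡, refl α β ∈ 𝓡 := fun β hβ => by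
    have : refl α β ∈ (refl α) '' (𝓡 : Set (ConfigSpace N)) := ⟨β, hβ, rfl⟩
    rwa [h𝓡.image_refl α hα] at this
  have hinv : ∀ β, refl α (refl α β) = β := fun β => Submodule.reflection_reflection _ β
  exact Finset.prod_bij' (fun β _ => refl α β) (fun β _ => refl α β) hmem hmem
    (fun β _ => hinv β) (fun β _ => hinv β) (fun β _ => rfl)

theorem IsMultiplicity.apply_refl (hμ : IsMultiplicity 𝓡 μ) {α β : ConfigSpace N} (hα : α ∈ 𝓡)
    (hβ : β ∈ 𝓡) : μ (refl α β) = μ β :=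
  hμ.invariant _ (Subgroup.subset_closure ⟨α, hα, rfl⟩) β hβ

theorem IsMultiplicity.half_nonneg (hμ : IsMultiplicity 𝓡 μ) : ∀ α ∈ 𝓡, 0 ≤ μ α / 2 :=
  fun α hα => div_nonneg (hμ.nonneg α hα) zero_le_two

/-- The algebra of polynomial functions on `ℂ^N`. -/
abbrev PhasePoly (N : ℕ) : Type := MvPolynomial (Fin N) ℂ

/-- Evaluation of polynomials at a point of `ℂ^N`. -/
def evalAt (x : PhaseSpace N) : PhasePoly N →ₐ[ℂ] ℂ := MvPolynomial.aeval x.ofLp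

@[simp] theorem evalAt_X (x : PhaseSpace N) (i : Fin N) : evalAt x (MvPolynomial.X i) = x i :=
  MvPolynomial.aeval_X _ _

theorem PhasePoly.ext {p q : PhasePoly N} (h : ∀ x, evalAt x p = evalAt x q) : p = q :=
  MvPolynomial.funext fun x => by
    simpa only [evalAt, MvPolynomial.aeval_eq_eval] using h (WithLp.toLp 2 x)

theorem differentiable_evalAt (p : PhasePoly N) :
    Differentiable ℂ fun x : PhaseSpace N => evalAt x p := by
  induction p using MvPolynomial.induction_on with
  | C a => simp
  | add p q hp hq =>
    simp only [map_add]
    exact hp.fun_add hq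
  | mul_X p i hp =>
    simp only [map_mul, evalAt_X]
    exact hp.mul (by fun_prop)

/-- The linear form `x ↦ ∑ vᵢ xᵢ` as a polynomial. -/
def linForm : PhaseSpace N →ₗ[ℂ] PhasePoly N where
  toFun v := ∑ i, v i • MvPolynomial.X i
  map_add' v w := by simp [add_smul, Finset.sum_add_distrib]
  map_smul' a v := by simp [mul_smul, Finset.smul_sum]

theorem linForm_apply (v : PhaseSpace N) : linForm v = ∑ i, v i • MvPolynomial.X i := rfl

@[simp] theorem evalAt_linForm (x v : PhaseSpace N) : evalAt x (linForm v) = bil v x := by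
  simp [linForm_apply, bil_apply]

theorem linForm_single (i : Fin N) :
    linForm (EuclideanSpace.single i (1 : ℂ)) = MvPolynomial.X i :=
  PhasePoly.ext fun x => by simp [bil_apply]

theorem isHomogeneous_linForm (v : PhaseSpace N) : (linForm v).IsHomogeneous 1 :=
  MvPolynomial.IsHomogeneous.sum _ _ _ fun i _ =>
    (MvPolynomial.homogeneousSubmodule (Fin N) ℂ 1).smul_mem _ (MvPolynomial.isHomogeneous_X ℂ i)

/-- The action of the reflection `σ_α` on polynomials. -/
def polyRefl (α : ConfigSpace N) : PhasePoly N →ₐ[ℂ] PhasePoly N :=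
  MvPolynomial.aeval fun i => MvPolynomial.X i - toPhase α i • linForm (toPhase α)

@[simp] theorem polyRefl_X (α : ConfigSpace N) (i : Fin N) :
    polyRefl α (MvPolynomial.X i) = MvPolynomial.X i - toPhase α i • linForm (toPhase α) :=
  MvPolynomial.aeval_X _ _

@[simp] theorem polyRefl_C (α : ConfigSpace N) (a : ℂ) :
    polyRefl α (MvPolynomial.C a) = MvPolynomial.C a := (polyRefl α).commutes a

@[simp] theorem evalAt_polyRefl (α : ConfigSpace N) (x : PhaseSpace N) (p : PhasePoly N) :
    evalAt x (polyRefl α p) = evalAt (phaseRefl α x) p := by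
  induction p using MvPolynomial.induction_on with
  | C a => simp
  | add p q hp hq => simp [hp, hq]
  | mul_X p i hp =>
    rw [map_mul, map_mul, map_mul, hp, polyRefl_X, map_sub, map_smul, evalAt_linForm, evalAt_X,
      evalAt_X, phaseRefl_apply, PiLp.sub_apply, PiLp.smul_apply, smul_eq_mul, smul_eq_mul,
      mul_comm (bil _ _)]

theorem polyRefl_linForm (α : ConfigSpace N) (v : PhaseSpace N) :
    polyRefl α (linForm v) = linForm (phaseRefl α v) :=
  PhasePoly.ext fun x => by simp [bil_phaseRefl_left]

theorem polyRefl_polyRefl_eq_polyRefl_refl {α : ConfigSpace N} (hα : ‖α‖ ^ 2 = 2)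
    (β : ConfigSpace N) (p : PhasePoly N) :
    polyRefl β (polyRefl α p) = polyRefl α (polyRefl (refl α β) p) :=
  PhasePoly.ext fun x => by
    simp only [evalAt_polyRefl, phaseRefl_phaseRefl_eq_phaseRefl_refl hα]

theorem isHomogeneous_polyRefl (α : ConfigSpace N) {p : PhasePoly N} {n : ℕ}
    (hp : p.IsHomogeneous n) : (polyRefl α p).IsHomogeneous n := by
  have := hp.aeval (n := 1) (fun i => MvPolynomial.X i - toPhase α i • linForm (toPhase α))
    fun i => (MvPolynomial.isHomogeneous_X ℂ i).sub
      ((MvPolynomial.homogeneousSubmodule (Fin N) ℂ 1).smul_mem _ (isHomogeneous_linForm _))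
  rwa [one_mul] at this

theorem linForm_dvd_sub_polyRefl (α : ConfigSpace N) (p : PhasePoly N) :
    linForm (toPhase α) ∣ p - polyRefl α p := by
  induction p using MvPolynomial.induction_on with
  | C a => simp
  | add p q hp hq =>
    rw [map_add, add_sub_add_comm]
    exact dvd_add hp hq
  | mul_X p i hp =>
    have : p * MvPolynomial.X i - polyRefl α (p * MvPolynomial.X i) =
        (p - polyRefl α p) * MvPolynomial.X i +
          linForm (toPhase α) * (polyRefl α p * MvPolynomial.C (toPhase α i)) := by
      rw [map_mul, polyRefl_X, MvPolynomial.smul_eq_C_mul]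
      ring
    rw [this]
    exact dvd_add (hp.mul_right _) (dvd_mul_right _ _)

/-- The derivative of polynomials in a constant direction. -/
def polyDeriv : PhaseSpace N →ₗ[ℂ] Derivation ℂ (PhasePoly N) (PhasePoly N) where
  toFun v := MvPolynomial.mkDerivation ℂ fun i => MvPolynomial.C (v i)
  map_add' v w := MvPolynomial.derivation_ext fun i => by simp [MvPolynomial.mkDerivation_X]
  map_smul' a v := MvPolynomial.derivation_ext fun i => by
    simp [MvPolynomial.mkDerivation_X, MvPolynomial.smul_eq_C_mul]

@[simp] theorem polyDeriv_X (v : PhaseSpace N) (i : Fin N) :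
    polyDeriv v (MvPolynomial.X i) = MvPolynomial.C (v i) := MvPolynomial.mkDerivation_X _ _ _

theorem polyDeriv_linForm (v w : PhaseSpace N) :
    polyDeriv v (linForm w) = MvPolynomial.C (bil v w) := by
  simp [linForm_apply, bil_apply, MvPolynomial.smul_eq_C_mul, mul_comm]

theorem fderiv_evalAt (p : PhasePoly N) (x v : PhaseSpace N) :
    fderiv ℂ (fun x => evalAt x p) x v = evalAt x (polyDeriv v p) := by
  induction p using MvPolynomial.induction_on with
  | C a => simp
  | add p q hp hq =>
    simp only [map_add]
    rw [fderiv_fun_add (differentiable_evalAt p x) (differentiable_evalAt q x), add_apply, hp, hq]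
  | mul_X p i hp =>
    have hX : HasFDerivAt (fun x : PhaseSpace N => x i)
        (EuclideanSpace.proj i : PhaseSpace N →L[ℂ] ℂ) x :=
      (EuclideanSpace.proj i : PhaseSpace N →L[ℂ] ℂ).hasFDerivAt
    simp only [map_mul, evalAt_X]
    rw [((differentiable_evalAt p x).hasFDerivAt.fun_mul hX).fderiv]
    simp [Derivation.leibniz, hp]

theorem polyDeriv_polyRefl (α : ConfigSpace N) (v : PhaseSpace N) (p : PhasePoly N) :
    polyDeriv v (polyRefl α p) = polyRefl α (polyDeriv (phaseRefl α v) p) := by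
  induction p using MvPolynomial.induction_on with
  | C a => simp
  | add p q hp hq => simp [hp, hq]
  | mul_X p i hp =>
    have hX : polyDeriv v (polyRefl α (MvPolynomial.X i)) =
        polyRefl α (polyDeriv (phaseRefl α v) (MvPolynomial.X i)) := by
      rw [polyRefl_X, polyDeriv_X, polyRefl_C, map_sub, Derivation.map_smul, polyDeriv_linForm,
        polyDeriv_X, phaseRefl_apply, PiLp.sub_apply, PiLp.smul_apply, smul_eq_mul,
        MvPolynomial.smul_eq_C_mul, ← map_mul, ← map_sub, bil_comm v, mul_comm]
    rw [map_mul, Derivation.leibniz, hp, hX, Derivation.leibniz]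
    simp only [smul_eq_mul, map_add, map_mul]

/-- The Euler vector field `∑ xᵢ ∂ᵢ` on polynomials. -/
def polyEuler : Derivation ℂ (PhasePoly N) (PhasePoly N) :=
  MvPolynomial.mkDerivation ℂ MvPolynomial.X

theorem polyEuler_X (i : Fin N) :
    polyEuler (MvPolynomial.X i : PhasePoly N) = MvPolynomial.X i :=
  MvPolynomial.mkDerivation_X _ _ _

theorem polyEuler_linForm (v : PhaseSpace N) : polyEuler (linForm v) = linForm v := by
  simp [linForm_apply, polyEuler_X]

theorem evalAt_polyEuler (x : PhaseSpace N) (p : PhasePoly N) :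
    evalAt x (polyEuler p) = evalAt x (polyDeriv x p) := by
  induction p using MvPolynomial.induction_on with
  | C a => simp [polyEuler]
  | add p q hp hq => simp [hp, hq]
  | mul_X p i hp => simp [hp, polyEuler_X]

theorem polyEuler_eq_sum (p : PhasePoly N) :
    polyEuler p = ∑ i, MvPolynomial.X i * polyDeriv (EuclideanSpace.single i 1) p :=
  PhasePoly.ext fun x => by
    rw [evalAt_polyEuler, map_eq_sum_single polyDeriv x, ← Derivation.coeFnAddMonoidHom_apply,
      map_sum, Finset.sum_apply]
    simp

theorem polyEuler_of_isHomogeneous {p : PhasePoly N} {n : ℕ} (hp : p.IsHomogeneous n) :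
    polyEuler p = (n : ℂ) • p := by
  have hsingle (i : Fin N) : polyDeriv (EuclideanSpace.single i 1) = MvPolynomial.pderiv i :=
    MvPolynomial.derivation_ext fun j => by
      simp [MvPolynomial.pderiv_X, Pi.single_apply, eq_comm]
  simp only [polyEuler_eq_sum, hsingle]
  rw [hp.sum_X_mul_pderiv, Nat.cast_smul_eq_nsmul]

theorem polyEuler_polyDeriv (v : PhaseSpace N) (p : PhasePoly N) :
    polyEuler (polyDeriv v p) = polyDeriv v (polyEuler p) - polyDeriv v p := by
  have h : ⁅(polyEuler : Derivation ℂ (PhasePoly N) _), polyDeriv v⁆ = -polyDeriv v :=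
    MvPolynomial.derivation_ext fun i => by
      simp [Derivation.commutator_apply, polyEuler]
  have := DFunLike.congr_fun h p
  rw [Derivation.commutator_apply, Derivation.neg_apply] at this
  rw [sub_eq_iff_eq_add.mp this]
  ring

/-- The divided difference `(p - σ_α p) / ⟨α, ·⟩` of polynomials. The left inverse of the
multiplication by the linear form of `α` is meaningful on its range, which contains every
`p - σ_α p`; for `α = 0` it takes a junk value. -/
def divDiff (α : ConfigSpace N) : Module.End ℂ (PhasePoly N) :=
  (LinearMap.mulLeft ℂ (linForm (toPhase α))).leftInverse ∘ₗ
    (LinearMap.id - (polyRefl α).toLinearMap)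

section DivDiff

variable {α : ConfigSpace N} (hα : ‖α‖ ^ 2 = 2)

include hα

theorem linForm_toPhase_ne_zero : linForm (toPhase α) ≠ 0 := fun h => by
  have := evalAt_linForm (toPhase α) (toPhase α)
  rw [h, map_zero, bil_toPhase_self hα] at this
  norm_num at this

theorem linForm_mul_divDiff (p : PhasePoly N) :
    linForm (toPhase α) * divDiff α p = p - polyRefl α p := by
  obtain ⟨q, hq⟩ := linForm_dvd_sub_polyRefl α p
  have hker : (LinearMap.mulLeft ℂ (linForm (toPhase α))).ker = ⊥ :=
    LinearMap.ker_eq_bot.mpr (mul_right_injective₀ (linForm_toPhase_ne_zero hα))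
  have hdiv : divDiff α p = q := by
    have := LinearMap.leftInverse_apply_of_inj hker q
    rwa [LinearMap.mulLeft_apply, ← hq] at this
  rw [hdiv, hq]

theorem divDiff_eq {p q : PhasePoly N} (h : linForm (toPhase α) * q = p - polyRefl α p) :
    divDiff α p = q :=
  mul_left_cancel₀ (linForm_toPhase_ne_zero hα) ((linForm_mul_divDiff hα p).trans h.symm)

theorem divDiff_one : divDiff α (1 : PhasePoly N) = 0 := divDiff_eq hα (by simp)

theorem divDiff_linForm_mul (w : PhaseSpace N) (p : PhasePoly N) :
    divDiff α (linForm w * p) =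
      linForm w * divDiff α p + bil (toPhase α) w • polyRefl α p := by
  refine divDiff_eq hα ?_
  rw [mul_add, mul_left_comm, linForm_mul_divDiff hα, map_mul, polyRefl_linForm, phaseRefl_apply,
    map_sub, map_smul, MvPolynomial.smul_eq_C_mul, MvPolynomial.smul_eq_C_mul]
  ring

theorem divDiff_polyRefl {β : ConfigSpace N} (hβ : ‖β‖ ^ 2 = 2) (p : PhasePoly N) :
    divDiff β (polyRefl α p) = polyRefl α (divDiff (refl α β) p) := by
  refine divDiff_eq hβ ?_
  have h : linForm (toPhase β) = polyRefl α (linForm (toPhase (refl α β))) := by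
    rw [polyRefl_linForm, toPhase_refl hα, phaseRefl_phaseRefl hα]
  rw [h, ← map_mul, linForm_mul_divDiff (by rw [LinearIsometryEquiv.norm_map, hβ]), map_sub,
    polyRefl_polyRefl_eq_polyRefl_refl hα]

theorem polyEuler_divDiff {p : PhasePoly N} {n : ℕ} (hp : p.IsHomogeneous (n + 1)) :
    polyEuler (divDiff α p) = (n : ℂ) • divDiff α p := by
  refine mul_left_cancel₀ (linForm_toPhase_ne_zero hα) ?_
  have h := congrArg polyEuler (linForm_mul_divDiff hα p)
  rw [polyEuler_of_isHomogeneous (hp.sub (isHomogeneous_polyRefl α hp)),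
    ← linForm_mul_divDiff hα, Derivation.leibniz, polyEuler_linForm, smul_eq_mul, smul_eq_mul] at h
  rw [eq_sub_of_add_eq h, MvPolynomial.smul_eq_C_mul, MvPolynomial.smul_eq_C_mul]
  push_cast
  rw [map_add, map_one]
  ring

end DivDiff

/-- The Dunkl operator in the direction `v`, acting on polynomials. -/
def polyDunkl (𝓡 : Finset (ConfigSpace N)) (μ : ConfigSpace N → ℝ) :
    PhaseSpace N →ₗ[ℂ] Module.End ℂ (PhasePoly N) where
  toFun v := (polyDeriv v).toLinearMap +
    ∑ β ∈ 𝓡, (((μ β / 2 : ℝ) : ℂ) * bil (toPhase β) v) • divDiff β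
  map_add' v w := by
    simp only [map_add, Derivation.coe_add_linearMap, mul_add, add_smul, Finset.sum_add_distrib]
    abel
  map_smul' a v := by
    simp only [map_smul, Derivation.coe_smul_linearMap, smul_add, Finset.smul_sum, smul_smul,
      smul_eq_mul, mul_left_comm, RingHom.id_apply]

theorem polyDunkl_apply (v : PhaseSpace N) (p : PhasePoly N) :
    polyDunkl 𝓡 μ v p = polyDeriv v p +
      ∑ β ∈ 𝓡, (((μ β / 2 : ℝ) : ℂ) * bil (toPhase β) v) • divDiff β p := by
  simp [polyDunkl]

theorem polyDunkl_phaseRefl (β : ConfigSpace N) (v : PhaseSpace N) :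
    polyDunkl 𝓡 μ (phaseRefl β v) =
      polyDunkl 𝓡 μ v - bil (toPhase β) v • polyDunkl 𝓡 μ (toPhase β) := by
  rw [phaseRefl_apply, map_sub, map_smul]

/-- The reflection `σ_α` as an endomorphism of the space of polynomials, so that it can be composed
and bracketed with Dunkl operators. -/
def reflEnd (α : ConfigSpace N) : Module.End ℂ (PhasePoly N) := (polyRefl α).toLinearMap

@[simp] theorem reflEnd_apply (α : ConfigSpace N) (p : PhasePoly N) :
    reflEnd α p = polyRefl α p := rfl

/-- The operator `∑ xᵢ Tᵢ`, in terms of the Euler vector field. -/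
def dunklEuler (𝓡 : Finset (ConfigSpace N)) (μ : ConfigSpace N → ℝ) :
    Module.End ℂ (PhasePoly N) :=
  polyEuler.toLinearMap +
    ∑ β ∈ 𝓡, ((μ β / 2 : ℝ) : ℂ) • (1 - reflEnd β)

theorem dunklEuler_apply (p : PhasePoly N) : dunklEuler 𝓡 μ p =
    polyEuler p + ∑ β ∈ 𝓡, ((μ β / 2 : ℝ) : ℂ) • (p - polyRefl β p) := by
  simp [dunklEuler]

theorem evalAt_dunklEuler (x : PhaseSpace N) (p : PhasePoly N) :
    evalAt x (dunklEuler 𝓡 μ p) = evalAt x (polyEuler p) +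
      ∑ β ∈ 𝓡, ((μ β / 2 : ℝ) : ℂ) * (evalAt x p - evalAt (phaseRefl β x) p) := by
  simp [dunklEuler_apply]

section RootSystem

variable (h𝓡 : IsRootSystem 𝓡)

include h𝓡

theorem polyDunkl_one (v : PhaseSpace N) : polyDunkl 𝓡 μ v 1 = 0 := by
  rw [polyDunkl_apply, Derivation.map_one_eq_zero, zero_add]
  exact Finset.sum_eq_zero fun α hα => by rw [divDiff_one (h𝓡.norm_sq α hα), smul_zero]

theorem polyDunkl_linForm_mul (v w : PhaseSpace N) (p : PhasePoly N) :
    polyDunkl 𝓡 μ v (linForm w * p) = linForm w * polyDunkl 𝓡 μ v p + (bil v w • p +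
      ∑ β ∈ 𝓡, (((μ β / 2 : ℝ) : ℂ) * bil (toPhase β) v * bil (toPhase β) w) • polyRefl β p) := by
  have h : ∀ β ∈ 𝓡, (((μ β / 2 : ℝ) : ℂ) * bil (toPhase β) v) • divDiff β (linForm w * p) =
      linForm w * ((((μ β / 2 : ℝ) : ℂ) * bil (toPhase β) v) • divDiff β p) +
      (((μ β / 2 : ℝ) : ℂ) * bil (toPhase β) v * bil (toPhase β) w) • polyRefl β p := by
    intro β hβ
    rw [divDiff_linForm_mul (h𝓡.norm_sq β hβ), smul_add, mul_smul_comm, smul_smul]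
  rw [polyDunkl_apply, polyDunkl_apply, Finset.sum_congr rfl h, Finset.sum_add_distrib,
    Derivation.leibniz, polyDeriv_linForm, mul_add, ← Finset.mul_sum, smul_eq_mul, smul_eq_mul,
    MvPolynomial.smul_eq_C_mul p (bil v w)]
  ring

theorem lie_polyDunkl_lmul_linForm (v w : PhaseSpace N) :
    ⁅polyDunkl 𝓡 μ v, Algebra.lmul ℂ (PhasePoly N) (linForm w)⁆ = bil v w • 1 +
      ∑ β ∈ 𝓡, (((μ β / 2 : ℝ) : ℂ) * bil (toPhase β) v * bil (toPhase β) w) • reflEnd β := by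
  refine LinearMap.ext fun p => ?_
  simp [Ring.lie_def, polyDunkl_linForm_mul h𝓡]

theorem polyEuler_polyDunkl (v : PhaseSpace N) {p : PhasePoly N} {n : ℕ}
    (hp : p.IsHomogeneous (n + 1)) :
    polyEuler (polyDunkl 𝓡 μ v p) = (n : ℂ) • polyDunkl 𝓡 μ v p := by
  have hderiv : polyEuler (polyDeriv v p) = (n : ℂ) • polyDeriv v p := by
    rw [polyEuler_polyDeriv, polyEuler_of_isHomogeneous hp, Derivation.map_smul, Nat.cast_succ,
      add_smul, one_smul, add_sub_cancel_right]
  rw [polyDunkl_apply, map_add, map_sum, hderiv, smul_add, Finset.smul_sum]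
  congr 1
  exact Finset.sum_congr rfl fun β hβ => by
    rw [Derivation.map_smul, polyEuler_divDiff (h𝓡.norm_sq β hβ) hp, smul_comm]

theorem dunklEuler_eq_sum : dunklEuler 𝓡 μ =
    ∑ i, Algebra.lmul ℂ (PhasePoly N) (linForm (EuclideanSpace.single i 1)) *
      polyDunkl 𝓡 μ (EuclideanSpace.single i 1) := by
  refine LinearMap.ext fun p => ?_
  have h : ∀ β ∈ 𝓡, ((μ β / 2 : ℝ) : ℂ) • (p - polyRefl β p) =
      ∑ i, linForm (EuclideanSpace.single i 1) * (((μ β / 2 : ℝ) : ℂ) *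
        bil (toPhase β) (EuclideanSpace.single i 1)) • divDiff β p := by
    intro β hβ
    rw [← linForm_mul_divDiff (h𝓡.norm_sq β hβ), linForm_apply, Finset.sum_mul, Finset.smul_sum]
    refine Finset.sum_congr rfl fun i _ => ?_
    rw [linForm_single, bil_apply]
    simp [mul_smul]
  rw [dunklEuler_apply, Finset.sum_congr rfl h, Finset.sum_comm, polyEuler_eq_sum,
    LinearMap.sum_apply, ← Finset.sum_add_distrib]
  refine Finset.sum_congr rfl fun i _ => ?_
  rw [Module.End.mul_apply, Algebra.coe_lmul_eq_mul, LinearMap.mul_apply', polyDunkl_apply,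
    mul_add, Finset.mul_sum, linForm_single]

variable (hμ : IsMultiplicity 𝓡 μ)

include hμ

theorem polyDunkl_polyRefl {α : ConfigSpace N} (hα : α ∈ 𝓡) (v : PhaseSpace N)
    (p : PhasePoly N) :
    polyDunkl 𝓡 μ v (polyRefl α p) = polyRefl α (polyDunkl 𝓡 μ (phaseRefl α v) p) := by
  have hn := h𝓡.norm_sq α hα
  rw [polyDunkl_apply, polyDunkl_apply, polyDeriv_polyRefl, map_add, map_sum,
    ← h𝓡.sum_comp_refl hα fun β => polyRefl α
      ((((μ β / 2 : ℝ) : ℂ) * bil (toPhase β) (phaseRefl α v)) • divDiff β p)]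
  congr 1
  refine Finset.sum_congr rfl fun β hβ => ?_
  rw [toPhase_refl hn, bil_phaseRefl_phaseRefl hn, hμ.apply_refl hα hβ, map_smul,
    divDiff_polyRefl hn (h𝓡.norm_sq β hβ)]

theorem lie_polyDunkl_polyRefl {β : ConfigSpace N} (hβ : β ∈ 𝓡) (v : PhaseSpace N) :
    ⁅polyDunkl 𝓡 μ v, reflEnd β⁆ =
      -(bil (toPhase β) v • (reflEnd β * polyDunkl 𝓡 μ (toPhase β))) := by
  refine LinearMap.ext fun p => ?_
  simp [Ring.lie_def, polyDunkl_polyRefl h𝓡 hμ hβ, polyDunkl_phaseRefl]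

omit h𝓡 hμ in
theorem eq_zero_of_lie_lmul_linForm {D : Module.End ℂ (PhasePoly N)}
    (h : ∀ u, ⁅D, Algebra.lmul ℂ (PhasePoly N) (linForm u)⁆ = 0) (h1 : D 1 = 0) : D = 0 := by
  refine LinearMap.ext fun p => ?_
  induction p using MvPolynomial.induction_on with
  | C a => rw [MvPolynomial.C_eq_smul_one, map_smul, h1, smul_zero, LinearMap.zero_apply]
  | add p q hp hq => rw [map_add, hp, hq, map_add]
  | mul_X p i hp =>
    have := LinearMap.congr_fun (h (EuclideanSpace.single i 1)) p
    rw [Ring.lie_def, linForm_single, LinearMap.sub_apply, Module.End.mul_apply,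
      Module.End.mul_apply, hp] at this
    simpa [mul_comm] using this

theorem lie_polyDunkl_polyDunkl (v w : PhaseSpace N) : ⁅polyDunkl 𝓡 μ v, polyDunkl 𝓡 μ w⁆ = 0 := by
  have hdouble : ∀ v w u : PhaseSpace N,
      ⁅polyDunkl 𝓡 μ v, ⁅polyDunkl 𝓡 μ w, Algebra.lmul ℂ (PhasePoly N) (linForm u)⁆⁆ =
        -∑ β ∈ 𝓡, (((μ β / 2 : ℝ) : ℂ) * bil (toPhase β) u * bil (toPhase β) v *
          bil (toPhase β) w) • (reflEnd β * polyDunkl 𝓡 μ (toPhase β)) := by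
    intro v w u
    rw [lie_polyDunkl_lmul_linForm h𝓡, Ring.lie_def, mul_add, add_mul, mul_smul_one, smul_one_mul,
      add_sub_add_left_eq_sub, Finset.mul_sum, Finset.sum_mul, ← Finset.sum_sub_distrib,
      ← Finset.sum_neg_distrib]
    refine Finset.sum_congr rfl fun β hβ => ?_
    rw [mul_smul_comm, smul_mul_assoc]
    refine (smul_sub _ _ _).symm.trans ?_
    rw [← Ring.lie_def, lie_polyDunkl_polyRefl h𝓡 hμ hβ, smul_neg, smul_smul]
    congr 2
    ring
  have hjacobi : ∀ a b c : Module.End ℂ (PhasePoly N), ⁅⁅a, b⁆, c⁆ = ⁅a, ⁅b, c⁆⁆ - ⁅b, ⁅a, c⁆⁆ :=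
    fun a b c => by
      simp only [Ring.lie_def, mul_sub, sub_mul, mul_assoc]
      abel
  refine eq_zero_of_lie_lmul_linForm (fun u => ?_) ?_
  · rw [hjacobi, hdouble, hdouble, sub_eq_zero]
    simp only [mul_right_comm _ (bil _ v) (bil _ w)]
  · simp [Ring.lie_def, polyDunkl_one h𝓡]

theorem lie_polyDunkl_dunklEuler (v : PhaseSpace N) :
    ⁅polyDunkl 𝓡 μ v, dunklEuler 𝓡 μ⁆ = polyDunkl 𝓡 μ v +
      ∑ β ∈ 𝓡, (((μ β / 2 : ℝ) : ℂ) * bil (toPhase β) v) •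
        (reflEnd β * polyDunkl 𝓡 μ (toPhase β)) := by
  have hterm : ∀ i : Fin N, ⁅polyDunkl 𝓡 μ v,
      Algebra.lmul ℂ (PhasePoly N) (linForm (EuclideanSpace.single i 1)) *
        polyDunkl 𝓡 μ (EuclideanSpace.single i 1)⁆ =
      v i • polyDunkl 𝓡 μ (EuclideanSpace.single i 1) +
        ∑ β ∈ 𝓡, (((μ β / 2 : ℝ) : ℂ) * bil (toPhase β) v) • (reflEnd β *
          (toPhase β i • polyDunkl 𝓡 μ (EuclideanSpace.single i 1))) := by
    intro i
    have hleibniz : ∀ a b c : Module.End ℂ (PhasePoly N), ⁅a, b * c⁆ = ⁅a, b⁆ * c + b * ⁅a, c⁆ :=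
      fun a b c => by simp only [Ring.lie_def, mul_sub, sub_mul, mul_assoc]; abel
    have hcoord : ∀ z : PhaseSpace N, bil z (EuclideanSpace.single i 1) = z i := fun z => by
      simp [bil_apply]
    rw [hleibniz, lie_polyDunkl_polyDunkl h𝓡 hμ, mul_zero, add_zero,
      lie_polyDunkl_lmul_linForm h𝓡, hcoord, add_mul, Finset.sum_mul]
    simp only [hcoord, smul_mul_assoc, mul_smul_comm, smul_smul, one_mul]
  rw [dunklEuler_eq_sum h𝓡, Ring.lie_def, Finset.mul_sum, Finset.sum_mul, ← Finset.sum_sub_distrib]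
  simp only [← Ring.lie_def]
  rw [Finset.sum_congr rfl fun i _ => hterm i, Finset.sum_add_distrib,
    ← map_eq_sum_single (polyDunkl 𝓡 μ), Finset.sum_comm]
  simp only [← Finset.smul_sum, ← Finset.mul_sum, ← map_eq_sum_single (polyDunkl 𝓡 μ)]

end RootSystem

end PolynomialDunklOperators

/-! ### The Dunkl kernel as a power series -/

section DunklSeries

variable {N : ℕ} {𝓡 : Finset (ConfigSpace N)} {μ : ConfigSpace N → ℝ}

theorem isHomogeneous_dunklEuler {p : PhasePoly N} {n : ℕ} (hp : p.IsHomogeneous n) :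
    (dunklEuler 𝓡 μ p).IsHomogeneous n := by
  rw [dunklEuler_apply, polyEuler_of_isHomogeneous hp]
  exact Submodule.add_mem (MvPolynomial.homogeneousSubmodule (Fin N) ℂ n)
    (Submodule.smul_mem _ _ hp) (Submodule.sum_mem _ fun α _ =>
      Submodule.smul_mem _ _ (Submodule.sub_mem _ hp (isHomogeneous_polyRefl α hp)))

theorem differentiable_evalAt_linearMap (g : PhaseSpace N →ₗ[ℂ] PhasePoly N) :
    Differentiable ℂ fun p : PhaseSpace N × PhaseSpace N => evalAt p.1 (g p.2) := by
  have hg : ∀ p : PhaseSpace N × PhaseSpace N,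
      evalAt p.1 (g p.2) = ∑ i, p.2 i * evalAt p.1 (g (EuclideanSpace.single i 1)) := fun p => by
    rw [map_eq_sum_single g]
    simp only [map_sum, map_smul, smul_eq_mul]
  rw [funext hg]
  exact Differentiable.fun_sum fun i _ =>
    Differentiable.mul (by fun_prop) ((differentiable_evalAt _).comp differentiable_fst)

/-- The homogeneous components `f n` of the Dunkl kernel with spectral parameter `y`, characterised
by the Euler equation `(∑ xᵢ Tᵢ) f = ⟨·, y⟩ f`. -/
structure IsDunklSeries (𝓡 : Finset (ConfigSpace N)) (μ : ConfigSpace N → ℝ) (y : PhaseSpace N)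
    (f : ℕ → PhasePoly N) : Prop where
  zero : f 0 = 1
  isHomogeneous : ∀ n, (f n).IsHomogeneous n
  dunklEuler_succ : ∀ n, dunklEuler 𝓡 μ (f (n + 1)) = linForm y * f n

section RootSystem

variable (h𝓡 : IsRootSystem 𝓡) (hμ : IsMultiplicity 𝓡 μ)

include h𝓡 hμ

theorem mul_norm_evalAt_le {p : PhasePoly N} {n : ℕ} (hn : 0 < n) (hp : p.IsHomogeneous n)
    {r B : ℝ} (h : ∀ x, ‖x‖ ≤ r → ‖evalAt x (dunklEuler 𝓡 μ p)‖ ≤ B) {x : PhaseSpace N}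
    (hx : ‖x‖ ≤ r) : n * ‖evalAt x p‖ ≤ B := by
  refine mul_norm_le_of_mul_add_sum_sub_le (isCompact_closedBall (0 : PhaseSpace N) r)
    (differentiable_evalAt p).continuous.continuousOn 𝓡 hμ.half_nonneg
    (σ := fun α x => phaseRefl α x) (fun α hα x hx => ?_) (Nat.cast_pos.mpr hn) (fun x hx => ?_) x
    (mem_closedBall_zero_iff.mpr hx)
  · rwa [mem_closedBall_zero_iff, norm_phaseRefl (h𝓡.norm_sq α hα), ← mem_closedBall_zero_iff]
  · have := h x (mem_closedBall_zero_iff.mp hx)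
    rwa [evalAt_dunklEuler, polyEuler_of_isHomogeneous hp, map_smul] at this

theorem eq_zero_of_dunklEuler_eq_zero {p : PhasePoly N} {n : ℕ} (hn : 0 < n)
    (hp : p.IsHomogeneous n) (h : dunklEuler 𝓡 μ p = 0) : p = 0 := by
  refine PhasePoly.ext fun x => ?_
  have hle := mul_norm_evalAt_le h𝓡 hμ hn hp (fun y (_ : ‖y‖ ≤ ‖x‖) => by
    rw [h, map_zero, norm_zero]) le_rfl
  rw [map_zero, ← norm_le_zero_iff]
  exact nonpos_of_mul_nonpos_right hle (Nat.cast_pos.mpr hn)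

theorem exists_rightInverse_dunklEuler {n : ℕ} (hn : 0 < n) :
    ∃ S : Module.End ℂ (PhasePoly N),
      ∀ p, p.IsHomogeneous n → (S p).IsHomogeneous n ∧ dunklEuler 𝓡 μ (S p) = p := by
  let H := MvPolynomial.homogeneousSubmodule (Fin N) ℂ n
  have hmaps : ∀ p ∈ H, dunklEuler 𝓡 μ p ∈ H := fun p hp => isHomogeneous_dunklEuler hp
  have hfin : FiniteDimensional ℂ H :=
    Module.Finite.iff_fg.mpr (MvPolynomial.homogeneousSubmodule_fg _ _ n)
  have hinj : Function.Injective ((dunklEuler 𝓡 μ).restrict hmaps) := by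
    rw [← LinearMap.ker_eq_bot, LinearMap.ker_eq_bot']
    exact fun p hp => Subtype.ext
      (eq_zero_of_dunklEuler_eq_zero h𝓡 hμ hn p.2 (congrArg Subtype.val hp))
  let e := LinearEquiv.ofInjectiveEndo _ hinj
  obtain ⟨S, hS⟩ := (H.subtype ∘ₗ e.symm.toLinearMap).exists_extend
  refine ⟨S, fun p hp => ?_⟩
  have hSp : S p = e.symm ⟨p, hp⟩ := LinearMap.congr_fun hS ⟨p, hp⟩
  rw [hSp]
  exact ⟨(e.symm ⟨p, hp⟩).2, congrArg Subtype.val (e.apply_symm_apply ⟨p, hp⟩)⟩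

omit h𝓡 hμ in
/-- The recursion `f 0 = 1`, `f (n + 1) = S (⟨·, y⟩ f n)`, where `S = S (n + 1)` is meant to invert
`∑ xᵢ Tᵢ` in degree `n + 1`. -/
def dunklSeries (S : ℕ → Module.End ℂ (PhasePoly N)) : ℕ → PhaseSpace N → PhasePoly N
  | 0, _ => 1
  | n + 1, y => S (n + 1) (linForm y * dunklSeries S n y)

omit h𝓡 hμ in
theorem differentiable_evalAt_dunklSeries (S : ℕ → Module.End ℂ (PhasePoly N)) (n : ℕ)
    (L : Module.End ℂ (PhasePoly N)) :
    Differentiable ℂ fun p : PhaseSpace N × PhaseSpace N =>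
      evalAt p.1 (L (dunklSeries S n p.2)) := by
  induction n generalizing L with
  | zero => exact (differentiable_evalAt (L 1)).comp differentiable_fst
  | succ n ih =>
    simp only [dunklSeries, linForm_apply, Finset.sum_mul, smul_mul_assoc, map_sum, map_smul,
      smul_eq_mul]
    exact Differentiable.fun_sum fun i _ => Differentiable.mul (by fun_prop)
      (ih (L ∘ₗ S (n + 1) ∘ₗ LinearMap.mulLeft ℂ (MvPolynomial.X i)))

theorem exists_isDunklSeries : ∃ f : ℕ → PhaseSpace N → PhasePoly N,
    (∀ y, IsDunklSeries 𝓡 μ y fun n => f n y) ∧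
      ∀ n, Differentiable ℂ fun p : PhaseSpace N × PhaseSpace N => evalAt p.1 (f n p.2) := by
  choose S hS using fun n : ℕ => exists_rightInverse_dunklEuler h𝓡 hμ n.succ_pos
  let T : ℕ → Module.End ℂ (PhasePoly N) := fun n => S (n - 1)
  have hmul : ∀ y n, (dunklSeries T n y).IsHomogeneous n →
      (linForm y * dunklSeries T n y).IsHomogeneous (n + 1) := fun y n h => by
    rw [add_comm]
    exact (isHomogeneous_linForm y).mul h
  have hom : ∀ y n, (dunklSeries T n y).IsHomogeneous n := fun y n => by
    induction n with
    | zero => exact MvPolynomial.isHomogeneous_one _ _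
    | succ n ih => exact (hS n _ (hmul y n ih)).1
  exact ⟨dunklSeries T, fun y => ⟨rfl, hom y, fun n => (hS n _ (hmul y n (hom y n))).2⟩,
    fun n => differentiable_evalAt_dunklSeries T n LinearMap.id⟩

/-- The maximum principle, applied to a polynomial in `x` that depends linearly on `v` and on which
the reflections act diagonally. -/
theorem eq_zero_of_smul_add_sum_smul_sub {g : PhaseSpace N →ₗ[ℂ] PhasePoly N} {n : ℝ} (hn : 0 < n)
    (h : ∀ v, (n : ℂ) • g v +
      ∑ β ∈ 𝓡, ((μ β / 2 : ℝ) : ℂ) • (g v - polyRefl β (g (phaseRefl β v))) = 0) : g = 0 := by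
  refine LinearMap.ext fun v => PhasePoly.ext fun x => ?_
  have hle := mul_norm_le_of_mul_add_sum_sub_le (B := 0)
    ((isCompact_closedBall (0 : PhaseSpace N) ‖x‖).prod
      (isCompact_closedBall (0 : PhaseSpace N) ‖v‖))
    (differentiable_evalAt_linearMap g).continuous.continuousOn 𝓡 hμ.half_nonneg
    (σ := fun α p => (phaseRefl α p.1, phaseRefl α p.2)) (fun α hα p hp => ?_) hn (fun p _ => ?_)
    (x, v) (by simp)
  · rw [LinearMap.zero_apply, map_zero, ← norm_le_zero_iff]
    exact nonpos_of_mul_nonpos_right hle hn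
  · simpa [norm_phaseRefl (h𝓡.norm_sq α hα)] using hp
  · have := congrArg (evalAt p.1) (h p.2)
    simp only [map_add, map_sum, map_smul, map_sub, map_zero, evalAt_polyRefl,
      smul_eq_mul] at this
    rw [this, norm_zero]

end RootSystem

namespace IsDunklSeries

variable {y : PhaseSpace N} {f : ℕ → PhasePoly N}

section

variable (h : IsDunklSeries 𝓡 μ y f) (h𝓡 : IsRootSystem 𝓡)

include h h𝓡

theorem polyDunkl_zero (v : PhaseSpace N) : polyDunkl 𝓡 μ v (f 0) = 0 := by
  rw [h.zero, polyDunkl_one h𝓡]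

variable (hμ : IsMultiplicity 𝓡 μ)

include hμ

theorem norm_evalAt_le (n : ℕ) (x : PhaseSpace N) :
    ‖evalAt x (f n)‖ ≤ (‖x‖ * ‖y‖) ^ n / n.factorial := by
  suffices H : ∀ r, ∀ x : PhaseSpace N, ‖x‖ ≤ r →
      ‖evalAt x (f n)‖ ≤ (r * ‖y‖) ^ n / n.factorial from H _ x le_rfl
  intro r
  induction n with
  | zero => simp [h.zero]
  | succ n ih =>
    intro x hx
    have hrhs : ∀ z, ‖z‖ ≤ r → ‖evalAt z (dunklEuler 𝓡 μ (f (n + 1)))‖ ≤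
        (r * ‖y‖) ^ (n + 1) / n.factorial := fun z hz => by
      have hr : 0 ≤ r := (norm_nonneg z).trans hz
      have hlin : ‖bil y z‖ ≤ r * ‖y‖ := by
        rw [mul_comm]
        exact (norm_bil_le y z).trans (by gcongr)
      rw [h.dunklEuler_succ, map_mul, norm_mul, evalAt_linForm, pow_succ', mul_div_assoc]
      exact mul_le_mul hlin (ih z hz) (norm_nonneg _) (by positivity)
    have := mul_norm_evalAt_le h𝓡 hμ n.succ_pos (h.isHomogeneous (n + 1)) hrhs hx
    rwa [Nat.factorial_succ, Nat.cast_mul, mul_comm ((n + 1 : ℕ) : ℝ), ← div_div,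
      le_div_iff₀' (by positivity)]

/-- The defect `g v = T_v f_{n+1} - ⟨v, y⟩ f_n` of the eigenvalue equation solves, by the commutator
of `T_v` with `∑ xᵢ Tᵢ`, a homogeneous differential-reflection equation. -/
theorem polyDunkl_succ_of_linForm_mul {n : ℕ}
    (hn : ∀ v, linForm y * polyDunkl 𝓡 μ v (f n) = bil v y • dunklEuler 𝓡 μ (f n))
    (v : PhaseSpace N) : polyDunkl 𝓡 μ v (f (n + 1)) = bil v y • f n := by
  let g : PhaseSpace N →ₗ[ℂ] PhasePoly N :=
    (polyDunkl 𝓡 μ).flip (f (n + 1)) - (bil.flip y).smulRight (f n)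
  have hg : ∀ v, g v = polyDunkl 𝓡 μ v (f (n + 1)) - bil v y • f n := fun v => rfl
  have hEuler : ∀ v, polyEuler (g v) = (n : ℂ) • g v := fun v => by
    rw [hg, map_sub, Derivation.map_smul, polyEuler_polyDunkl h𝓡 v (h.isHomogeneous (n + 1)),
      polyEuler_of_isHomogeneous (h.isHomogeneous n), smul_sub, smul_comm (n : ℂ)]
  have hrefl : ∀ β v, g (phaseRefl β v) = g v - bil (toPhase β) v • g (toPhase β) := fun β v => by
    rw [phaseRefl_apply, map_sub, map_smul]
  have hdunklEuler : ∀ v, dunklEuler 𝓡 μ (g v) + g v +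
      ∑ β ∈ 𝓡, (((μ β / 2 : ℝ) : ℂ) * bil (toPhase β) v) • polyRefl β (g (toPhase β)) = 0 := by
    intro v
    have hcomm := LinearMap.congr_fun (lie_polyDunkl_dunklEuler h𝓡 hμ v) (f (n + 1))
    simp only [Ring.lie_def, LinearMap.sub_apply, LinearMap.add_apply, Module.End.mul_apply,
      LinearMap.sum_apply, LinearMap.smul_apply, reflEnd_apply, h.dunklEuler_succ,
      polyDunkl_linForm_mul h𝓡, hn] at hcomm
    simp only [hg, map_sub, map_smul, smul_sub, smul_smul, Finset.sum_sub_distrib]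
    linear_combination (exp := 1) -hcomm
  have hzero : g = 0 := by
    refine eq_zero_of_smul_add_sum_smul_sub h𝓡 hμ (n := n + 1) (by positivity) fun v => ?_
    rw [← hdunklEuler v, dunklEuler_apply, hEuler, add_assoc (_ + _) (g v), add_add_add_comm,
      ← Finset.sum_add_distrib]
    congr 1
    · push_cast
      rw [add_smul, one_smul]
    · refine Finset.sum_congr rfl fun β _ => ?_
      rw [hrefl, map_sub, map_smul]
      module
  exact sub_eq_zero.mp (LinearMap.congr_fun hzero v)

theorem polyDunkl_succ (n : ℕ) (v : PhaseSpace N) :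
    polyDunkl 𝓡 μ v (f (n + 1)) = bil v y • f n := by
  induction n generalizing v with
  | zero =>
    refine h.polyDunkl_succ_of_linForm_mul h𝓡 hμ (fun v => ?_) v
    rw [h.polyDunkl_zero h𝓡, mul_zero, dunklEuler_apply,
      polyEuler_of_isHomogeneous (h.isHomogeneous 0), h.zero]
    simp
  | succ n ih =>
    refine h.polyDunkl_succ_of_linForm_mul h𝓡 hμ (fun v => ?_) v
    rw [ih, h.dunklEuler_succ, mul_smul_comm]

end

end IsDunklSeries

end DunklSeries

/-! ### Series of entire functions and Dunkl operators -/

section SeriesOfEntireFunctions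

variable {N : ℕ} {𝓡 : Finset (ConfigSpace N)} {μ : ConfigSpace N → ℝ}

theorem norm_fderiv_le_of_forall_mem_ball {E F : Type*} [NormedAddCommGroup E] [NormedSpace ℂ E]
    [NormedAddCommGroup F] [NormedSpace ℂ F] {f : E → F} {c : E} {R M : ℝ} (hR : 0 < R)
    (hf : DifferentiableOn ℂ f (Metric.ball c R)) (hM : ∀ z ∈ Metric.ball c R, ‖f z‖ ≤ M) :
    ‖fderiv ℂ f c‖ ≤ 2 * M / R := by
  refine Complex.norm_fderiv_le_div_of_mapsTo_ball hf (fun z hz => ?_) hR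
  rw [mem_closedBall_iff_norm, two_mul]
  exact norm_sub_le_of_le (hM z hz) (hM c (Metric.mem_ball_self hR))

section EntireSeries

variable {V : Type*} [NormedAddCommGroup V] [NormedSpace ℂ V] {F : ℕ → V → ℂ}
  (hF : ∀ n, Differentiable ℂ (F n)) {u : ℝ → ℕ → ℝ}
  (hFu : ∀ R n x, ‖x‖ ≤ R → ‖F n x‖ ≤ u R n) (hu : ∀ R, Summable (u R))

include hF hFu

theorem norm_fderiv_le_of_norm_le (R : ℝ) (n : ℕ) {x : V} (hx : ‖x‖ ≤ R) :
    ‖fderiv ℂ (F n) x‖ ≤ 2 * u (R + 1) n := by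
  have := norm_fderiv_le_of_forall_mem_ball one_pos (hF n).differentiableOn
    (M := u (R + 1) n) (c := x) fun z hz => hFu _ _ _ ?_
  · rwa [div_one] at this
  · rw [mem_ball_iff_norm] at hz
    linarith [norm_le_norm_add_norm_sub' z x]

include hu

theorem hasFDerivAt_tsum_of_norm_le (x : V) :
    HasFDerivAt (fun z => ∑' n, F n z) (∑' n, fderiv ℂ (F n) x) x :=
  hasFDerivAt_tsum_of_isPreconnected ((hu (‖x‖ + 1 + 1)).mul_left 2) Metric.isOpen_ball
    (convex_ball (0 : V) (‖x‖ + 1)).isPreconnected (fun n z _ => (hF n z).hasFDerivAt)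
    (fun n z hz => norm_fderiv_le_of_norm_le hF hFu _ n (mem_ball_zero_iff.mp hz).le)
    (by simp : x ∈ _) (.of_norm_bounded (hu ‖x‖) fun n => hFu _ n x le_rfl) (by simp)

theorem hasSum_fderiv_of_norm_le (x : V) :
    HasSum (fun n => fderiv ℂ (F n) x) (fderiv ℂ (fun z => ∑' n, F n z) x) := by
  rw [(hasFDerivAt_tsum_of_norm_le hF hFu hu x).fderiv]
  exact (Summable.of_norm_bounded ((hu (‖x‖ + 1)).mul_left 2)
    fun n => norm_fderiv_le_of_norm_le hF hFu _ n le_rfl).hasSum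

end EntireSeries

theorem hasFDerivAt_comp_toPhase {f : PhaseSpace N → ℂ} (hf : Differentiable ℂ f)
    (x : ConfigSpace N) : HasFDerivAt (fun x => f (toPhase x))
      (((fderiv ℂ f (toPhase x)).restrictScalars ℝ).comp
        (phaseEmbedding N).toContinuousLinearMap) x :=
  ((hf (toPhase x)).hasFDerivAt.restrictScalars ℝ).comp x
    (phaseEmbedding N).toContinuousLinearMap.hasFDerivAt

theorem fderiv_comp_toPhase {f : PhaseSpace N → ℂ} (hf : Differentiable ℂ f)
    (x v : ConfigSpace N) : fderiv ℝ (fun x => f (toPhase x)) x v =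
      fderiv ℂ f (toPhase x) (toPhase v) := by
  rw [(hasFDerivAt_comp_toPhase hf x).fderiv]
  rfl

section DiffQuot

variable {α : ConfigSpace N} (hα : ‖α‖ ^ 2 = 2)

include hα

theorem inner_mul_diffQuot (f : ConfigSpace N → ℂ) (x : ConfigSpace N) :
    (⟪α, x⟫ : ℂ) * diffQuot α f x = f x - f (refl α x) := by
  unfold diffQuot
  split_ifs with h
  · simp [refl_apply hα, h]
  · exact mul_div_cancel₀ _ (by exact_mod_cast h)

theorem diffQuot_eq_of_inner_mul_eq {f q : ConfigSpace N → ℂ} {x : ConfigSpace N}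
    (hf : DifferentiableAt ℝ f x) (hq : DifferentiableAt ℝ q x)
    (h : ∀ x, (⟪α, x⟫ : ℂ) * q x = f x - f (refl α x)) : diffQuot α f x = q x := by
  by_cases hx : ⟪α, x⟫ = 0
  · have hline : ∀ c : ℝ, HasDerivAt (fun t : ℝ => x + t • c • α) (c • α) 0 := fun c => by
      simpa using ((hasDerivAt_id (0 : ℝ)).smul_const (c • α)).const_add x
    have hcomp : ∀ {g : ConfigSpace N → ℂ}, DifferentiableAt ℝ g x → ∀ c : ℝ,
        HasDerivAt (fun t : ℝ => g (x + t • c • α)) (fderiv ℝ g x (c • α)) 0 := fun hg c =>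
      HasFDerivAt.comp_hasDerivAt (0 : ℝ) (by simpa using hg.hasFDerivAt) (hline c)
    have hodd : ∀ t : ℝ, f (x + t • (1 : ℝ) • α) - f (x + t • (-1 : ℝ) • α) =
        2 * ((t : ℂ) * q (x + t • (1 : ℝ) • α)) := fun t => by
      have hinner : ⟪α, x + t • α⟫ = 2 * t := by
        rw [inner_add_right, hx, inner_smul_right, real_inner_self_eq_norm_sq, hα]
        ring
      have hrefl : refl α (x + t • α) = x + t • (-1 : ℝ) • α := by
        rw [refl_apply hα, hinner]
        module
      rw [one_smul, ← hrefl, ← h, hinner]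
      push_cast
      ring
    have hleft := ((hcomp hf 1).sub (hcomp hf (-1))).congr_of_eventuallyEq
      (.of_forall fun t => (hodd t).symm)
    have hright := (((hasDerivAt_id (0 : ℝ)).ofReal_comp.mul (hcomp hq 1)).const_mul 2)
    have := hleft.unique hright
    simp only [one_smul, neg_smul, map_neg, sub_neg_eq_add, zero_smul, add_zero, id, one_mul,
      Complex.ofReal_zero, Complex.ofReal_one, zero_mul] at this
    rw [diffQuot, if_pos hx]
    linear_combination this / 2
  · exact mul_left_cancel₀ (Complex.ofReal_ne_zero.mpr hx)
      ((inner_mul_diffQuot hα f x).trans (h x).symm)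

theorem diffQuot_evalAt (p : PhasePoly N) (x : ConfigSpace N) :
    diffQuot α (fun x => evalAt (toPhase x) p) x = evalAt (toPhase x) (divDiff α p) := by
  refine diffQuot_eq_of_inner_mul_eq hα
    (hasFDerivAt_comp_toPhase (differentiable_evalAt p) x).differentiableAt
    (hasFDerivAt_comp_toPhase (differentiable_evalAt _) x).differentiableAt fun x => ?_
  rw [← bil_toPhase, ← evalAt_linForm, ← map_mul, linForm_mul_divDiff hα, map_sub,
    evalAt_polyRefl, toPhase_refl hα]

end DiffQuot

theorem dunklOp_evalAt (h𝓡 : IsRootSystem 𝓡) (p : PhasePoly N) (ξ x : ConfigSpace N) :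
    dunklOp 𝓡 μ ξ (fun x => evalAt (toPhase x) p) x =
      evalAt (toPhase x) (polyDunkl 𝓡 μ (toPhase ξ) p) := by
  rw [dunklOp, fderiv_comp_toPhase (differentiable_evalAt p), fderiv_evalAt, polyDunkl_apply,
    map_add, map_sum, Finset.mul_sum]
  congr 1
  refine Finset.sum_congr rfl fun α hα => ?_
  rw [diffQuot_evalAt (h𝓡.norm_sq α hα), map_smul, bil_toPhase, smul_eq_mul]
  push_cast
  ring

theorem hasSum_dunklOp {F : ℕ → PhaseSpace N → ℂ} {f : PhaseSpace N → ℂ}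
    (hF : ∀ n, Differentiable ℂ (F n)) (hf : Differentiable ℂ f)
    (hsum : ∀ x, HasSum (fun n => F n x) (f x))
    (hfderiv : ∀ x, HasSum (fun n => fderiv ℂ (F n) x) (fderiv ℂ f x)) (ξ x : ConfigSpace N) :
    HasSum (fun n => dunklOp 𝓡 μ ξ (fun x => F n (toPhase x)) x)
      (dunklOp 𝓡 μ ξ (fun x => f (toPhase x)) x) := by
  have hfderiv' : ∀ v, HasSum (fun n => fderiv ℝ (fun x => F n (toPhase x)) x v)
      (fderiv ℝ (fun x => f (toPhase x)) x v) := fun v => by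
    simp only [fderiv_comp_toPhase (hF _), fderiv_comp_toPhase hf]
    exact (hfderiv (toPhase x)).mapL (ContinuousLinearMap.apply ℂ ℂ (toPhase v))
  refine (hfderiv' ξ).add ((hasSum_sum fun α _ => HasSum.mul_left _ ?_).mul_left _)
  unfold diffQuot
  split_ifs
  · exact hfderiv' α
  · exact ((hsum _).sub (hsum _)).div_const _

end SeriesOfEntireFunctions

/-! ### Existence and uniqueness of the Dunkl kernel -/

section DunklKernel

variable {N : ℕ} {𝓡 : Finset (ConfigSpace N)} {μ : ConfigSpace N → ℝ}

/-- The properties of the Dunkl kernel with a complex spectral parameter `y`. The last one is the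
radial part `∑ xᵢ Tᵢ E(·, y) = ⟨·, y⟩ E(·, y)` of the eigenvalue equations, at complex `x`. -/
structure IsEntireDunklKernel (𝓡 : Finset (ConfigSpace N)) (μ : ConfigSpace N → ℝ)
    (E : PhaseSpace N → PhaseSpace N → ℂ) : Prop where
  holomorphic : Differentiable ℂ fun p : PhaseSpace N × PhaseSpace N => E p.1 p.2
  zero_left : ∀ y, E 0 y = 1
  dunklOp_eq : ∀ (ξ x : ConfigSpace N) (y : PhaseSpace N),
    dunklOp 𝓡 μ ξ (fun x => E (toPhase x) y) x = bil (toPhase ξ) y * E (toPhase x) y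
  isRadialSolution : ∀ y, IsRadialSolution 𝓡 (fun α => μ α / 2) (fun α => phaseRefl α)
    (fun x => bil x y) fun x => E x y

theorem hasDerivAt_smul_one_of_hasFDerivAt {V F : Type*} [NormedAddCommGroup V] [NormedSpace ℝ V]
    [NormedAddCommGroup F] [NormedSpace ℝ F] {f : V → F} {f' : V →L[ℝ] F} {x : V}
    (hf : HasFDerivAt f f' x) : HasDerivAt (fun t : ℝ => f (t • x)) (f' x) 1 :=
  HasFDerivAt.comp_hasDerivAt (1 : ℝ) (f := fun t : ℝ => t • x) (by simpa using hf)
    (by simpa using (hasDerivAt_id (1 : ℝ)).smul_const x)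

namespace IsDunklSeries

variable {y : PhaseSpace N} {f : ℕ → PhasePoly N} (h : IsDunklSeries 𝓡 μ y f)

include h

variable (h𝓡 : IsRootSystem 𝓡) (hμ : IsMultiplicity 𝓡 μ)

include h𝓡 hμ

theorem norm_evalAt_le_of_norm_le (R : ℝ) (n : ℕ) (x : PhaseSpace N) (hx : ‖x‖ ≤ R) :
    ‖evalAt x (f n)‖ ≤ (R * ‖y‖) ^ n / n.factorial :=
  (h.norm_evalAt_le h𝓡 hμ n x).trans (by gcongr)

theorem hasSum_evalAt (x : PhaseSpace N) :
    HasSum (fun n => evalAt x (f n)) (∑' n, evalAt x (f n)) :=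
  (Summable.of_norm_bounded (Real.summable_pow_div_factorial _)
    fun n => h.norm_evalAt_le h𝓡 hμ n x).hasSum

theorem differentiable_tsum : Differentiable ℂ fun x => ∑' n, evalAt x (f n) := fun x =>
  (hasFDerivAt_tsum_of_norm_le (fun n => differentiable_evalAt (f n))
    (h.norm_evalAt_le_of_norm_le h𝓡 hμ) (fun _ => Real.summable_pow_div_factorial _)
    x).differentiableAt

theorem hasSum_fderiv (x : PhaseSpace N) :
    HasSum (fun n => fderiv ℂ (fun x => evalAt x (f n)) x)
      (fderiv ℂ (fun x => ∑' n, evalAt x (f n)) x) :=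
  hasSum_fderiv_of_norm_le (fun n => differentiable_evalAt (f n))
    (h.norm_evalAt_le_of_norm_le h𝓡 hμ) (fun _ => Real.summable_pow_div_factorial _) x

theorem dunklOp_tsum (ξ x : ConfigSpace N) :
    dunklOp 𝓡 μ ξ (fun x => ∑' n, evalAt (toPhase x) (f n)) x =
      bil (toPhase ξ) y * ∑' n, evalAt (toPhase x) (f n) := by
  refine (hasSum_dunklOp (fun n => differentiable_evalAt (f n)) (h.differentiable_tsum h𝓡 hμ)
    (h.hasSum_evalAt h𝓡 hμ) (h.hasSum_fderiv h𝓡 hμ) ξ x).unique ?_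
  simp only [dunklOp_evalAt h𝓡]
  rw [← hasSum_nat_add_iff' 1]
  simpa [h.polyDunkl_succ h𝓡 hμ, h.polyDunkl_zero h𝓡] using
    (h.hasSum_evalAt h𝓡 hμ (toPhase x)).mul_left (bil (toPhase ξ) y)

theorem isRadialSolution_tsum : IsRadialSolution 𝓡 (fun α => μ α / 2) (fun α => phaseRefl α)
    (fun x => bil x y) fun x => ∑' n, evalAt x (f n) where
  continuous := (h.differentiable_tsum h𝓡 hμ).continuous
  hasDerivAt x := by
    have hfderiv := hasDerivAt_smul_one_of_hasFDerivAt
      ((h.differentiable_tsum h𝓡 hμ x).hasFDerivAt.restrictScalars ℝ)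
    have hsum : HasSum (fun n => evalAt x (dunklEuler 𝓡 μ (f n)))
        (fderiv ℂ (fun x => ∑' n, evalAt x (f n)) x x + ∑ α ∈ 𝓡, ((μ α / 2 : ℝ) : ℂ) *
          ((∑' n, evalAt x (f n)) - ∑' n, evalAt (phaseRefl α x) (f n))) := by
      simp only [evalAt_dunklEuler, evalAt_polyEuler, ← fderiv_evalAt]
      exact ((h.hasSum_fderiv h𝓡 hμ x).mapL (ContinuousLinearMap.apply ℂ ℂ x)).add
        (hasSum_sum fun α _ => ((h.hasSum_evalAt h𝓡 hμ x).sub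
          (h.hasSum_evalAt h𝓡 hμ (phaseRefl α x))).mul_left _)
    refine hfderiv.congr_deriv (eq_sub_of_add_eq (hsum.unique ?_))
    rw [← hasSum_nat_add_iff' 1]
    simpa [h.dunklEuler_succ, h.zero, evalAt_dunklEuler, bil_comm y] using
      (h.hasSum_evalAt h𝓡 hμ x).mul_left (bil x y)

end IsDunklSeries

theorem exists_isEntireDunklKernel (h𝓡 : IsRootSystem 𝓡) (hμ : IsMultiplicity 𝓡 μ) :
    ∃ E, IsEntireDunklKernel 𝓡 μ E := by
  obtain ⟨f, hf, hdiff⟩ := exists_isDunklSeries h𝓡 hμ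
  have hbound : ∀ R n (p : PhaseSpace N × PhaseSpace N), ‖p‖ ≤ R →
      ‖evalAt p.1 (f n p.2)‖ ≤ (R * R) ^ n / n.factorial := fun R n p hp => by
    have h₁ := (norm_fst_le p).trans hp
    have h₂ := (norm_snd_le p).trans hp
    have hR := (norm_nonneg p).trans hp
    exact ((hf p.2).norm_evalAt_le h𝓡 hμ n p.1).trans (by gcongr)
  refine ⟨fun x y => ∑' n, evalAt x (f n y), ⟨fun p => ?_, fun y => ?_,
    fun ξ x y => (hf y).dunklOp_tsum h𝓡 hμ ξ x, fun y => (hf y).isRadialSolution_tsum h𝓡 hμ⟩⟩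
  · exact (hasFDerivAt_tsum_of_norm_le hdiff hbound
      (fun _ => Real.summable_pow_div_factorial _) p).differentiableAt
  · have hzero : ∀ n ≠ 0, evalAt 0 (f n y) = 0 := fun n hn => by
      simpa [hn] using (hf y).norm_evalAt_le h𝓡 hμ n 0
    rw [tsum_eq_single 0 hzero, (hf y).zero, map_one]

/-- The real and imaginary parts of `p` span a complex line on which the function vanishes at the
real parameters. -/
theorem eq_of_forall_toPhase_eq {f g : PhaseSpace N × PhaseSpace N → ℂ} (hf : Differentiable ℂ f)
    (hg : Differentiable ℂ g) (h : ∀ x y, f (toPhase x, toPhase y) = g (toPhase x, toPhase y)) :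
    f = g := by
  funext p
  let re (z : PhaseSpace N) : ConfigSpace N := WithLp.toLp 2 fun j => (z j).re
  let im (z : PhaseSpace N) : ConfigSpace N := WithLp.toLp 2 fun j => (z j).im
  let q (t : ℂ) : PhaseSpace N × PhaseSpace N :=
    (toPhase (re p.1) + t • toPhase (im p.1), toPhase (re p.2) + t • toPhase (im p.2))
  have hq : Differentiable ℂ q := by fun_prop
  have hqI : q Complex.I = p := by
    refine Prod.ext ?_ ?_ <;>
    · ext j
      simp [q, re, im, mul_comm Complex.I, Complex.re_add_im]
  have hreal : ∀ t : ℝ, f (q t) = g (q t) := fun t => by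
    convert h (re p.1 + t • im p.1) (re p.2 + t • im p.2) using 2 <;>
    · refine Prod.ext ?_ ?_ <;>
      · ext j
        simp [q]
  have htendsto : Filter.Tendsto (fun t : ℝ => (t : ℂ)) (nhdsWithin 0 {0}ᶜ) (nhdsWithin 0 {0}ᶜ) :=
    tendsto_nhdsWithin_of_tendsto_nhds_of_eventually_within _
      ((Complex.continuous_ofReal.tendsto' 0 0 rfl).mono_left nhdsWithin_le_nhds)
      (Filter.eventually_of_mem self_mem_nhdsWithin fun t ht => Complex.ofReal_ne_zero.mpr ht)
  have hline : f ∘ q = g ∘ q := AnalyticOnNhd.eq_of_frequently_eq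
    ((hf.comp hq).differentiableOn.analyticOnNhd isOpen_univ)
    ((hg.comp hq).differentiableOn.analyticOnNhd isOpen_univ)
    (htendsto.frequently (.of_forall hreal))
  rw [← hqI]
  exact congrFun hline Complex.I

namespace IsDunklKernel

variable {E E' : PhaseSpace N → PhaseSpace N → ℂ}

theorem isRadialSolution (h𝓡 : IsRootSystem 𝓡) (hE : IsDunklKernel 𝓡 μ E) (y : ConfigSpace N) :
    IsRadialSolution 𝓡 (fun α => μ α / 2) (fun α => refl α) (fun x => (⟪x, y⟫ : ℂ))
      fun x => E (toPhase x) (toPhase y) where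
  continuous := by
    have := hE.holomorphic.continuous
    exact this.comp (continuous_toPhase.prodMk continuous_const)
  hasDerivAt x := by
    have hdiff : Differentiable ℂ fun x => E x (toPhase y) :=
      hE.holomorphic.comp (differentiable_id.prodMk (differentiable_const _))
    refine (hasDerivAt_smul_one_of_hasFDerivAt
      (hasFDerivAt_comp_toPhase hdiff x).differentiableAt.hasFDerivAt).congr_deriv ?_
    rw [eq_sub_iff_add_eq, ← hE.eigen, dunklOp, Finset.mul_sum]
    congr 1
    refine Finset.sum_congr rfl fun α hα => ?_
    rw [mul_assoc, inner_mul_diffQuot (h𝓡.norm_sq α hα)]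
    push_cast
    ring

theorem eq (h𝓡 : IsRootSystem 𝓡) (hμ : IsMultiplicity 𝓡 μ) (hE : IsDunklKernel 𝓡 μ E)
    (hE' : IsDunklKernel 𝓡 μ E') : E = E' := by
  have hreal : ∀ x y, E (toPhase x) (toPhase y) = E' (toPhase x) (toPhase y) := fun x y =>
    congrFun ((hE.isRadialSolution h𝓡 y).eq_of_apply_zero_eq (hE'.isRadialSolution h𝓡 y)
      hμ.half_nonneg (fun α _ x => (refl α).norm_map x) (K := ‖y‖)
      (fun x => by simpa [mul_comm] using abs_real_inner_le_norm x y)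
      (by simp [hE.at_zero, hE'.at_zero])) x
  funext x y
  exact congrFun (eq_of_forall_toPhase_eq hE.holomorphic hE'.holomorphic hreal) (x, y)

end IsDunklKernel

theorem IsEntireDunklKernel.isDunklKernel {E : PhaseSpace N → PhaseSpace N → ℂ}
    (hE : IsEntireDunklKernel 𝓡 μ E) : IsDunklKernel 𝓡 μ E where
  holomorphic := hE.holomorphic
  eigen ξ x y := by rw [hE.dunklOp_eq, bil_toPhase]
  at_zero y := hE.zero_left (toPhase y)

theorem isEntireDunklKernel_dunklKernel (h𝓡 : IsRootSystem 𝓡) (hμ : IsMultiplicity 𝓡 μ) :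
    IsEntireDunklKernel 𝓡 μ (dunklKernel 𝓡 μ) := by
  obtain ⟨E, hE⟩ := exists_isEntireDunklKernel h𝓡 hμ
  have hex : ∃ E, IsDunklKernel 𝓡 μ E := ⟨E, hE.isDunklKernel⟩
  rwa [dunklKernel, dif_pos hex, hex.choose_spec.eq h𝓡 hμ hE.isDunklKernel]

end DunklKernel

/-! ### Symmetries of the Dunkl kernel -/

section Symmetries

variable {N : ℕ} {𝓡 : Finset (ConfigSpace N)} {μ : ConfigSpace N → ℝ}

namespace IsEntireDunklKernel

variable {E : PhaseSpace N → PhaseSpace N → ℂ} (hE : IsEntireDunklKernel 𝓡 μ E)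

include hE

theorem differentiable_left (y : PhaseSpace N) : Differentiable ℂ fun x => E x y :=
  hE.holomorphic.comp (differentiable_id.prodMk (differentiable_const y))

theorem differentiable_right (x : PhaseSpace N) : Differentiable ℂ fun y => E x y :=
  hE.holomorphic.comp ((differentiable_const x).prodMk differentiable_id)

variable (h𝓡 : IsRootSystem 𝓡) (hμ : IsMultiplicity 𝓡 μ)

include h𝓡 hμ

theorem norm_le (x y : PhaseSpace N) : ‖E x y‖ ≤ Real.exp (‖x‖ * ‖y‖) := by
  have := (hE.isRadialSolution y).norm_le hμ.half_nonneg
    (fun α hα x => norm_phaseRefl (h𝓡.norm_sq α hα) x)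
    (fun x => (norm_bil_le x y).trans_eq (mul_comm _ _)) x
  simpa [hE.zero_left, mul_comm] using this

theorem eq_mul_of_isRadialSolution {y : PhaseSpace N} {U : PhaseSpace N → ℂ}
    (hU : IsRadialSolution 𝓡 (fun α => μ α / 2) (fun α => phaseRefl α) (fun x => bil x y) U)
    (x : PhaseSpace N) : U x = U 0 * E x y :=
  congrFun (hU.eq_of_apply_zero_eq ((hE.isRadialSolution y).const_mul (U 0)) hμ.half_nonneg
    (fun α hα x => norm_phaseRefl (h𝓡.norm_sq α hα) x)
    (fun x => (norm_bil_le x y).trans_eq (mul_comm _ _)) (by rw [hE.zero_left, mul_one])) x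

theorem eq_of_isRadialSolution {y : PhaseSpace N} {U : PhaseSpace N → ℂ}
    (hU : IsRadialSolution 𝓡 (fun α => μ α / 2) (fun α => phaseRefl α) (fun x => bil x y) U)
    (h0 : U 0 = 1) (x : PhaseSpace N) : U x = E x y := by
  rw [hE.eq_mul_of_isRadialSolution h𝓡 hμ hU, h0, one_mul]

theorem phaseRefl_left {α : ConfigSpace N} (hα : α ∈ 𝓡) (x y : PhaseSpace N) :
    E (phaseRefl α x) y = E x (phaseRefl α y) := by
  have hn := h𝓡.norm_sq α hα
  refine hE.eq_of_isRadialSolution h𝓡 hμ (U := fun x => E (phaseRefl α x) y) ⟨?_, fun x => ?_⟩ ?_ x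
  · exact (hE.differentiable_left y).continuous.comp (differentiable_phaseRefl α).continuous
  · have hderiv := (hE.isRadialSolution y).hasDerivAt (phaseRefl α x)
    simp only [← LinearMap.map_smul_of_tower] at hderiv
    refine hderiv.congr_deriv ?_
    rw [bil_phaseRefl_left, ← h𝓡.sum_comp_refl hα]
    congr 1
    refine Finset.sum_congr rfl fun β hβ => ?_
    rw [hμ.apply_refl hα hβ, phaseRefl_phaseRefl_eq_phaseRefl_refl hn]
  · simp [hE.zero_left]

theorem smul_left (c : ℂ) (x y : PhaseSpace N) : E (c • x) y = E x (c • y) := by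
  refine hE.eq_of_isRadialSolution h𝓡 hμ (U := fun x => E (c • x) y) ⟨?_, fun x => ?_⟩ ?_ x
  · exact (hE.differentiable_left y).continuous.comp (continuous_const_smul c)
  · have hderiv := (hE.isRadialSolution y).hasDerivAt (c • x)
    simpa only [smul_comm _ c, map_smul, LinearMap.smul_apply] using hderiv
  · rw [smul_zero, hE.zero_left]

theorem conj_apply (x y : PhaseSpace N) :
    (starRingEnd ℂ) (E (conjPhase x) (conjPhase y)) = E x y := by
  refine hE.eq_of_isRadialSolution h𝓡 hμ
    (U := fun x => (starRingEnd ℂ) (E (conjPhase x) (conjPhase y))) ⟨?_, fun x => ?_⟩ ?_ x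
  · exact Complex.continuous_conj.comp
      ((hE.differentiable_left _).continuous.comp continuous_conjPhase)
  · have hderiv := Complex.conjCLE.toContinuousLinearMap.hasFDerivAt.comp_hasDerivAt (1 : ℝ)
      ((hE.isRadialSolution (conjPhase y)).hasDerivAt (conjPhase x))
    have hsmul : ∀ t : ℝ, conjPhase (t • x) = t • conjPhase x := fun t => by
      simpa using conjPhase_smul t x
    simp only [← hsmul] at hderiv
    refine hderiv.congr_deriv ?_
    simp [bil_conjPhase, phaseRefl_conjPhase, Complex.conj_ofNat]
  · have hzero : conjPhase (0 : PhaseSpace N) = 0 := by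
      simpa using conjPhase_smul 0 (0 : PhaseSpace N)
    simp [hzero, hE.zero_left]

theorem symm (x y : PhaseSpace N) : E x y = E y x := by
  refine (hE.eq_of_isRadialSolution h𝓡 hμ (U := fun x => E y x) ⟨?_, fun x => ?_⟩ ?_ x).symm
  · exact (hE.differentiable_right _).continuous
  · have hderiv := (hE.isRadialSolution x).hasDerivAt y
    have hsmul : ∀ t : ℝ, E (t • y) x = E y (t • x) := fun t => hE.smul_left h𝓡 hμ (t : ℂ) y x
    simp only [hsmul] at hderiv
    refine hderiv.congr_deriv ?_
    rw [bil_comm]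
    congr 1
    exact Finset.sum_congr rfl fun α hα => by rw [hE.phaseRefl_left h𝓡 hμ hα]
  · simpa [hE.zero_left] using (hE.smul_left h𝓡 hμ 0 y 0).symm

end IsEntireDunklKernel

end Symmetries

/-! ### Functions of exponential growth -/

section ExponentialGrowth

/-- Functions of at most exponential growth, the class of integrands used with Gaussian weights. -/
def ExpBounded {V W : Type*} [Norm V] [Norm W] (f : V → W) : Prop :=
  ∃ C c : ℝ, 0 ≤ C ∧ 0 ≤ c ∧ ∀ x, ‖f x‖ ≤ C * Real.exp (c * ‖x‖)

namespace ExpBounded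

section Normed

variable {V W : Type*} [NormedAddCommGroup V] [NormedAddCommGroup W]

theorem of_norm_le {W' : Type*} [Norm W'] {f : V → W} {g : V → W'} (hf : ExpBounded f)
    (h : ∀ x, ‖g x‖ ≤ ‖f x‖) : ExpBounded g := by
  obtain ⟨C, c, hC, hc, hle⟩ := hf
  exact ⟨C, c, hC, hc, fun x => (h x).trans (hle x)⟩

theorem norm {f : V → W} (hf : ExpBounded f) : ExpBounded fun x => ‖f x‖ :=
  hf.of_norm_le fun x => (norm_norm (f x)).le

theorem const (a : W) : ExpBounded fun _ : V => a :=
  ⟨‖a‖, 0, norm_nonneg a, le_rfl, fun x => by simp⟩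

theorem add {f g : V → W} (hf : ExpBounded f) (hg : ExpBounded g) :
    ExpBounded fun x => f x + g x := by
  obtain ⟨C, c, hC, hc, hf⟩ := hf
  obtain ⟨D, d, hD, hd, hg⟩ := hg
  refine ⟨C + D, c + d, by positivity, by positivity, fun x => ?_⟩
  calc ‖f x + g x‖ ≤ C * Real.exp (c * ‖x‖) + D * Real.exp (d * ‖x‖) :=
        norm_add_le_of_le (hf x) (hg x)
    _ ≤ C * Real.exp ((c + d) * ‖x‖) + D * Real.exp ((c + d) * ‖x‖) := by
        gcongr <;> linarith
    _ = (C + D) * Real.exp ((c + d) * ‖x‖) := (add_mul _ _ _).symm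

theorem neg {f : V → W} (hf : ExpBounded f) : ExpBounded fun x => -f x :=
  hf.of_norm_le fun x => (norm_neg (f x)).le

theorem sub {f g : V → W} (hf : ExpBounded f) (hg : ExpBounded g) :
    ExpBounded fun x => f x - g x := by
  simpa only [sub_eq_add_neg] using hf.add hg.neg

theorem sum {ι : Type*} {s : Finset ι} {f : ι → V → W} (hf : ∀ i ∈ s, ExpBounded (f i)) :
    ExpBounded fun x => ∑ i ∈ s, f i x := by
  classical
  induction s using Finset.induction_on with
  | empty => simpa using const (V := V) (0 : W)
  | insert i s hi ih =>
    simp only [Finset.sum_insert hi]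
    exact (hf i (by simp)).add (ih fun j hj => hf j (by simp [hj]))

theorem smul {𝕜 : Type*} [NormedField 𝕜] [NormedSpace 𝕜 W] {f : V → 𝕜} {g : V → W}
    (hf : ExpBounded f) (hg : ExpBounded g) : ExpBounded fun x => f x • g x := by
  obtain ⟨C, c, hC, hc, hf⟩ := hf
  obtain ⟨D, d, hD, hd, hg⟩ := hg
  refine ⟨C * D, c + d, by positivity, by positivity, fun x => ?_⟩
  calc ‖f x • g x‖ ≤ C * Real.exp (c * ‖x‖) * (D * Real.exp (d * ‖x‖)) :=
        (norm_smul_le _ _).trans (mul_le_mul (hf x) (hg x) (norm_nonneg _) (by positivity))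
    _ = C * D * Real.exp ((c + d) * ‖x‖) := by rw [add_mul, Real.exp_add]; ring

theorem mul {𝕜 : Type*} [NormedField 𝕜] {f g : V → 𝕜} (hf : ExpBounded f) (hg : ExpBounded g) :
    ExpBounded fun x => f x * g x :=
  hf.smul hg

theorem const_mul {𝕜 : Type*} [NormedField 𝕜] (a : 𝕜) {f : V → 𝕜} (hf : ExpBounded f) :
    ExpBounded fun x => a * f x :=
  (const a).mul hf

theorem clm_apply [NormedSpace ℝ V] {f : V → V →L[ℝ] ℂ} (hf : ExpBounded f) (ξ : V) :
    ExpBounded fun x => f x ξ := by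
  obtain ⟨C, c, hC, hc, hf⟩ := hf
  refine ⟨C * ‖ξ‖, c, by positivity, hc, fun x => ?_⟩
  calc ‖f x ξ‖ ≤ C * Real.exp (c * ‖x‖) * ‖ξ‖ := (f x).le_of_opNorm_le (hf x) ξ
    _ = C * ‖ξ‖ * Real.exp (c * ‖x‖) := mul_right_comm _ _ _

theorem comp_linearIsometryEquiv [NormedSpace ℝ V] {f : V → W} (hf : ExpBounded f)
    (e : V ≃ₗᵢ[ℝ] V) : ExpBounded fun x => f (e x) := by
  obtain ⟨C, c, hC, hc, hf⟩ := hf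
  exact ⟨C, c, hC, hc, fun x => by simpa only [e.norm_map] using hf (e x)⟩

end Normed

variable {V : Type*} [NormedAddCommGroup V] [InnerProductSpace ℝ V]

theorem inner (ξ : V) : ExpBounded fun x : V => (⟪ξ, x⟫ : ℂ) := by
  refine ⟨‖ξ‖, 1, norm_nonneg ξ, zero_le_one, fun x => ?_⟩
  rw [Complex.norm_real, one_mul]
  refine (norm_inner_le_norm ξ x).trans ?_
  gcongr
  linarith [Real.add_one_le_exp ‖x‖]

end ExpBounded

theorem norm_ofReal_mul_le_of_le_gaussian {V : Type*} [Norm V] {f : V → ℂ} {g : V → ℝ} {a b C c : ℝ}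
    (hg : ∀ x, ‖g x‖ ≤ Real.exp (-a * ‖x‖ ^ 2 + b * ‖x‖))
    (hf : ∀ x, ‖f x‖ ≤ C * Real.exp (c * ‖x‖)) (x : V) :
    ‖(g x : ℂ) * f x‖ ≤ C * Real.exp (-a * ‖x‖ ^ 2 + (b + c) * ‖x‖) := by
  rw [norm_mul, Complex.norm_real]
  calc ‖g x‖ * ‖f x‖ ≤ Real.exp (-a * ‖x‖ ^ 2 + b * ‖x‖) * (C * Real.exp (c * ‖x‖)) :=
        mul_le_mul (hg x) (hf x) (norm_nonneg _) (Real.exp_pos _).le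
    _ = C * Real.exp (-a * ‖x‖ ^ 2 + (b + c) * ‖x‖) := by
        rw [mul_left_comm, ← Real.exp_add, add_mul, add_assoc]

section GaussianIntegrals

variable {V : Type*} [NormedAddCommGroup V] [InnerProductSpace ℝ V] [FiniteDimensional ℝ V]
  [MeasurableSpace V] [BorelSpace V]

theorem integrable_exp_neg_mul_sq_norm_add {a c : ℝ} (ha : 0 < a) :
    Integrable fun x : V => Real.exp (-a * ‖x‖ ^ 2 + c * ‖x‖) := by
  have hgauss : Integrable fun x : V => Real.exp (-(a / 2) * ‖x‖ ^ 2) := by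
    refine (GaussianFourier.integrable_cexp_neg_mul_sq_norm_add (V := V)
      (b := ((a / 2 : ℝ) : ℂ)) (by simpa using ha) 0 0).norm.congr (.of_forall fun x => ?_)
    simp [Complex.norm_exp, ← Complex.ofReal_pow]
  refine (hgauss.const_mul (Real.exp (c ^ 2 / (2 * a)))).mono' (by fun_prop)
    (.of_forall fun x => ?_)
  rw [Real.norm_of_nonneg (Real.exp_pos _).le, ← Real.exp_add, Real.exp_le_exp]
  have hsq : 0 ≤ (a * ‖x‖ - c) ^ 2 / (2 * a) := by positivity
  have hexpand : (a * ‖x‖ - c) ^ 2 / (2 * a) =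
      a / 2 * ‖x‖ ^ 2 - c * ‖x‖ + c ^ 2 / (2 * a) := by
    field_simp
    ring
  linarith

end GaussianIntegrals

/-- Differentiable functions that are of at most exponential growth together with their first
derivative, the class on which Dunkl operators are integrated by parts. -/
structure ExpBoundedDiff {V : Type*} [NormedAddCommGroup V] [NormedSpace ℝ V] (f : V → ℂ) :
    Prop where
  differentiable : Differentiable ℝ f
  expBounded : ExpBounded f
  expBounded_fderiv : ExpBounded (fderiv ℝ f)

namespace ExpBoundedDiff

theorem mul {V : Type*} [NormedAddCommGroup V] [NormedSpace ℝ V] {f g : V → ℂ}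
    (hf : ExpBoundedDiff f) (hg : ExpBoundedDiff g) : ExpBoundedDiff fun x => f x * g x where
  differentiable := hf.differentiable.mul hg.differentiable
  expBounded := hf.expBounded.mul hg.expBounded
  expBounded_fderiv := by
    have hfderiv : (fderiv ℝ fun x => f x * g x) =
        fun x => f x • fderiv ℝ g x + g x • fderiv ℝ f x :=
      funext fun x => fderiv_fun_mul (hf.differentiable x) (hg.differentiable x)
    rw [hfderiv]
    exact (hf.expBounded.smul hg.expBounded_fderiv).add (hg.expBounded.smul hf.expBounded_fderiv)

variable {N : ℕ} {f : ConfigSpace N → ℂ}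

theorem expBounded_diffQuot (hf : ExpBoundedDiff f) {α : ConfigSpace N} (hα : ‖α‖ ^ 2 = 2) :
    ExpBounded (diffQuot α f) := by
  obtain ⟨C, c, hC, hc, hle⟩ := hf.expBounded_fderiv
  refine ⟨C * ‖α‖, c, by positivity, hc, fun x => ?_⟩
  rw [diffQuot]
  split_ifs with hx
  · calc ‖fderiv ℝ f x α‖ ≤ C * Real.exp (c * ‖x‖) * ‖α‖ :=
          (fderiv ℝ f x).le_of_opNorm_le (hle x) α
      _ = C * ‖α‖ * Real.exp (c * ‖x‖) := mul_right_comm _ _ _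
  · rw [norm_div, Complex.norm_real, div_le_iff₀ (norm_pos_iff.mpr hx)]
    calc ‖f x - f (refl α x)‖ ≤ C * Real.exp (c * ‖x‖) * ‖x - refl α x‖ := by
          refine (convex_closedBall (0 : ConfigSpace N) ‖x‖).norm_image_sub_le_of_norm_fderiv_le
            (𝕜 := ℝ) (fun y _ => hf.differentiable y) (fun y hy => (hle y).trans ?_)
            (by simp) (by simp)
          have : ‖y‖ ≤ ‖x‖ := by simpa using hy
          gcongr
      _ = C * ‖α‖ * Real.exp (c * ‖x‖) * ‖⟪α, x⟫‖ := by
          rw [refl_apply hα, sub_sub_cancel, norm_smul]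
          ring

theorem measurable_diffQuot (hf : ExpBoundedDiff f) (α : ConfigSpace N) :
    Measurable (diffQuot α f) := by
  have hnum : Continuous fun x => f x - f (refl α x) :=
    hf.differentiable.continuous.sub (hf.differentiable.continuous.comp (refl α).continuous)
  have hden : Measurable fun x : ConfigSpace N => (⟪α, x⟫ : ℂ) := by fun_prop
  exact Measurable.ite (measurableSet_eq_fun (by fun_prop) measurable_const)
    (measurable_fderiv_apply_const ℝ f α) (hnum.measurable.div hden)

variable {𝓡 : Finset (ConfigSpace N)} {μ : ConfigSpace N → ℝ}

theorem expBounded_dunklOp (hf : ExpBoundedDiff f) (h𝓡 : IsRootSystem 𝓡) (ξ : ConfigSpace N) :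
    ExpBounded (dunklOp 𝓡 μ ξ f) :=
  (hf.expBounded_fderiv.clm_apply ξ).add ((ExpBounded.sum fun α hα =>
    (hf.expBounded_diffQuot (h𝓡.norm_sq α hα)).const_mul _).const_mul _)

theorem measurable_dunklOp (hf : ExpBoundedDiff f) (ξ : ConfigSpace N) :
    Measurable (dunklOp 𝓡 μ ξ f) :=
  (measurable_fderiv_apply_const ℝ f ξ).add ((Finset.measurable_fun_sum _ fun α _ =>
    (hf.measurable_diffQuot α).const_mul _).const_mul _)

end ExpBoundedDiff

end ExponentialGrowth

/-! ### The Dunkl Gaussian measure and integration by parts -/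

section GaussianMeasure

theorem measurePreserving_withDensity {X Y : Type*} [MeasurableSpace X]
    [MeasurableSpace Y] {ν : Measure X} {ν' : Measure Y} {e : X → Y} (he : MeasurePreserving e ν ν')
    {g : Y → ENNReal} (hg : Measurable g) :
    MeasurePreserving e (ν.withDensity fun x => g (e x)) (ν'.withDensity g) where
  measurable := he.measurable
  map_eq := by
    ext s hs
    rw [Measure.map_apply he.measurable hs, withDensity_apply _ (he.measurable hs),
      withDensity_apply _ hs, he.setLIntegral_comp_preimage hs hg]

variable {N : ℕ} {𝓡 : Finset (ConfigSpace N)} {μ : ConfigSpace N → ℝ} {α : ConfigSpace N}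

/-- The Gaussian density `exp(-‖x‖²/2) ∏ |⟨α, x⟩|^μ(α)` with each `|⟨α, x⟩|` replaced by
`(⟨α, x⟩² + ε²)^(1/2)`, which makes it smooth for `ε > 0`. -/
def regWeight (𝓡 : Finset (ConfigSpace N)) (μ : ConfigSpace N → ℝ) (ε : ℝ)
    (x : ConfigSpace N) : ℝ :=
  Real.exp (-‖x‖ ^ 2 / 2) * ∏ α ∈ 𝓡, (⟪α, x⟫ ^ 2 + ε ^ 2) ^ (μ α / 2)

theorem regWeight_zero (x : ConfigSpace N) :
    regWeight 𝓡 μ 0 x = Real.exp (-‖x‖ ^ 2 / 2) * weightTilde 𝓡 μ 1 x := by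
  simp only [regWeight, weightTilde, Real.one_rpow, one_mul]
  congr 1
  refine Finset.prod_congr rfl fun α _ => ?_
  rw [zero_pow two_ne_zero, add_zero, ← sq_abs, ← Real.rpow_natCast,
    ← Real.rpow_mul (abs_nonneg _)]
  congr 1
  push_cast
  ring

theorem regWeight_nonneg (ε : ℝ) (x : ConfigSpace N) : 0 ≤ regWeight 𝓡 μ ε x := by
  unfold regWeight
  positivity

theorem continuous_regWeight (hμ : IsMultiplicity 𝓡 μ) :
    Continuous fun p : ℝ × ConfigSpace N => regWeight 𝓡 μ p.1 p.2 := by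
  unfold regWeight
  refine Continuous.mul (by fun_prop) (continuous_finsetProd _ fun α hα => ?_)
  exact Continuous.rpow_const (by fun_prop) fun _ => .inr (hμ.half_nonneg α hα)

theorem measurable_regWeight (hμ : IsMultiplicity 𝓡 μ) (ε : ℝ) : Measurable (regWeight 𝓡 μ ε) :=
  ((continuous_regWeight hμ).comp (Continuous.prodMk_right ε)).measurable

theorem inner_sq_add_sq_le_exp (hα : ‖α‖ ^ 2 = 2) {ε : ℝ} (hε : ε ^ 2 ≤ 1)
    (x : ConfigSpace N) : ⟪α, x⟫ ^ 2 + ε ^ 2 ≤ Real.exp (2 * ‖x‖) := by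
  have hinner : ⟪α, x⟫ ^ 2 ≤ 2 * ‖x‖ ^ 2 := by
    rw [← hα, ← mul_pow, sq_le_sq, abs_of_nonneg (by positivity : 0 ≤ ‖α‖ * ‖x‖)]
    exact abs_real_inner_le_norm α x
  have hexp := Real.quadratic_le_exp_of_nonneg (by positivity : 0 ≤ 2 * ‖x‖)
  nlinarith [norm_nonneg x]

theorem norm_regWeight_le (h𝓡 : IsRootSystem 𝓡) (hμ : IsMultiplicity 𝓡 μ) {ε : ℝ}
    (hε : ε ^ 2 ≤ 1) (x : ConfigSpace N) :
    ‖regWeight 𝓡 μ ε x‖ ≤ Real.exp (-(1 / 2) * ‖x‖ ^ 2 + (∑ α ∈ 𝓡, μ α) * ‖x‖) := by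
  rw [Real.norm_of_nonneg (regWeight_nonneg ε x), regWeight, Real.exp_add, Finset.sum_mul,
    Real.exp_sum]
  refine mul_le_mul (Real.exp_le_exp.mpr (by linarith))
    (Finset.prod_le_prod (fun α _ => by positivity) fun α hα => ?_) (by positivity) (by positivity)
  calc (⟪α, x⟫ ^ 2 + ε ^ 2) ^ (μ α / 2) ≤ Real.exp (2 * ‖x‖) ^ (μ α / 2) :=
        Real.rpow_le_rpow (by positivity) (inner_sq_add_sq_le_exp (h𝓡.norm_sq α hα) hε x)
          (hμ.half_nonneg α hα)
    _ = Real.exp (μ α * ‖x‖) := by rw [← Real.exp_mul]; ring_nf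

theorem regWeight_refl (h𝓡 : IsRootSystem 𝓡) (hμ : IsMultiplicity 𝓡 μ) (hα : α ∈ 𝓡) (ε : ℝ)
    (x : ConfigSpace N) : regWeight 𝓡 μ ε (refl α x) = regWeight 𝓡 μ ε x := by
  rw [regWeight, regWeight, LinearIsometryEquiv.norm_map, ← h𝓡.prod_comp_refl hα]
  congr 1
  refine Finset.prod_congr rfl fun β hβ => ?_
  rw [LinearIsometryEquiv.inner_map_map, hμ.apply_refl hα hβ]

theorem hasLineDerivAt_regWeight {ε : ℝ} (hε : 0 < ε) (ξ x : ConfigSpace N) :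
    HasLineDerivAt ℝ (regWeight 𝓡 μ ε) (regWeight 𝓡 μ ε x *
      (∑ α ∈ 𝓡, μ α * ⟪α, ξ⟫ * (⟪α, x⟫ / (⟪α, x⟫ ^ 2 + ε ^ 2)) - ⟪ξ, x⟫)) x ξ := by
  have hlog : regWeight 𝓡 μ ε = fun x =>
      Real.exp (∑ α ∈ 𝓡, μ α / 2 * Real.log (⟪α, x⟫ ^ 2 + ε ^ 2) + -‖x‖ ^ 2 / 2) := by
    ext x
    rw [regWeight, add_comm, Real.exp_add, Real.exp_sum]
    congr 1
    refine Finset.prod_congr rfl fun α _ => ?_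
    rw [Real.rpow_def_of_pos (by positivity), mul_comm]
  have hline : HasDerivAt (fun t : ℝ => x + t • ξ) ξ 0 := by
    simpa using ((hasDerivAt_id (0 : ℝ)).smul_const ξ).const_add x
  have hgauss : HasDerivAt (fun t : ℝ => -‖x + t • ξ‖ ^ 2 / 2) (-⟪ξ, x⟫) 0 := by
    refine (hline.norm_sq.neg.div_const 2).congr_deriv ?_
    simp only [zero_smul, add_zero, real_inner_comm]
    ring
  have hroot : ∀ α ∈ 𝓡, HasDerivAt (fun t : ℝ => μ α / 2 * Real.log (⟪α, x + t • ξ⟫ ^ 2 + ε ^ 2))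
      (μ α * ⟪α, ξ⟫ * (⟪α, x⟫ / (⟪α, x⟫ ^ 2 + ε ^ 2))) 0 := by
    intro α _
    have hinner : HasDerivAt (fun t : ℝ => ⟪α, x + t • ξ⟫) ⟪α, ξ⟫ 0 :=
      (innerSL ℝ α).hasFDerivAt.comp_hasDerivAt (0 : ℝ) hline
    have hpos : ⟪α, x⟫ ^ 2 + ε ^ 2 ≠ 0 := by positivity
    refine ((((hinner.pow 2).add_const (ε ^ 2)).log (by simpa using hpos)).const_mul
      (μ α / 2)).congr_deriv ?_
    simp only [Nat.cast_ofNat, zero_smul, add_zero, Nat.add_one_sub_one, pow_one, Pi.pow_apply]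
    field_simp
  rw [hlog]
  refine ((HasDerivAt.fun_sum hroot).add hgauss).exp.congr_deriv ?_
  simp [sub_eq_add_neg]

theorem ae_inner_ne_zero (h𝓡 : IsRootSystem 𝓡) :
    ∀ᵐ x : ConfigSpace N, ∀ α ∈ 𝓡, ⟪α, x⟫ ≠ 0 := by
  rw [Filter.eventually_all_finset]
  intro α hα
  have hker : LinearMap.ker (innerₛₗ ℝ α) ≠ ⊤ := fun h =>
    h𝓡.ne_zero α hα <| by simpa using h.ge (Submodule.mem_top (x := α))
  simp only [ae_iff, not_not]
  exact Measure.addHaar_submodule volume _ hker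

/-- The measure with density `regWeight`. For `ε = 0` it is the product of the Gaussian
`exp(-‖x‖²/2)` and the measure `ω̃_{μ,1}`. -/
def gaussianMeasure (𝓡 : Finset (ConfigSpace N)) (μ : ConfigSpace N → ℝ) (ε : ℝ) :
    Measure (ConfigSpace N) :=
  volume.withDensity fun x => ENNReal.ofReal (regWeight 𝓡 μ ε x)

theorem integral_gaussianMeasure (hμ : IsMultiplicity 𝓡 μ) (ε : ℝ) (f : ConfigSpace N → ℂ) :
    ∫ x, f x ∂gaussianMeasure 𝓡 μ ε = ∫ x, (regWeight 𝓡 μ ε x : ℂ) * f x := by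
  rw [gaussianMeasure, integral_withDensity_eq_integral_toReal_smul
    (measurable_regWeight hμ ε).ennreal_ofReal (.of_forall fun _ => ENNReal.ofReal_lt_top)]
  simp only [ENNReal.toReal_ofReal (regWeight_nonneg ε _), Complex.real_smul]

theorem integrable_gaussianMeasure_iff (hμ : IsMultiplicity 𝓡 μ) {ε : ℝ}
    {f : ConfigSpace N → ℂ} : Integrable f (gaussianMeasure 𝓡 μ ε) ↔
      Integrable fun x => (regWeight 𝓡 μ ε x : ℂ) * f x := by
  rw [gaussianMeasure, integrable_withDensity_iff_integrable_smul'
    (measurable_regWeight hμ ε).ennreal_ofReal (.of_forall fun _ => ENNReal.ofReal_lt_top)]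
  simp only [ENNReal.toReal_ofReal (regWeight_nonneg ε _), Complex.real_smul]

theorem ExpBounded.integrable_gaussianMeasure {f : ConfigSpace N → ℂ} (hf : ExpBounded f)
    (hfm : Measurable f) (h𝓡 : IsRootSystem 𝓡) (hμ : IsMultiplicity 𝓡 μ) {ε : ℝ}
    (hε : ε ^ 2 ≤ 1) : Integrable f (gaussianMeasure 𝓡 μ ε) := by
  obtain ⟨C, c, -, -, hle⟩ := hf
  have := measurable_regWeight hμ ε
  rw [integrable_gaussianMeasure_iff hμ]
  exact ((integrable_exp_neg_mul_sq_norm_add (by norm_num)).const_mul C).mono'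
    (by fun_prop) (.of_forall (norm_ofReal_mul_le_of_le_gaussian (norm_regWeight_le h𝓡 hμ hε) hle))

theorem measurePreserving_refl_gaussianMeasure (h𝓡 : IsRootSystem 𝓡) (hμ : IsMultiplicity 𝓡 μ)
    (hα : α ∈ 𝓡) (ε : ℝ) : MeasurePreserving (refl α) (gaussianMeasure 𝓡 μ ε)
      (gaussianMeasure 𝓡 μ ε) := by
  simpa only [gaussianMeasure, regWeight_refl h𝓡 hμ hα] using measurePreserving_withDensity
    (refl α).measurePreserving (measurable_regWeight hμ ε).ennreal_ofReal

theorem integral_gaussianMeasure_comp_refl (h𝓡 : IsRootSystem 𝓡) (hμ : IsMultiplicity 𝓡 μ)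
    (hα : α ∈ 𝓡) (ε : ℝ) (f : ConfigSpace N → ℂ) :
    ∫ x, f (refl α x) ∂gaussianMeasure 𝓡 μ ε = ∫ x, f x ∂gaussianMeasure 𝓡 μ ε :=
  (measurePreserving_refl_gaussianMeasure h𝓡 hμ hα ε).integral_comp
    (refl α).toHomeomorph.measurableEmbedding f

theorem tendsto_integral_gaussianMeasure (h𝓡 : IsRootSystem 𝓡) (hμ : IsMultiplicity 𝓡 μ)
    {F : ℝ → ConfigSpace N → ℂ} {f : ConfigSpace N → ℂ} {C c : ℝ} (hF : ∀ ε, Measurable (F ε))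
    (hle : ∀ ε x, ‖F ε x‖ ≤ C * Real.exp (c * ‖x‖))
    (hlim : ∀ᵐ x, Filter.Tendsto (fun ε => F ε x) (nhdsWithin 0 (Set.Ioi 0)) (nhds (f x))) :
    Filter.Tendsto (fun ε => ∫ x, F ε x ∂gaussianMeasure 𝓡 μ ε) (nhdsWithin 0 (Set.Ioi 0))
      (nhds (∫ x, f x ∂gaussianMeasure 𝓡 μ 0)) := by
  simp only [integral_gaussianMeasure hμ]
  refine tendsto_integral_filter_of_dominated_convergence
    (fun x => C * Real.exp (-(1 / 2) * ‖x‖ ^ 2 + ((∑ α ∈ 𝓡, μ α) + c) * ‖x‖)) ?_ ?_ ?_ ?_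
  · refine .of_forall fun ε => ?_
    have := measurable_regWeight hμ ε
    have := hF ε
    fun_prop
  · filter_upwards [Ioo_mem_nhdsGT (zero_lt_one' ℝ)] with ε hε
    have hε1 : ε ^ 2 ≤ 1 := pow_le_one₀ hε.1.le hε.2.le
    exact .of_forall (norm_ofReal_mul_le_of_le_gaussian (norm_regWeight_le h𝓡 hμ hε1) (hle ε))
  · exact (integrable_exp_neg_mul_sq_norm_add (by norm_num)).const_mul C
  · filter_upwards [hlim] with x hx
    have hw : Filter.Tendsto (fun ε => (regWeight 𝓡 μ ε x : ℂ)) (nhdsWithin 0 (Set.Ioi 0))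
        (nhds (regWeight 𝓡 μ 0 x : ℂ)) :=
      ((Complex.continuous_ofReal.comp ((continuous_regWeight hμ).comp
        (Continuous.prodMk_left x))).tendsto 0).mono_left nhdsWithin_le_nhds
    exact hw.mul hx

variable {f g : ConfigSpace N → ℂ}

theorem inner_refl (hα : ‖α‖ ^ 2 = 2) (x : ConfigSpace N) : ⟪α, refl α x⟫ = -⟪α, x⟫ := by
  rw [refl_apply hα, inner_sub_right, real_inner_smul_right, real_inner_self_eq_norm_sq, hα]
  ring

theorem diffQuot_refl (hα : ‖α‖ ^ 2 = 2) (f : ConfigSpace N → ℂ) (x : ConfigSpace N) :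
    diffQuot α f (refl α x) = diffQuot α f x := by
  by_cases hx : ⟪α, x⟫ = 0
  · rw [refl_apply hα, hx, zero_smul, sub_zero]
  · have hrr : refl α (refl α x) = x := Submodule.reflection_reflection _ x
    rw [diffQuot, diffQuot, inner_refl hα, if_neg hx, if_neg (neg_ne_zero.mpr hx), hrr,
      Complex.ofReal_neg, div_neg, ← neg_div, neg_sub]

theorem diffQuot_mul (hα : ‖α‖ ^ 2 = 2) {x : ConfigSpace N} (hf : DifferentiableAt ℝ f x)
    (hg : DifferentiableAt ℝ g x) : diffQuot α (fun x => f x * g x) x =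
      diffQuot α f x * g x + f x * diffQuot α g x -
        (⟪α, x⟫ : ℂ) * (diffQuot α f x * diffQuot α g x) := by
  by_cases hx : ⟪α, x⟫ = 0
  · rw [diffQuot, diffQuot, diffQuot, if_pos hx, if_pos hx, if_pos hx, fderiv_fun_mul hf hg, hx]
    simp only [Complex.ofReal_zero, zero_mul, sub_zero, add_apply, smul_apply, smul_eq_mul]
    ring
  · have hxc : (⟪α, x⟫ : ℂ) ≠ 0 := Complex.ofReal_ne_zero.mpr hx
    refine mul_left_cancel₀ hxc ?_
    have hf' := inner_mul_diffQuot hα f x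
    have hg' := inner_mul_diffQuot hα g x
    rw [inner_mul_diffQuot hα]
    linear_combination -(g x - ⟪α, x⟫ * diffQuot α g x) * hf' - f (refl α x) * hg'

theorem dunklOp_mul_add_mul_dunklOp (h𝓡 : IsRootSystem 𝓡) (ξ : ConfigSpace N) {x : ConfigSpace N}
    (hf : DifferentiableAt ℝ f x) (hg : DifferentiableAt ℝ g x) :
    dunklOp 𝓡 μ ξ f x * g x + f x * dunklOp 𝓡 μ ξ g x =
      dunklOp 𝓡 μ ξ (fun x => f x * g x) x + (1 / 2 : ℂ) * ∑ α ∈ 𝓡, (μ α : ℂ) * (⟪α, ξ⟫ : ℂ) *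
        ((⟪α, x⟫ : ℂ) * (diffQuot α f x * diffQuot α g x)) := by
  have hsum : ∑ α ∈ 𝓡, (μ α : ℂ) * (⟪α, ξ⟫ : ℂ) * diffQuot α (fun x => f x * g x) x =
      (∑ α ∈ 𝓡, (μ α : ℂ) * (⟪α, ξ⟫ : ℂ) * diffQuot α f x) * g x +
        f x * ∑ α ∈ 𝓡, (μ α : ℂ) * (⟪α, ξ⟫ : ℂ) * diffQuot α g x -
        ∑ α ∈ 𝓡, (μ α : ℂ) * (⟪α, ξ⟫ : ℂ) *
          ((⟪α, x⟫ : ℂ) * (diffQuot α f x * diffQuot α g x)) := by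
    rw [Finset.sum_mul, Finset.mul_sum, ← Finset.sum_add_distrib, ← Finset.sum_sub_distrib]
    refine Finset.sum_congr rfl fun α hα => ?_
    rw [diffQuot_mul (h𝓡.norm_sq α hα) hf hg]
    ring
  rw [dunklOp, dunklOp, dunklOp, hsum, fderiv_fun_mul hf hg]
  simp only [add_apply, smul_apply, smul_eq_mul]
  ring

/-- Replacing `1 / ⟨α, x⟩` by `⟨α, x⟩ / (⟨α, x⟩² + ε²)` in the Dunkl operator `T_ξ` gives the
operator adapted to the weight `regWeight ε`. -/
def regDunklOp (𝓡 : Finset (ConfigSpace N)) (μ : ConfigSpace N → ℝ) (ε : ℝ) (ξ : ConfigSpace N)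
    (f : ConfigSpace N → ℂ) (x : ConfigSpace N) : ℂ :=
  fderiv ℝ f x ξ + (1 / 2 : ℂ) * ∑ α ∈ 𝓡, (μ α : ℂ) * (⟪α, ξ⟫ : ℂ) *
    (((⟪α, x⟫ / (⟪α, x⟫ ^ 2 + ε ^ 2) : ℝ) : ℂ) * (f x - f (refl α x)))

theorem tendsto_regDunklOp {x : ConfigSpace N} (hx : ∀ α ∈ 𝓡, ⟪α, x⟫ ≠ 0) (ξ : ConfigSpace N) :
    Filter.Tendsto (fun ε => regDunklOp 𝓡 μ ε ξ f x) (nhds 0) (nhds (dunklOp 𝓡 μ ξ f x)) := by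
  refine tendsto_const_nhds.add ((tendsto_finsetSum _ fun α hα => ?_).const_mul _)
  refine Filter.Tendsto.const_mul _ ?_
  have hx := hx α hα
  have hcont : ContinuousAt (fun ε : ℝ => ⟪α, x⟫ / (⟪α, x⟫ ^ 2 + ε ^ 2)) 0 :=
    continuousAt_const.div (by fun_prop) (by positivity)
  have hvalue : diffQuot α f x =
      ((⟪α, x⟫ / (⟪α, x⟫ ^ 2 + 0 ^ 2) : ℝ) : ℂ) * (f x - f (refl α x)) := by
    rw [diffQuot, if_neg hx]
    simp [field]
  rw [hvalue]
  exact (Complex.continuous_ofReal.continuousAt.comp hcont).tendsto.mul_const _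

theorem norm_inner_div_mul_sub_le (hα : ‖α‖ ^ 2 = 2) (ε : ℝ) (f : ConfigSpace N → ℂ)
    (x : ConfigSpace N) :
    ‖((⟪α, x⟫ / (⟪α, x⟫ ^ 2 + ε ^ 2) : ℝ) : ℂ) * (f x - f (refl α x))‖ ≤ ‖diffQuot α f x‖ := by
  rw [← inner_mul_diffQuot hα, ← mul_assoc, norm_mul, ← Complex.ofReal_mul, Complex.norm_real]
  refine mul_le_of_le_one_left (norm_nonneg _) ?_
  rw [div_mul_eq_mul_div, ← sq, Real.norm_of_nonneg (by positivity)]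
  exact div_le_one_of_le₀ (by linarith [sq_nonneg ε]) (by positivity)

theorem norm_inner_div_le {ε : ℝ} (hε : 0 < ε) (x : ConfigSpace N) :
    ‖((⟪α, x⟫ / (⟪α, x⟫ ^ 2 + ε ^ 2) : ℝ) : ℂ)‖ ≤ (2 * ε)⁻¹ := by
  rw [Complex.norm_real, Real.norm_eq_abs, abs_div, abs_of_pos (a := _ + _) (by positivity),
    div_le_iff₀ (by positivity), ← div_eq_inv_mul, le_div_iff₀ (by positivity), ← sq_abs ⟪α, x⟫]
  linarith [two_mul_le_add_sq |⟪α, x⟫| ε]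

theorem expBounded_inner_div (α : ConfigSpace N) {ε : ℝ} (hε : 0 < ε) :
    ExpBounded fun x : ConfigSpace N => ((⟪α, x⟫ / (⟪α, x⟫ ^ 2 + ε ^ 2) : ℝ) : ℂ) :=
  (ExpBounded.const (2 * ε)⁻¹).of_norm_le fun x =>
    (norm_inner_div_le hε x).trans (Real.le_norm_self _)

/-- The logarithmic derivative of `regWeight ε` in the direction `ξ`. -/
def logDerivRegWeight (𝓡 : Finset (ConfigSpace N)) (μ : ConfigSpace N → ℝ) (ε : ℝ)
    (ξ x : ConfigSpace N) : ℂ :=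
  ∑ α ∈ 𝓡, (μ α : ℂ) * (⟪α, ξ⟫ : ℂ) * ((⟪α, x⟫ / (⟪α, x⟫ ^ 2 + ε ^ 2) : ℝ) : ℂ) - (⟪ξ, x⟫ : ℂ)

theorem expBounded_logDerivRegWeight {ε : ℝ} (hε : 0 < ε) (ξ : ConfigSpace N) :
    ExpBounded (logDerivRegWeight 𝓡 μ ε ξ) :=
  (ExpBounded.sum fun α _ => (expBounded_inner_div α hε).const_mul _).sub (ExpBounded.inner ξ)

theorem measurable_logDerivRegWeight (ε : ℝ) (ξ : ConfigSpace N) :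
    Measurable (logDerivRegWeight 𝓡 μ ε ξ) := by
  unfold logDerivRegWeight
  fun_prop

theorem integral_inner_mul_diffQuot_mul_diffQuot (h𝓡 : IsRootSystem 𝓡)
    (hμ : IsMultiplicity 𝓡 μ) (hα : α ∈ 𝓡) (f g : ConfigSpace N → ℂ) :
    ∫ x, (⟪α, x⟫ : ℂ) * (diffQuot α f x * diffQuot α g x) ∂gaussianMeasure 𝓡 μ 0 = 0 := by
  have hn := h𝓡.norm_sq α hα
  have hodd := integral_gaussianMeasure_comp_refl h𝓡 hμ hα 0
    fun x => (⟪α, x⟫ : ℂ) * (diffQuot α f x * diffQuot α g x)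
  simp only [inner_refl hn, diffQuot_refl hn, Complex.ofReal_neg, neg_mul, integral_neg] at hodd
  linear_combination -hodd / 2

namespace ExpBoundedDiff

theorem exists_forall_norm_regDunklOp_le (hf : ExpBoundedDiff f) (h𝓡 : IsRootSystem 𝓡)
    (ξ : ConfigSpace N) :
    ∃ C c : ℝ, ∀ ε x, ‖regDunklOp 𝓡 μ ε ξ f x‖ ≤ C * Real.exp (c * ‖x‖) := by
  have hbound : ExpBounded fun x => ‖fderiv ℝ f x ξ‖ +
      ‖(1 / 2 : ℂ)‖ * ∑ α ∈ 𝓡, ‖(μ α : ℂ) * (⟪α, ξ⟫ : ℂ)‖ * ‖diffQuot α f x‖ :=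
    (hf.expBounded_fderiv.clm_apply ξ).norm.add <| .const_mul _ <| .sum fun α hα =>
      (hf.expBounded_diffQuot (h𝓡.norm_sq α hα)).norm.const_mul _
  obtain ⟨C, c, -, -, hle⟩ := hbound
  refine ⟨C, c, fun ε x => le_trans ?_ ((le_abs_self _).trans (hle x))⟩
  refine norm_add_le_of_le le_rfl ?_
  rw [norm_mul]
  refine mul_le_mul_of_nonneg_left (norm_sum_le_of_le _ fun α hα => ?_) (norm_nonneg _)
  rw [norm_mul]
  exact mul_le_mul_of_nonneg_left (norm_inner_div_mul_sub_le (h𝓡.norm_sq α hα) ε f x)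
    (norm_nonneg _)

theorem measurable_regDunklOp (hf : ExpBoundedDiff f) (ε : ℝ) (ξ : ConfigSpace N) :
    Measurable (regDunklOp 𝓡 μ ε ξ f) := by
  have hfm := hf.differentiable.continuous.measurable
  have hfr : ∀ α, Measurable fun x => f (refl α x) := fun α =>
    hfm.comp (refl α).continuous.measurable
  exact (measurable_fderiv_apply_const ℝ f ξ).add <| .const_mul
    (Finset.measurable_fun_sum _ fun α _ => by have := hfr α; fun_prop) _

theorem integral_fderiv_gaussianMeasure (hf : ExpBoundedDiff f) (h𝓡 : IsRootSystem 𝓡)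
    (hμ : IsMultiplicity 𝓡 μ) {ε : ℝ} (hε : 0 < ε) (hε1 : ε ^ 2 ≤ 1) (ξ : ConfigSpace N) :
    ∫ x, fderiv ℝ f x ξ ∂gaussianMeasure 𝓡 μ ε =
      -∫ x, logDerivRegWeight 𝓡 μ ε ξ x * f x ∂gaussianMeasure 𝓡 μ ε := by
  have hfm := hf.differentiable.continuous.measurable
  have hderiv : ∀ x, HasLineDerivAt ℝ (fun x => (regWeight 𝓡 μ ε x : ℂ))
      ((regWeight 𝓡 μ ε x : ℂ) * logDerivRegWeight 𝓡 μ ε ξ x) x ξ := fun x => by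
    simpa [HasLineDerivAt, logDerivRegWeight] using (hasLineDerivAt_regWeight hε ξ x).ofReal_comp
  have hint : ∀ {F : ConfigSpace N → ℂ}, ExpBounded F → Measurable F →
      Integrable fun x => (regWeight 𝓡 μ ε x : ℂ) * F x := fun hF hFm =>
    (integrable_gaussianMeasure_iff hμ).mp (hF.integrable_gaussianMeasure hFm h𝓡 hμ hε1)
  simp only [integral_gaussianMeasure hμ, ← mul_assoc]
  refine integral_bilinear_hasLineDerivAt_right_eq_neg_left_of_integrable
    (B := ContinuousLinearMap.mul ℝ ℂ) ?_ ?_ ?_ (fun x _ => hderiv x)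
    (fun x _ => (hf.differentiable x).hasFDerivAt.hasLineDerivAt ξ)
  · simpa only [ContinuousLinearMap.mul_apply', mul_assoc] using
      hint ((expBounded_logDerivRegWeight hε ξ).mul hf.expBounded)
        ((measurable_logDerivRegWeight ε ξ).mul hfm)
  · exact hint (hf.expBounded_fderiv.clm_apply ξ) (measurable_fderiv_apply_const ℝ f ξ)
  · exact hint hf.expBounded hfm

theorem integral_inner_div_mul (hf : ExpBoundedDiff f) (h𝓡 : IsRootSystem 𝓡)
    (hμ : IsMultiplicity 𝓡 μ) (hα : α ∈ 𝓡) {ε : ℝ} (hε : 0 < ε) (hε1 : ε ^ 2 ≤ 1) :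
    ∫ x, ((⟪α, x⟫ / (⟪α, x⟫ ^ 2 + ε ^ 2) : ℝ) : ℂ) * f x ∂gaussianMeasure 𝓡 μ ε =
      1 / 2 * ∫ x, ((⟪α, x⟫ / (⟪α, x⟫ ^ 2 + ε ^ 2) : ℝ) : ℂ) * (f x - f (refl α x))
        ∂gaussianMeasure 𝓡 μ ε := by
  set ρ : ConfigSpace N → ℂ := fun x => ((⟪α, x⟫ / (⟪α, x⟫ ^ 2 + ε ^ 2) : ℝ) : ℂ) with hρ
  have hodd : ∀ x, ρ (refl α x) = -ρ x := fun x => by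
    simp only [hρ, inner_refl (h𝓡.norm_sq α hα), neg_sq, neg_div, Complex.ofReal_neg]
  have hrr : ∀ x, refl α (refl α x) = x := Submodule.reflection_reflection _
  have hint : Integrable (fun x => ρ x * f x) (gaussianMeasure 𝓡 μ ε) :=
    ((expBounded_inner_div α hε).mul hf.expBounded).integrable_gaussianMeasure
      (.mul (by fun_prop) hf.differentiable.continuous.measurable) h𝓡 hμ hε1
  have hpres := measurePreserving_refl_gaussianMeasure h𝓡 hμ hα ε
  have hint' : Integrable (fun x => ρ x * f (refl α x)) (gaussianMeasure 𝓡 μ ε) := by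
    simpa [Function.comp_def, hodd] using (hpres.integrable_comp_of_integrable hint).neg
  have hneg : ∫ x, ρ x * f (refl α x) ∂gaussianMeasure 𝓡 μ ε =
      -∫ x, ρ x * f x ∂gaussianMeasure 𝓡 μ ε := by
    rw [← integral_gaussianMeasure_comp_refl h𝓡 hμ hα]
    simp only [hodd, hrr, neg_mul, integral_neg]
  simp only [mul_sub]
  rw [integral_sub hint hint', hneg]
  ring

theorem integral_inner_mul_eq_integral_regDunklOp (hf : ExpBoundedDiff f) (h𝓡 : IsRootSystem 𝓡)
    (hμ : IsMultiplicity 𝓡 μ) {ε : ℝ} (hε : 0 < ε) (hε1 : ε ^ 2 ≤ 1) (ξ : ConfigSpace N) :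
    ∫ x, (⟪ξ, x⟫ : ℂ) * f x ∂gaussianMeasure 𝓡 μ ε =
      ∫ x, regDunklOp 𝓡 μ ε ξ f x ∂gaussianMeasure 𝓡 μ ε := by
  have hfm := hf.differentiable.continuous.measurable
  have hint : ∀ {F : ConfigSpace N → ℂ}, ExpBounded F → Measurable F →
      Integrable F (gaussianMeasure 𝓡 μ ε) := fun hF hFm =>
    hF.integrable_gaussianMeasure hFm h𝓡 hμ hε1
  have hρ : ∀ α ∈ 𝓡, Integrable (fun x => (μ α : ℂ) * (⟪α, ξ⟫ : ℂ) *
      (((⟪α, x⟫ / (⟪α, x⟫ ^ 2 + ε ^ 2) : ℝ) : ℂ) * f x)) (gaussianMeasure 𝓡 μ ε) := fun α _ =>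
    (hint ((expBounded_inner_div α hε).mul hf.expBounded) (by fun_prop)).const_mul _
  have hσ : ∀ α ∈ 𝓡, Integrable (fun x => (μ α : ℂ) * (⟪α, ξ⟫ : ℂ) *
      (((⟪α, x⟫ / (⟪α, x⟫ ^ 2 + ε ^ 2) : ℝ) : ℂ) * (f x - f (refl α x))))
      (gaussianMeasure 𝓡 μ ε) := fun α _ =>
    (hint ((expBounded_inner_div α hε).mul
      (hf.expBounded.sub (hf.expBounded.comp_linearIsometryEquiv (refl α))))
      (by have := hfm.comp (refl α).continuous.measurable; fun_prop)).const_mul _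
  have hparts := hf.integral_fderiv_gaussianMeasure h𝓡 hμ hε hε1 ξ
  simp only [logDerivRegWeight, sub_mul, Finset.sum_mul, mul_assoc] at hparts
  simp only [mul_assoc] at hρ hσ
  rw [integral_sub (integrable_finsetSum _ hρ) (hint ((ExpBounded.inner ξ).mul hf.expBounded)
    (by fun_prop)), integral_finsetSum _ hρ] at hparts
  simp only [regDunklOp, mul_assoc]
  rw [integral_add (hint (hf.expBounded_fderiv.clm_apply ξ) (measurable_fderiv_apply_const ℝ f ξ))
    ((integrable_finsetSum _ hσ).const_mul _), integral_const_mul, integral_finsetSum _ hσ, hparts,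
    neg_sub, Finset.mul_sum, ← add_sub_right_comm, eq_sub_iff_add_eq]
  congr 1
  refine Finset.sum_congr rfl fun α hα => ?_
  simp only [integral_const_mul]
  rw [hf.integral_inner_div_mul h𝓡 hμ hα hε hε1]
  ring

theorem integral_inner_mul_eq_integral_dunklOp (hf : ExpBoundedDiff f) (h𝓡 : IsRootSystem 𝓡)
    (hμ : IsMultiplicity 𝓡 μ) (ξ : ConfigSpace N) :
    ∫ x, (⟪ξ, x⟫ : ℂ) * f x ∂gaussianMeasure 𝓡 μ 0 =
      ∫ x, dunklOp 𝓡 μ ξ f x ∂gaussianMeasure 𝓡 μ 0 := by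
  obtain ⟨C, c, hle⟩ := hf.exists_forall_norm_regDunklOp_le (μ := μ) h𝓡 ξ
  obtain ⟨D, d, -, -, hinner⟩ := (ExpBounded.inner ξ).mul hf.expBounded
  have hfm := hf.differentiable.continuous.measurable
  have hleft := tendsto_integral_gaussianMeasure h𝓡 hμ
    (F := fun _ x => (⟪ξ, x⟫ : ℂ) * f x) (fun _ => by fun_prop) (fun _ => hinner)
    (.of_forall fun _ => tendsto_const_nhds)
  have hright := tendsto_integral_gaussianMeasure h𝓡 hμ
    (F := fun ε => regDunklOp 𝓡 μ ε ξ f) (fun ε => hf.measurable_regDunklOp ε ξ) hle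
    ((ae_inner_ne_zero h𝓡).mono fun x hx => (tendsto_regDunklOp hx ξ).mono_left nhdsWithin_le_nhds)
  refine tendsto_nhds_unique_of_eventuallyEq hleft hright ?_
  filter_upwards [Ioo_mem_nhdsGT (zero_lt_one' ℝ)] with ε hε
  exact hf.integral_inner_mul_eq_integral_regDunklOp h𝓡 hμ hε.1
    (pow_le_one₀ hε.1.le hε.2.le) ξ

theorem integral_inner_mul_mul (hf : ExpBoundedDiff f) (hg : ExpBoundedDiff g)
    (h𝓡 : IsRootSystem 𝓡) (hμ : IsMultiplicity 𝓡 μ) (ξ : ConfigSpace N) :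
    ∫ x, (⟪ξ, x⟫ : ℂ) * (f x * g x) ∂gaussianMeasure 𝓡 μ 0 =
      ∫ x, (dunklOp 𝓡 μ ξ f x * g x + f x * dunklOp 𝓡 μ ξ g x) ∂gaussianMeasure 𝓡 μ 0 := by
  have hint : ∀ α ∈ 𝓡, Integrable (fun x => (μ α : ℂ) * (⟪α, ξ⟫ : ℂ) * ((⟪α, x⟫ : ℂ) *
      (diffQuot α f x * diffQuot α g x))) (gaussianMeasure 𝓡 μ 0) := fun α hα => by
    have hfα := hf.expBounded_diffQuot (h𝓡.norm_sq α hα)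
    have hgα := hg.expBounded_diffQuot (h𝓡.norm_sq α hα)
    have := hf.measurable_diffQuot α
    have := hg.measurable_diffQuot α
    exact (((ExpBounded.inner α).mul (hfα.mul hgα)).integrable_gaussianMeasure (by fun_prop)
      h𝓡 hμ (by norm_num)).const_mul _
  have hfg := hf.mul hg
  have hTfg := (hfg.expBounded_dunklOp (μ := μ) h𝓡 ξ).integrable_gaussianMeasure
    (hfg.measurable_dunklOp ξ) h𝓡 hμ (ε := 0) (by norm_num)
  simp only [dunklOp_mul_add_mul_dunklOp h𝓡 ξ (hf.differentiable _) (hg.differentiable _)]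
  rw [hfg.integral_inner_mul_eq_integral_dunklOp h𝓡 hμ ξ, integral_add hTfg
    ((integrable_finsetSum _ hint).const_mul _), integral_const_mul, integral_finsetSum _ hint]
  simp only [integral_const_mul]
  rw [Finset.sum_eq_zero fun α hα => ?_, mul_zero, add_zero]
  rw [integral_inner_mul_diffQuot_mul_diffQuot h𝓡 hμ hα, mul_zero]

end ExpBoundedDiff

end GaussianMeasure

/-! ### The Gaussian integral of two Dunkl kernels -/

section GaussianIntegral

theorem hasDerivAt_integral_of_forall_norm_le {X : Type*} [MeasurableSpace X] {ν : Measure X}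
    {F F' : ℂ → X → ℂ} {B : X → ℝ} (c : ℂ) (hF : ∀ q t, HasDerivAt (fun t => F t q) (F' t q) t)
    (hFm : ∀ t, AEStronglyMeasurable (F t) ν) (hB : Integrable B ν)
    (hle : ∀ q, ∀ t ∈ Metric.ball c 2, ‖F t q‖ ≤ B q) :
    HasDerivAt (fun t => ∫ q, F t q ∂ν) (∫ q, F' c q ∂ν) c := by
  have hbound : ∀ q, ∀ t ∈ Metric.ball c 1, ‖F' t q‖ ≤ 2 * B q := fun q t ht => by
    have hsub : Metric.ball t 1 ⊆ Metric.ball c 2 :=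
      Metric.ball_subset_ball' (by linarith [Metric.mem_ball.mp ht])
    have hcauchy := norm_fderiv_le_of_forall_mem_ball one_pos
      (fun s _ => (hF q s).differentiableAt.differentiableWithinAt) fun s hs => hle q s (hsub hs)
    rwa [← norm_deriv_eq_norm_fderiv, (hF q t).deriv, div_one] at hcauchy
  have hmeas : AEStronglyMeasurable (F' c) ν :=
    aestronglyMeasurable_of_tendsto_ae (nhdsWithin (0 : ℂ) {0}ᶜ)
      (f := fun t q => t⁻¹ • (F (c + t) q - F c q))
      (fun t => ((hFm (c + t)).sub (hFm c)).const_smul t⁻¹)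
      (.of_forall fun q => (hF q c).tendsto_slope_zero)
  have hint : Integrable (F c) ν :=
    hB.mono' (hFm c) (.of_forall fun q => hle q c (Metric.mem_ball_self two_pos))
  exact (hasDerivAt_integral_of_dominated_loc_of_deriv_le (s := Metric.ball c 1)
    (Metric.ball_mem_nhds c one_pos) (.of_forall hFm) hint hmeas (.of_forall hbound)
    (hB.const_mul 2) (.of_forall fun q t _ => hF q t)).2

theorem continuous_integral_of_forall_norm_le {V X : Type*} [NormedAddCommGroup V]
    [MeasurableSpace X] {ν : Measure X} {F : V → X → ℂ} {B : ℝ → X → ℝ}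
    (hF : ∀ q, Continuous fun z => F z q) (hFm : ∀ z, AEStronglyMeasurable (F z) ν)
    (hB : ∀ R, Integrable (B R) ν) (hle : ∀ R z q, ‖z‖ ≤ R → ‖F z q‖ ≤ B R q) :
    Continuous fun z => ∫ q, F z q ∂ν := by
  refine continuous_iff_continuousAt.mpr fun z₀ => continuousAt_of_dominated (.of_forall hFm) ?_
    (hB (‖z₀‖ + 1)) (.of_forall fun q => (hF q).continuousAt)
  filter_upwards [continuous_norm.continuousAt.eventually_lt_const (lt_add_one ‖z₀‖)] with z hz
  exact .of_forall fun q => hle _ z q hz.le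

variable {N : ℕ} {𝓡 : Finset (ConfigSpace N)} {μ : ConfigSpace N → ℝ}

theorem hasDerivAt_holoSq_smul (x : PhaseSpace N) :
    HasDerivAt (fun t : ℝ => holoSq (t • x)) (2 * holoSq x) 1 := by
  have hscale : ∀ t : ℝ, holoSq (t • x) = ((t ^ 2 : ℝ) : ℂ) * holoSq x := fun t => by
    simp [holoSq, mul_pow, Finset.mul_sum]
  simp only [hscale]
  simpa using (hasDerivAt_pow 2 (1 : ℝ)).ofReal_comp.mul_const (holoSq x)

theorem bil_toPhase_right_eq_sum (z : PhaseSpace N) (x : ConfigSpace N) :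
    bil z (toPhase x) = ∑ i, z i * (⟪EuclideanSpace.single i (1 : ℝ), x⟫ : ℂ) := by
  simp [bil_apply, EuclideanSpace.inner_single_left]

theorem bil_toPhase_single (i : Fin N) (z : PhaseSpace N) :
    bil (toPhase (EuclideanSpace.single i (1 : ℝ))) z = z i := by
  simp [bil_apply, apply_ite]

namespace IsEntireDunklKernel

variable {E : PhaseSpace N → PhaseSpace N → ℂ} (hE : IsEntireDunklKernel 𝓡 μ E)

include hE

theorem continuous_toPhase_right (z : PhaseSpace N) : Continuous fun q => E z (toPhase q) :=
  (hE.differentiable_right z).continuous.comp continuous_toPhase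

theorem deriv_smul_left (z y : PhaseSpace N) : deriv (fun t : ℂ => E (t • z) y) 1 =
    bil z y * E z y - ∑ α ∈ 𝓡, ((μ α / 2 : ℝ) : ℂ) * (E z y - E (phaseRefl α z) y) := by
  have hdiff : Differentiable ℂ fun t : ℂ => E (t • z) y :=
    (hE.differentiable_left y).comp (by fun_prop)
  exact (hdiff 1).hasDerivAt.comp_ofReal.unique ((hE.isRadialSolution y).hasDerivAt z)

variable (h𝓡 : IsRootSystem 𝓡) (hμ : IsMultiplicity 𝓡 μ)

include h𝓡 hμ

theorem norm_toPhase_right_le {z : PhaseSpace N} {R : ℝ} (hz : ‖z‖ ≤ R) (q : ConfigSpace N) :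
    ‖E z (toPhase q)‖ ≤ Real.exp (R * ‖q‖) := by
  refine (hE.norm_le h𝓡 hμ z (toPhase q)).trans ?_
  rw [norm_toPhase]
  gcongr

theorem expBoundedDiff_toPhase_right (z : PhaseSpace N) :
    ExpBoundedDiff fun q => E z (toPhase q) where
  differentiable q := (hasFDerivAt_comp_toPhase (hE.differentiable_right z) q).differentiableAt
  expBounded := ⟨1, ‖z‖, zero_le_one, norm_nonneg z, fun q => by
    simpa using hE.norm_toPhase_right_le h𝓡 hμ le_rfl q⟩
  expBounded_fderiv := by
    refine ⟨2 * Real.exp ‖z‖, ‖z‖, by positivity, norm_nonneg z, fun q => ?_⟩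
    have hcauchy := norm_fderiv_le_of_forall_mem_ball (c := toPhase q) one_pos
      (hE.differentiable_right z).differentiableOn (M := Real.exp ‖z‖ * Real.exp (‖z‖ * ‖q‖))
      fun y hy => ?_
    · refine ContinuousLinearMap.opNorm_le_bound _ (by positivity) fun v => ?_
      rw [fderiv_comp_toPhase (hE.differentiable_right z), ← norm_toPhase v, mul_assoc 2]
      exact ContinuousLinearMap.le_of_opNorm_le _ (by simpa using hcauchy) _
    · refine (hE.norm_le h𝓡 hμ z y).trans ?_
      rw [← Real.exp_add, ← mul_one_add, ← norm_toPhase q]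
      gcongr
      linarith [norm_le_norm_add_norm_sub' y (toPhase q), mem_ball_iff_norm.mp hy]

theorem dunklOp_toPhase_right (ξ q : ConfigSpace N) (z : PhaseSpace N) :
    dunklOp 𝓡 μ ξ (fun q => E z (toPhase q)) q = bil (toPhase ξ) z * E z (toPhase q) := by
  simpa only [hE.symm h𝓡 hμ _ z] using hE.dunklOp_eq ξ q z

theorem integrable_mul (z w : PhaseSpace N) : Integrable
    (fun q => E z (toPhase q) * E w (toPhase q)) (gaussianMeasure 𝓡 μ 0) :=
  ((hE.expBoundedDiff_toPhase_right h𝓡 hμ z).mul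
    (hE.expBoundedDiff_toPhase_right h𝓡 hμ w)).expBounded.integrable_gaussianMeasure
      ((hE.continuous_toPhase_right z).mul (hE.continuous_toPhase_right w)).measurable h𝓡 hμ
      (by norm_num)

theorem integral_inner_mul (ξ : ConfigSpace N) (z w : PhaseSpace N) :
    ∫ q, (⟪ξ, q⟫ : ℂ) * (E z (toPhase q) * E w (toPhase q)) ∂gaussianMeasure 𝓡 μ 0 =
      bil (toPhase ξ) (z + w) *
        ∫ q, E z (toPhase q) * E w (toPhase q) ∂gaussianMeasure 𝓡 μ 0 := by
  rw [(hE.expBoundedDiff_toPhase_right h𝓡 hμ z).integral_inner_mul_mul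
    (hE.expBoundedDiff_toPhase_right h𝓡 hμ w) h𝓡 hμ, ← integral_const_mul]
  refine integral_congr_ae (.of_forall fun q => ?_)
  simp only [hE.dunklOp_toPhase_right h𝓡 hμ, map_add]
  ring

theorem integrable_inner_mul (ξ : ConfigSpace N) (z w : PhaseSpace N) : Integrable
    (fun q => (⟪ξ, q⟫ : ℂ) * (E z (toPhase q) * E w (toPhase q))) (gaussianMeasure 𝓡 μ 0) := by
  have hz := hE.expBoundedDiff_toPhase_right h𝓡 hμ z
  have hw := hE.expBoundedDiff_toPhase_right h𝓡 hμ w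
  have := (hz.mul hw).differentiable.continuous
  exact ((ExpBounded.inner ξ).mul (hz.mul hw).expBounded).integrable_gaussianMeasure
    (by fun_prop) h𝓡 hμ (by norm_num)

theorem integral_bil_mul (x z w : PhaseSpace N) :
    ∫ q, bil x (toPhase q) * (E z (toPhase q) * E w (toPhase q)) ∂gaussianMeasure 𝓡 μ 0 =
      bil x (z + w) * ∫ q, E z (toPhase q) * E w (toPhase q) ∂gaussianMeasure 𝓡 μ 0 := by
  simp only [bil_toPhase_right_eq_sum, Finset.sum_mul, mul_assoc]
  rw [integral_finsetSum _ fun i _ => (hE.integrable_inner_mul h𝓡 hμ _ z w).const_mul _,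
    bil_apply, Finset.sum_mul]
  refine Finset.sum_congr rfl fun i _ => ?_
  rw [integral_const_mul, hE.integral_inner_mul h𝓡 hμ, bil_toPhase_single, mul_assoc]

theorem integrable_bil_mul (x z w : PhaseSpace N) : Integrable
    (fun q => bil x (toPhase q) * (E z (toPhase q) * E w (toPhase q)))
      (gaussianMeasure 𝓡 μ 0) := by
  simp only [bil_toPhase_right_eq_sum, Finset.sum_mul, mul_assoc]
  exact integrable_finsetSum _ fun i _ => (hE.integrable_inner_mul h𝓡 hμ _ z w).const_mul _

theorem integrable_exp_mul_norm (R : ℝ) (w : PhaseSpace N) : Integrable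
    (fun q => Real.exp (R * ‖q‖) * ‖E w (toPhase q)‖) (gaussianMeasure 𝓡 μ 0) := by
  have hexp : ExpBounded fun q : ConfigSpace N => (Real.exp (R * ‖q‖) : ℂ) :=
    ⟨1, |R|, zero_le_one, abs_nonneg R, fun q => by
      rw [one_mul, Complex.norm_of_nonneg (Real.exp_pos _).le]
      gcongr
      exact le_abs_self R⟩
  have hcont : Continuous fun q => (Real.exp (R * ‖q‖) : ℂ) * E w (toPhase q) :=
    Continuous.mul (by fun_prop) (hE.continuous_toPhase_right w)
  have hint := (hexp.mul (hE.expBoundedDiff_toPhase_right h𝓡 hμ w).expBounded)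
    |>.integrable_gaussianMeasure hcont.measurable h𝓡 hμ (ε := 0) (by norm_num)
  simpa only [norm_mul, Complex.norm_of_nonneg (Real.exp_pos _).le] using hint.norm

theorem hasDerivAt_integral_smul_mul (z w : PhaseSpace N) :
    HasDerivAt (fun t : ℂ => ∫ q, E (t • z) (toPhase q) * E w (toPhase q) ∂gaussianMeasure 𝓡 μ 0)
      (∫ q, deriv (fun t : ℂ => E (t • z) (toPhase q)) 1 * E w (toPhase q)
        ∂gaussianMeasure 𝓡 μ 0) 1 := by
  refine hasDerivAt_integral_of_forall_norm_le
    (F' := fun t q => deriv (fun t : ℂ => E (t • z) (toPhase q)) t * E w (toPhase q)) 1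
    (fun q t => ?_) (fun t => (hE.integrable_mul h𝓡 hμ _ w).aestronglyMeasurable)
    (hE.integrable_exp_mul_norm h𝓡 hμ (3 * ‖z‖) w) fun q t ht => ?_
  · exact (((hE.differentiable_left _).comp (by fun_prop)) t).hasDerivAt.mul_const _
  · have ht3 : ‖t‖ ≤ 3 := by
      have := norm_le_norm_add_norm_sub' t 1
      rw [mem_ball_iff_norm] at ht
      rw [norm_one] at this
      linarith
    rw [norm_mul]
    gcongr
    exact hE.norm_toPhase_right_le h𝓡 hμ ((norm_smul t z).trans_le (by gcongr)) q

theorem isRadialSolution_integral (w : PhaseSpace N) :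
    IsRadialSolution 𝓡 (fun α => μ α / 2) (fun α => phaseRefl α)
      (fun z => bil z (z + w))
      fun z => ∫ q, E z (toPhase q) * E w (toPhase q) ∂gaussianMeasure 𝓡 μ 0 := by
  have hint := fun z => hE.integrable_mul h𝓡 hμ z w
  refine ⟨continuous_integral_of_forall_norm_le
    (B := fun R q => Real.exp (R * ‖q‖) * ‖E w (toPhase q)‖)
    (fun q => (hE.differentiable_left _).continuous.mul continuous_const)
    (fun z => (hint z).aestronglyMeasurable) (hE.integrable_exp_mul_norm h𝓡 hμ · w)
    fun R z q hz => ?_, fun z => (hE.hasDerivAt_integral_smul_mul h𝓡 hμ z w).comp_ofReal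
      |>.congr_deriv ?_⟩
  · rw [norm_mul]
    gcongr
    exact hE.norm_toPhase_right_le h𝓡 hμ hz q
  · simp only [hE.deriv_smul_left, sub_mul, Finset.sum_mul, mul_assoc]
    have hdiff : ∀ α ∈ 𝓡, Integrable (fun q => ((μ α / 2 : ℝ) : ℂ) * (E z (toPhase q) *
        E w (toPhase q) - E (phaseRefl α z) (toPhase q) * E w (toPhase q)))
        (gaussianMeasure 𝓡 μ 0) := fun α _ => ((hint z).sub (hint _)).const_mul _
    rw [integral_sub (hE.integrable_bil_mul h𝓡 hμ z z w) (integrable_finsetSum _ hdiff),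
      hE.integral_bil_mul h𝓡 hμ, integral_finsetSum _ hdiff]
    simp only [integral_const_mul, integral_sub (hint z) (hint _)]

theorem integral_mul_eq (z w : PhaseSpace N) :
    ∫ q, E z (toPhase q) * E w (toPhase q) ∂gaussianMeasure 𝓡 μ 0 =
      Complex.exp (holoSq z / 2) * E z w *
        ∫ q, E w (toPhase q) ∂gaussianMeasure 𝓡 μ 0 := by
  have hsol : IsRadialSolution 𝓡 (fun α => μ α / 2) (fun α => phaseRefl α) (fun z => bil z w)
      fun z => Complex.exp (-holoSq z / 2) *
        ∫ q, E z (toPhase q) * E w (toPhase q) ∂gaussianMeasure 𝓡 μ 0 := by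
    have := (hE.isRadialSolution_integral h𝓡 hμ w).cexp_mul (φ := fun z => -holoSq z / 2)
      (by have := (differentiable_holoSq (N := N)).continuous; fun_prop)
      (fun z => (hasDerivAt_holoSq_smul z).neg.div_const 2)
      fun α hα z => by rw [holoSq_phaseRefl (h𝓡.norm_sq α hα)]
    refine ⟨this.continuous, fun z => (this.hasDerivAt z).congr_deriv ?_⟩
    rw [map_add, bil_self]
    ring
  have hkey := hE.eq_mul_of_isRadialSolution h𝓡 hμ hsol z
  simp only [hE.zero_left, one_mul, ← bil_self 0, map_zero, neg_zero, zero_div, Complex.exp_zero]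
    at hkey
  rw [mul_assoc, mul_comm (E z w), ← hkey, ← mul_assoc, ← Complex.exp_add]
  simp [neg_div]

theorem integral_mul (z w : PhaseSpace N) :
    ∫ q, E z (toPhase q) * E w (toPhase q) ∂gaussianMeasure 𝓡 μ 0 =
      Complex.exp (holoSq z / 2 + holoSq w / 2) * E z w *
        ∫ _, (1 : ℂ) ∂gaussianMeasure 𝓡 μ 0 := by
  have hright : ∀ w, E w 0 = 1 := fun w => by rw [hE.symm h𝓡 hμ, hE.zero_left]
  have hzero := hE.integral_mul_eq h𝓡 hμ w 0
  simp only [hE.zero_left, hright, mul_one] at hzero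
  rw [hE.integral_mul_eq h𝓡 hμ, hzero, Complex.exp_add]
  ring

end IsEntireDunklKernel

end GaussianIntegral

/-! ### Gram kernels -/

section GramKernel

variable {𝕜 X V H : Type*} [RCLike 𝕜] [NormedAddCommGroup V] [InnerProductSpace 𝕜 V]
  [CompleteSpace V] [NormedAddCommGroup H] [InnerProductSpace 𝕜 H] [CompleteSpace H]

/-- The Gram matrix of a family of operators `v x : V → H`. It is the kernel of a reproducing
kernel Hilbert space when the `v x` are its kernel functions. -/
def gramKernel (v : X → V →L[𝕜] H) : Matrix X X (V →L[𝕜] V) :=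
  .of fun x y => (v x).adjoint ∘L v y

theorem inner_gramKernel (v : X → V →L[𝕜] H) (x y : X) (a b : V) :
    inner 𝕜 (gramKernel v x y a) b = inner 𝕜 (v y a) (v x b) :=
  (v x).adjoint_inner_left b (v y a)

theorem inner_lsum_self (v : X → V →L[𝕜] H) (f : X →₀ V) :
    inner 𝕜 (Finsupp.lsum 𝕜 (fun x => (v x).toLinearMap) f)
      (Finsupp.lsum 𝕜 (fun x => (v x).toLinearMap) f) =
      f.sum fun x a => f.sum fun y b => inner 𝕜 (gramKernel v y x a) b := by
  rw [Finsupp.lsum_apply, Finsupp.sum_inner]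
  simp only [Finsupp.inner_sum, inner_gramKernel, ContinuousLinearMap.coe_coe]

theorem posSemidef_gramKernel (v : X → V →L[𝕜] H) : (gramKernel v).PosSemidef := by
  have hiff := (RKHS.posSemidef_tfae (K := gramKernel v)).out 0 2
  refine hiff.mpr ⟨?_, fun f => ?_⟩
  · ext1 x y
    simp [gramKernel, ContinuousLinearMap.star_eq_adjoint, ContinuousLinearMap.adjoint_comp]
  · rw [← inner_lsum_self]
    exact inner_self_nonneg

theorem denseRange_lsum_kerFun [RKHS 𝕜 H X V] :
    DenseRange (Finsupp.lsum 𝕜 fun x => (RKHS.kerFun H x).toLinearMap) := by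
  have hle : Submodule.span 𝕜 {RKHS.kerFun H x a | (x) (a)} ≤
      LinearMap.range (Finsupp.lsum 𝕜 fun x => (RKHS.kerFun H x).toLinearMap) := by
    rw [Submodule.span_le]
    rintro _ ⟨x, a, rfl⟩
    exact ⟨Finsupp.single x a, by simp⟩
  exact Submodule.dense_iff_topologicalClosure_eq_top.mpr <|
    top_le_iff.mp <| (RKHS.kerFun_dense H).ge.trans (Submodule.topologicalClosure_mono hle)

theorem exists_continuousLinearMap_of_eq_gramKernel {v : X → V →L[𝕜] H}
    {K : Matrix X X (V →L[𝕜] V)} (hK : K = gramKernel v) [Fact K.PosSemidef] :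
    ∃ A : H →L[𝕜] RKHS.OfKernel K, ∀ ψ x, A ψ x = (v x).adjoint ψ := by
  let e := Finsupp.lsum 𝕜 fun x => (RKHS.kerFun (RKHS.OfKernel K) x).toLinearMap
  let f := Finsupp.lsum 𝕜 fun x => (v x).toLinearMap
  have hgram : gramKernel (RKHS.kerFun (RKHS.OfKernel K)) = gramKernel v :=
    RKHS.OfKernel.kernel_ofKernel.trans hK
  have hnorm : ∀ c, ‖f c‖ = ‖e c‖ := fun c => by
    rw [@norm_eq_sqrt_re_inner 𝕜, @norm_eq_sqrt_re_inner 𝕜, inner_lsum_self, inner_lsum_self,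
      hgram]
  let J := f.extendOfNorm e
  have hJ : ∀ x, J ∘L RKHS.kerFun (RKHS.OfKernel K) x = v x := fun x => by
    ext a
    have hext := LinearMap.extendOfNorm_eq (f := f) (e := e) denseRange_lsum_kerFun
      ⟨1, fun c => by rw [one_mul, hnorm]⟩ (Finsupp.single x a)
    simp only [e, f, Finsupp.lsum_single] at hext
    exact hext
  refine ⟨J.adjoint, fun ψ x => ?_⟩
  rw [← hJ x, ContinuousLinearMap.adjoint_comp, ContinuousLinearMap.comp_apply,
    RKHS.adjoint_kerFun]

/-- The kernel `(x, y) ↦ ∫ k x * conj (k y)`, which is the reproducing kernel of the range of the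
integral operator with kernel `k` on `L²(ν)`. -/
def integralGramKernel {Y : Type*} [MeasurableSpace Y] (ν : Measure Y) (k : X → Y → 𝕜) :
    Matrix X X (𝕜 →L[𝕜] 𝕜) :=
  .of fun x y => (∫ q, k x q * (starRingEnd 𝕜) (k y q) ∂ν) • ContinuousLinearMap.id 𝕜 𝕜

section IntegralOperator

variable {Y : Type*} [MeasurableSpace Y] {ν : Measure Y} {k : X → Y → 𝕜}

theorem adjoint_toSpanSingleton_star_toLp_apply {g : Y → 𝕜} (hg : MemLp g 2 ν)
    (ψ : Lp 𝕜 2 ν) :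
    (ContinuousLinearMap.toSpanSingleton 𝕜 hg.star.toLp).adjoint ψ = ∫ q, g q * ψ q ∂ν := by
  rw [ContinuousLinearMap.adjoint_toSpanSingleton, innerSL_apply_apply, L2.inner_def]
  refine integral_congr_ae ?_
  filter_upwards [hg.star.coeFn_toLp] with q hq
  simp [hq, mul_comm]

theorem integralGramKernel_eq_gramKernel (hk : ∀ x, MemLp (k x) 2 ν) :
    integralGramKernel ν k = gramKernel fun x =>
      ContinuousLinearMap.toSpanSingleton 𝕜 (hk x).star.toLp := by
  ext x y
  simp only [integralGramKernel, gramKernel, Matrix.of_apply, ContinuousLinearMap.comp_apply,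
    ContinuousLinearMap.toSpanSingleton_apply, one_smul, smul_apply, ContinuousLinearMap.id_apply,
    smul_eq_mul, mul_one]
  rw [adjoint_toSpanSingleton_star_toLp_apply (hk x)]
  refine integral_congr_ae ?_
  filter_upwards [(hk y).star.coeFn_toLp] with q hq
  simp [hq]

theorem posSemidef_integralGramKernel (hk : ∀ x, MemLp (k x) 2 ν) :
    (integralGramKernel ν k).PosSemidef := by
  rw [integralGramKernel_eq_gramKernel hk]
  exact posSemidef_gramKernel _

theorem exists_integralOperator (hk : ∀ x, MemLp (k x) 2 ν) {K : Matrix X X (𝕜 →L[𝕜] 𝕜)}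
    (hK : K = integralGramKernel ν k) [Fact K.PosSemidef] :
    ∃ A : Lp 𝕜 2 ν →L[𝕜] RKHS.OfKernel K, ∀ ψ x,
      Integrable (fun q => k x q * ψ q) ν ∧ A ψ x = ∫ q, k x q * ψ q ∂ν := by
  obtain ⟨A, hA⟩ := exists_continuousLinearMap_of_eq_gramKernel
    (hK.trans (integralGramKernel_eq_gramKernel hk))
  refine ⟨A, fun ψ x => ⟨(hk x).integrable_mul (Lp.memLp ψ), ?_⟩⟩
  rw [hA, adjoint_toSpanSingleton_star_toLp_apply (hk x)]

end IntegralOperator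

end GramKernel

/-! ### Unitary operators between `L²` spaces -/

section LpEquiv

variable {X Y : Type*} [MeasurableSpace X] [MeasurableSpace Y] {ν : Measure X} {p : ENNReal}
  [Fact (1 ≤ p)] {𝕜 : Type*} [RCLike 𝕜]

theorem exists_linearIsometryEquiv_smul_measure (hp : p ≠ ⊤) {c : ENNReal} (hc : c ≠ 0)
    (hc' : c ≠ ⊤) {a : 𝕜} (ha : ‖a‖ₑ * c ^ (1 / p).toReal = 1) :
    ∃ e : Lp 𝕜 p ν ≃ₗᵢ[𝕜] Lp 𝕜 p (c • ν), ∀ φ, e φ =ᵐ[c • ν] fun x => a * φ x := by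
  have hac : c • ν ≪ ν := Measure.smul_absolutelyContinuous
  have ha0 : a ≠ 0 := by rintro rfl; simp at ha
  have hmem (φ : Lp 𝕜 p ν) : MemLp (a • ⇑φ) p (c • ν) :=
    ((Lp.memLp φ).const_smul a).smul_measure hc'
  have hmem' (ψ : Lp 𝕜 p (c • ν)) : MemLp (a⁻¹ • ⇑ψ) p ν := by
    have := ((Lp.memLp ψ).const_smul a⁻¹).smul_measure (ENNReal.inv_ne_top.mpr hc)
    rwa [smul_smul, ENNReal.inv_mul_cancel hc hc', one_smul] at this
  have hcoe (φ : Lp 𝕜 p ν) : (hmem φ).toLp _ =ᵐ[c • ν] a • ⇑φ := MemLp.coeFn_toLp _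
  let L : Lp 𝕜 p ν →ₗᵢ[𝕜] Lp 𝕜 p (c • ν) :=
    { toFun := fun φ => (hmem φ).toLp _
      map_add' := fun φ ψ => by
        rw [← MemLp.toLp_add]
        refine MemLp.toLp_congr _ _ ?_
        filter_upwards [hac.ae_le (Lp.coeFn_add φ ψ)] with x hx
        simp only [Pi.smul_apply, Pi.add_apply, hx, smul_add]
      map_smul' := fun b φ => by
        rw [RingHom.id_apply, ← MemLp.toLp_const_smul]
        refine MemLp.toLp_congr _ _ ?_
        filter_upwards [hac.ae_le (Lp.coeFn_smul b φ)] with x hx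
        simp only [Pi.smul_apply, hx, smul_comm a b]
      norm_map' := fun φ => by
        rw [LinearMap.coe_mk, AddHom.coe_mk, Lp.norm_toLp, eLpNorm_const_smul,
          eLpNorm_smul_measure_of_ne_top hp, smul_eq_mul, ← mul_assoc, ha, one_mul, Lp.norm_def] }
  have hsurj : Function.Surjective L := fun ψ => by
    refine ⟨(hmem' ψ).toLp _, Lp.ext ?_⟩
    filter_upwards [hcoe ((hmem' ψ).toLp _), hac.ae_le (hmem' ψ).coeFn_toLp] with x hx hx'
    exact hx.trans (by simp [hx', ha0])
  exact ⟨LinearIsometryEquiv.ofSurjective L hsurj, hcoe⟩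

theorem exists_linearIsometryEquiv_comp {ν' : Measure Y} {g : X → Y} {g' : Y → X}
    (hg : MeasurePreserving g ν ν') (hg' : MeasurePreserving g' ν' ν)
    (hinv : Function.LeftInverse g' g) :
    ∃ e : Lp 𝕜 p ν' ≃ₗᵢ[𝕜] Lp 𝕜 p ν, ∀ φ, e φ =ᵐ[ν] φ ∘ g := by
  refine ⟨LinearIsometryEquiv.ofSurjective (Lp.compMeasurePreservingₗᵢ 𝕜 g hg) fun ψ => ?_,
    fun φ => Lp.coeFn_compMeasurePreserving φ hg⟩
  refine ⟨Lp.compMeasurePreserving g' hg' ψ, ?_⟩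
  have hcomp := Lp.compMeasurePreserving_comp_apply ψ hg' hg
  simp only [hinv.comp_eq_id, Lp.compMeasurePreserving_id_apply] at hcomp
  exact hcomp.symm

end LpEquiv

/-! ### The weighted measures -/

section WeightedMeasures

variable {N : ℕ} {𝓡 : Finset (ConfigSpace N)} {μ : ConfigSpace N → ℝ}

theorem measurable_weightTilde (t : ℝ) : Measurable (weightTilde 𝓡 μ t) := by
  unfold weightTilde
  fun_prop

theorem measurable_weight (t : ℝ) : Measurable (weight 𝓡 μ t) :=
  (measurable_weightTilde t).const_mul _

theorem weightTilde_eq_rpow_mul (t : ℝ) (x : ConfigSpace N) :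
    weightTilde 𝓡 μ t x = t ^ (-(gammaConst 𝓡 μ + N / 2)) * weightTilde 𝓡 μ 1 x := by
  simp [weightTilde]

theorem weightTilde_smul {r t : ℝ} (hr : 0 < r) (x : ConfigSpace N) :
    weightTilde 𝓡 μ t (r • x) = r ^ (2 * gammaConst 𝓡 μ) * weightTilde 𝓡 μ t x := by
  have hgamma : 2 * gammaConst 𝓡 μ = ∑ α ∈ 𝓡, μ α := by rw [gammaConst]; ring
  have hroot (α : ConfigSpace N) : |⟪α, r • x⟫| ^ μ α = r ^ μ α * |⟪α, x⟫| ^ μ α := by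
    rw [real_inner_smul_right, abs_mul, abs_of_pos hr, Real.mul_rpow hr.le (abs_nonneg _)]
  rw [hgamma, Real.rpow_sum_of_pos hr, weightTilde, weightTilde]
  simp only [hroot, Finset.prod_mul_distrib]
  ring

theorem weight_smul {r t : ℝ} (hr : 0 < r) (ht : 0 ≤ t) (x : ConfigSpace N) :
    r ^ N * weight 𝓡 μ (r ^ 2 * t) (r • x) = weight 𝓡 μ t x := by
  have hpow : r ^ N * ((r ^ 2) ^ (-(gammaConst 𝓡 μ + N / 2)) * r ^ (2 * gammaConst 𝓡 μ)) = 1 := by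
    rw [← Real.rpow_natCast r 2, ← Real.rpow_mul hr.le, ← Real.rpow_natCast r N,
      ← Real.rpow_add hr, ← Real.rpow_add hr, ← Real.rpow_zero r]
    congr 1
    push_cast
    ring
  rw [weight, weight, weightTilde_smul hr, weightTilde_eq_rpow_mul (r ^ 2 * t),
    weightTilde_eq_rpow_mul t, Real.mul_rpow (by positivity) ht]
  linear_combination (mehtaConst 𝓡 μ)⁻¹ * t ^ (-(gammaConst 𝓡 μ + N / 2)) *
    weightTilde 𝓡 μ 1 x * hpow

theorem measurePreserving_smul_addHaar {E : Type*} [NormedAddCommGroup E] [NormedSpace ℝ E]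
    [FiniteDimensional ℝ E] [MeasurableSpace E] [BorelSpace E] (ν : Measure E)
    [ν.IsAddHaarMeasure] {r : ℝ} (hr : r ≠ 0) :
    MeasurePreserving (r • ·) (ENNReal.ofReal |r ^ Module.finrank ℝ E| • ν) ν where
  measurable := measurable_const_smul r
  map_eq := by
    rw [Measure.map_smul, Measure.map_addHaar_smul _ hr, smul_smul,
      ← ENNReal.ofReal_mul (abs_nonneg _), ← abs_mul, mul_inv_cancel₀ (pow_ne_zero _ hr), abs_one,
      ENNReal.ofReal_one, one_smul]

theorem measurePreserving_smul_measureOmega {r t : ℝ} (hr : 0 < r) (ht : 0 ≤ t) :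
    MeasurePreserving (fun x : ConfigSpace N => r • x) (measureOmega 𝓡 μ t)
      (measureOmega 𝓡 μ (r ^ 2 * t)) := by
  have hdensity : (ENNReal.ofReal (r ^ N) • volume).withDensity (fun x : ConfigSpace N =>
      ENNReal.ofReal (weight 𝓡 μ (r ^ 2 * t) (r • x))) = measureOmega 𝓡 μ t := by
    have hmeas : Measurable fun x : ConfigSpace N =>
        ENNReal.ofReal (weight 𝓡 μ (r ^ 2 * t) (r • x)) :=
      ((measurable_weight _).comp (measurable_const_smul r)).ennreal_ofReal
    rw [withDensity_smul_measure, ← withDensity_smul _ hmeas, measureOmega]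
    congr 1
    ext x
    rw [Pi.smul_apply, smul_eq_mul, ← ENNReal.ofReal_mul (by positivity), weight_smul hr ht]
  have hpres := measurePreserving_withDensity
    (measurePreserving_smul_addHaar (volume : Measure (ConfigSpace N)) hr.ne')
    (measurable_weight (𝓡 := 𝓡) (μ := μ) (r ^ 2 * t)).ennreal_ofReal
  rwa [finrank_euclideanSpace_fin, abs_of_pos (pow_pos hr N), hdensity] at hpres

theorem gaussianMeasure_zero : gaussianMeasure 𝓡 μ 0 =
    (measureTilde 𝓡 μ 1).withDensity fun x => ENNReal.ofReal (Real.exp (-‖x‖ ^ 2 / 2)) := by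
  rw [measureTilde, ← withDensity_mul _ (measurable_weightTilde 1).ennreal_ofReal (by fun_prop),
    gaussianMeasure]
  congr 1
  ext x
  rw [regWeight_zero, mul_comm, Pi.mul_apply, ENNReal.ofReal_mul' (Real.exp_pos _).le]

theorem integral_gaussianMeasure_zero (f : ConfigSpace N → ℂ) :
    ∫ x, f x ∂gaussianMeasure 𝓡 μ 0 =
      ∫ x, (Real.exp (-‖x‖ ^ 2 / 2) : ℂ) * f x ∂measureTilde 𝓡 μ 1 := by
  rw [gaussianMeasure_zero, integral_withDensity_eq_integral_toReal_smul (by fun_prop)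
    (.of_forall fun _ => ENNReal.ofReal_lt_top)]
  simp only [ENNReal.toReal_ofReal (Real.exp_pos _).le, Complex.real_smul]

theorem integrable_gaussianMeasure_zero_iff {f : ConfigSpace N → ℂ} :
    Integrable f (gaussianMeasure 𝓡 μ 0) ↔
      Integrable (fun x => (Real.exp (-‖x‖ ^ 2 / 2) : ℂ) * f x) (measureTilde 𝓡 μ 1) := by
  rw [gaussianMeasure_zero, integrable_withDensity_iff_integrable_smul' (by fun_prop)
    (.of_forall fun _ => ENNReal.ofReal_lt_top)]
  simp only [ENNReal.toReal_ofReal (Real.exp_pos _).le, Complex.real_smul]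

theorem ofReal_mehtaConst : (mehtaConst 𝓡 μ : ℂ) = ∫ _, (1 : ℂ) ∂gaussianMeasure 𝓡 μ 0 := by
  simp only [integral_gaussianMeasure_zero, mul_one, mehtaConst, integral_complex_ofReal]

theorem mehtaConst_pos (h𝓡 : IsRootSystem 𝓡) (hμ : IsMultiplicity 𝓡 μ) : 0 < mehtaConst 𝓡 μ := by
  have hint : Integrable (regWeight 𝓡 μ 0) :=
    (integrable_exp_neg_mul_sq_norm_add (by norm_num)).mono'
      (measurable_regWeight hμ 0).aestronglyMeasurable
      (.of_forall (norm_regWeight_le h𝓡 hμ (by norm_num)))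
  have hc : mehtaConst 𝓡 μ = ∫ x, regWeight 𝓡 μ 0 x := by
    have := ofReal_mehtaConst (𝓡 := 𝓡) (μ := μ)
    simp only [integral_gaussianMeasure hμ, mul_one, integral_complex_ofReal] at this
    exact_mod_cast this
  have hsupp : Function.support (regWeight 𝓡 μ 0) =ᵐ[volume] Set.univ := by
    rw [Filter.eventuallyEq_univ]
    filter_upwards [ae_inner_ne_zero h𝓡] with x hx
    refine mul_ne_zero (Real.exp_ne_zero _) (Finset.prod_ne_zero_iff.mpr fun α hα => ?_)
    have := hx α hα
    positivity
  rw [hc, integral_pos_iff_support_of_nonneg (regWeight_nonneg 0) hint,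
    measure_congr hsupp]
  exact Measure.measure_univ_pos.mpr (NeZero.ne _)

theorem measureOmega_eq_smul (hc : 0 ≤ mehtaConst 𝓡 μ) {t : ℝ} (ht : 0 ≤ t) :
    measureOmega 𝓡 μ t =
      ENNReal.ofReal ((mehtaConst 𝓡 μ)⁻¹ * t ^ (-(gammaConst 𝓡 μ + N / 2))) •
        measureTilde 𝓡 μ 1 := by
  rw [measureTilde, ← withDensity_smul _ (measurable_weightTilde 1).ennreal_ofReal, measureOmega]
  congr 1
  ext x
  rw [Pi.smul_apply, smul_eq_mul, ← ENNReal.ofReal_mul (by positivity), weight,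
    weightTilde_eq_rpow_mul, mul_assoc]

theorem measureOmega_one (hc : 0 ≤ mehtaConst 𝓡 μ) :
    measureOmega 𝓡 μ 1 = ENNReal.ofReal (mehtaConst 𝓡 μ)⁻¹ • measureTilde 𝓡 μ 1 := by
  rw [measureOmega_eq_smul hc zero_le_one, Real.one_rpow, mul_one]

end WeightedMeasures

/-! ### The Segal–Bargmann transforms -/

section Transforms

variable {N : ℕ} {𝓡 : Finset (ConfigSpace N)} {μ : ConfigSpace N → ℝ}

theorem kernelA_one (z : PhaseSpace N) (q : ConfigSpace N) :
    kernelA 𝓡 μ 1 z q = Complex.exp (-holoSq z / 2 - (‖q‖ ^ 2 / 4 : ℝ)) *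
      dunklKernel 𝓡 μ z (toPhase q) := by
  simp [kernelA]

section

variable (h𝓡 : IsRootSystem 𝓡) (hμ : IsMultiplicity 𝓡 μ)

include h𝓡 hμ

theorem continuous_kernelA_one (z : PhaseSpace N) : Continuous (kernelA 𝓡 μ 1 z) := by
  have hE := (isEntireDunklKernel_dunklKernel h𝓡 hμ).continuous_toPhase_right z
  simp only [funext (kernelA_one z)]
  fun_prop

theorem kernelA_one_mul_conj (z w : PhaseSpace N) (q : ConfigSpace N) :
    kernelA 𝓡 μ 1 z q * (starRingEnd ℂ) (kernelA 𝓡 μ 1 w q) =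
      Complex.exp (-(holoSq z / 2 + holoSq (conjPhase w) / 2)) * (Real.exp (-‖q‖ ^ 2 / 2) *
        (dunklKernel 𝓡 μ z (toPhase q) * dunklKernel 𝓡 μ (conjPhase w) (toPhase q))) := by
  have hconj : (starRingEnd ℂ) (dunklKernel 𝓡 μ w (toPhase q)) =
      dunklKernel 𝓡 μ (conjPhase w) (toPhase q) := by
    rw [← (isEntireDunklKernel_dunklKernel h𝓡 hμ).conj_apply h𝓡 hμ (conjPhase w),
      conjPhase_conjPhase, conjPhase_toPhase]
  have hholo : (starRingEnd ℂ) (holoSq w) = holoSq (conjPhase w) := by simp [holoSq]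
  have hexp : Complex.exp (-holoSq z / 2 - (‖q‖ ^ 2 / 4 : ℝ)) *
      Complex.exp (-holoSq (conjPhase w) / 2 - (‖q‖ ^ 2 / 4 : ℝ)) =
      Complex.exp (-(holoSq z / 2 + holoSq (conjPhase w) / 2)) * Real.exp (-‖q‖ ^ 2 / 2) := by
    rw [Complex.ofReal_exp, ← Complex.exp_add, ← Complex.exp_add]
    congr 1
    push_cast
    ring
  rw [kernelA_one, kernelA_one, map_mul, hconj, ← Complex.exp_conj, map_sub, map_div₀, map_neg,
    hholo, Complex.conj_ofNat, Complex.conj_ofReal, mul_mul_mul_comm, hexp, mul_assoc]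

theorem memLp_kernelA_one (z : PhaseSpace N) :
    MemLp (kernelA 𝓡 μ 1 z) 2 (measureOmega 𝓡 μ 1) := by
  have hE := isEntireDunklKernel_dunklKernel h𝓡 hμ
  have hint : Integrable (fun q => kernelA 𝓡 μ 1 z q * (starRingEnd ℂ) (kernelA 𝓡 μ 1 z q))
      (measureTilde 𝓡 μ 1) := by
    simp only [kernelA_one_mul_conj h𝓡 hμ]
    exact (integrable_gaussianMeasure_zero_iff.mp (hE.integrable_mul h𝓡 hμ z _)).const_mul _
  rw [measureOmega_one (mehtaConst_pos h𝓡 hμ).le]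
  refine MemLp.smul_measure ?_ ENNReal.ofReal_ne_top
  rw [memLp_two_iff_integrable_sq_norm (continuous_kernelA_one h𝓡 hμ z).aestronglyMeasurable]
  simpa only [norm_mul, RCLike.norm_conj, ← sq] using hint.norm

theorem sbKernel_one_eq_integralGramKernel :
    sbKernel 𝓡 μ 1 = integralGramKernel (measureOmega 𝓡 μ 1) (kernelA 𝓡 μ 1) := by
  have hE := isEntireDunklKernel_dunklKernel h𝓡 hμ
  have hc := mehtaConst_pos h𝓡 hμ
  have hc0 : (mehtaConst 𝓡 μ : ℂ) ≠ 0 := Complex.ofReal_ne_zero.mpr hc.ne'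
  ext1 z w
  simp only [sbKernel, integralGramKernel, Matrix.of_apply, Real.sqrt_one, Complex.ofReal_one,
    inv_one, one_smul, kernelA_one_mul_conj h𝓡 hμ]
  congr 1
  rw [measureOmega_one hc.le, integral_smul_measure, integral_const_mul,
    ← integral_gaussianMeasure_zero, hE.integral_mul h𝓡 hμ, ← ofReal_mehtaConst,
    ENNReal.toReal_ofReal (inv_nonneg.mpr hc.le), Complex.real_smul, Complex.exp_neg,
    hE.symm h𝓡 hμ (conjPhase w)]
  push_cast
  field_simp

end

/-- The factor `c_μ^(1/2) 2^(-(γ_μ + N/2))` of the rescaling `R`. -/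
def rescalingFactor (𝓡 : Finset (ConfigSpace N)) (μ : ConfigSpace N → ℝ) : ℝ :=
  mehtaConst 𝓡 μ ^ (1 / 2 : ℝ) * 2 ^ (-(gammaConst 𝓡 μ + N / 2))

theorem rescalingFactor_pos (hc : 0 < mehtaConst 𝓡 μ) : 0 < rescalingFactor 𝓡 μ := by
  unfold rescalingFactor
  positivity

theorem inv_rescalingFactor (hc : 0 ≤ mehtaConst 𝓡 μ) : (rescalingFactor 𝓡 μ)⁻¹ =
    2 ^ (gammaConst 𝓡 μ + N / 2) * mehtaConst 𝓡 μ ^ (-(1 / 2) : ℝ) := by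
  rw [rescalingFactor, mul_inv_rev, ← Real.rpow_neg zero_le_two, neg_neg, ← Real.rpow_neg hc]

theorem measureOmega_quarter (hc : 0 ≤ mehtaConst 𝓡 μ) : measureOmega 𝓡 μ (1 / 4) =
    ENNReal.ofReal ((rescalingFactor 𝓡 μ)⁻¹ ^ 2) • measureTilde 𝓡 μ 1 := by
  rw [measureOmega_eq_smul hc (by norm_num)]
  congr 2
  have hquarter (g : ℝ) : (1 / 4 : ℝ) ^ (-g) = (2 ^ g) ^ 2 := by
    rw [Real.rpow_neg (by norm_num), ← Real.inv_rpow (by norm_num), Real.rpow_pow_comm zero_le_two]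
    norm_num
  have hsqrt : (mehtaConst 𝓡 μ ^ (-(1 / 2) : ℝ)) ^ 2 = (mehtaConst 𝓡 μ)⁻¹ := by
    rw [← Real.rpow_natCast, ← Real.rpow_mul hc, ← Real.rpow_neg_one]
    norm_num
  rw [inv_rescalingFactor hc, mul_pow, hsqrt, hquarter, mul_comm]

theorem measurePreserving_half : MeasurePreserving (fun x : ConfigSpace N => (1 / 2 : ℝ) • x)
    (measureOmega 𝓡 μ 1) (measureOmega 𝓡 μ (1 / 4)) := by
  have h := measurePreserving_smul_measureOmega (𝓡 := 𝓡) (μ := μ) one_half_pos zero_le_one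
  norm_num at h ⊢
  exact h

theorem measurePreserving_double : MeasurePreserving (fun x : ConfigSpace N => (2 : ℝ) • x)
    (measureOmega 𝓡 μ (1 / 4)) (measureOmega 𝓡 μ 1) := by
  have h := measurePreserving_smul_measureOmega (𝓡 := 𝓡) (μ := μ) (t := 1 / 4) two_pos (by simp)
  norm_num at h ⊢
  exact h

theorem exists_rescaling_linearIsometryEquiv (hc : 0 < mehtaConst 𝓡 μ) :
    ∃ R : Lp ℂ 2 (measureTilde 𝓡 μ 1) ≃ₗᵢ[ℂ] Lp ℂ 2 (measureOmega 𝓡 μ (1 / 4)),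
      ∀ φ, R φ =ᵐ[measureOmega 𝓡 μ (1 / 4)] rescaling 𝓡 μ φ := by
  have hpos := rescalingFactor_pos hc
  have hnorm : ‖(rescalingFactor 𝓡 μ : ℂ)‖ₑ *
      ENNReal.ofReal ((rescalingFactor 𝓡 μ)⁻¹ ^ 2) ^ (1 / (2 : ENNReal)).toReal = 1 := by
    have hsqrt : (((rescalingFactor 𝓡 μ)⁻¹ ^ 2) ^ (1 / (2 : ENNReal)).toReal) =
        (rescalingFactor 𝓡 μ)⁻¹ := by
      rw [← Real.rpow_natCast, ← Real.rpow_mul (inv_nonneg.mpr hpos.le)]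
      norm_num
    rw [ENNReal.ofReal_rpow_of_pos (by positivity), hsqrt, ← ofReal_norm,
      Complex.norm_of_nonneg hpos.le, ← ENNReal.ofReal_mul hpos.le, mul_inv_cancel₀ hpos.ne',
      ENNReal.ofReal_one]
  rw [measureOmega_quarter hc.le]
  exact exists_linearIsometryEquiv_smul_measure ENNReal.ofNat_ne_top
    (ENNReal.ofReal_pos.mpr (by positivity)).ne' ENNReal.ofReal_ne_top hnorm

theorem exists_dilation_linearIsometryEquiv :
    ∃ δ : Lp ℂ 2 (measureOmega 𝓡 μ (1 / 4)) ≃ₗᵢ[ℂ] Lp ℂ 2 (measureOmega 𝓡 μ 1),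
      ∀ ψ, δ ψ =ᵐ[measureOmega 𝓡 μ 1] dilation (1 / 2) ψ :=
  exists_linearIsometryEquiv_comp measurePreserving_half measurePreserving_double
    fun x => by rw [smul_smul]; norm_num

section

variable (h𝓡 : IsRootSystem 𝓡) (hμ : IsMultiplicity 𝓡 μ)

include h𝓡 hμ

theorem kernelBSO_eq_kernelA_double (z : PhaseSpace N) (y : ConfigSpace N) :
    kernelBSO 𝓡 μ z y = ((rescalingFactor 𝓡 μ)⁻¹ : ℝ) * kernelA 𝓡 μ 1 z ((2 : ℝ) • y) := by
  have hE := isEntireDunklKernel_dunklKernel h𝓡 hμ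
  have hkernel : dunklKernel 𝓡 μ (((√2 : ℝ) : ℂ) • toPhase y) (((√2 : ℝ) : ℂ) • z) =
      dunklKernel 𝓡 μ z (toPhase ((2 : ℝ) • y)) := by
    rw [hE.symm h𝓡 hμ, hE.smul_left h𝓡 hμ, smul_smul, ← Complex.ofReal_mul,
      Real.mul_self_sqrt zero_le_two, Complex.coe_smul, toPhase_smul]
  have hnorm : ‖(2 : ℝ) • y‖ ^ 2 / 4 = ‖y‖ ^ 2 := by
    rw [norm_smul, Real.norm_ofNat]
    ring
  rw [kernelBSO, hkernel, ← inv_rescalingFactor (mehtaConst_pos h𝓡 hμ).le, kernelA_one, hnorm,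
    mul_assoc]

theorem kernelA_mul_dilation_rescaling (φ : ConfigSpace N → ℂ) (z : PhaseSpace N)
    (y : ConfigSpace N) : (((rescalingFactor 𝓡 μ)⁻¹ ^ 2 : ℝ) : ℂ) *
      (kernelA 𝓡 μ 1 z ((2 : ℝ) • y) * dilation (1 / 2) (rescaling 𝓡 μ φ) ((2 : ℝ) • y)) =
      kernelBSO 𝓡 μ z y * φ y := by
  have hfactor : (rescalingFactor 𝓡 μ : ℂ) ≠ 0 :=
    Complex.ofReal_ne_zero.mpr (rescalingFactor_pos (mehtaConst_pos h𝓡 hμ)).ne'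
  have hrescaling : dilation (1 / 2) (rescaling 𝓡 μ φ) ((2 : ℝ) • y) =
      rescalingFactor 𝓡 μ * φ y := by
    rw [dilation, smul_smul, one_div_mul_cancel two_ne_zero, one_smul]
    rfl
  rw [hrescaling, kernelBSO_eq_kernelA_double h𝓡 hμ]
  push_cast
  field_simp

theorem integrable_kernelBSO_mul {φ : ConfigSpace N → ℂ} {z : PhaseSpace N}
    (hint : Integrable (fun q => kernelA 𝓡 μ 1 z q * dilation (1 / 2) (rescaling 𝓡 μ φ) q)
      (measureOmega 𝓡 μ 1)) :
    Integrable (fun y => kernelBSO 𝓡 μ z y * φ y) (measureTilde 𝓡 μ 1) := by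
  have hc := mehtaConst_pos h𝓡 hμ
  have hfactor := rescalingFactor_pos hc
  have hdouble := measurePreserving_double.integrable_comp_of_integrable hint
  rw [measureOmega_quarter hc.le, integrable_smul_measure
    (ENNReal.ofReal_pos.mpr (by positivity)).ne' ENNReal.ofReal_ne_top] at hdouble
  refine (hdouble.const_mul (((rescalingFactor 𝓡 μ)⁻¹ ^ 2 : ℝ) : ℂ)).congr (.of_forall fun y => ?_)
  exact kernelA_mul_dilation_rescaling h𝓡 hμ φ z y

theorem transformA_dilation_rescaling (φ : ConfigSpace N → ℂ) (z : PhaseSpace N) :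
    transformA 𝓡 μ 1 (dilation (1 / 2) (rescaling 𝓡 μ φ)) z = transformBSO 𝓡 μ φ z := by
  have hdouble : MeasurableEmbedding fun x : ConfigSpace N => (2 : ℝ) • x :=
    (Homeomorph.smulOfNeZero (2 : ℝ) two_ne_zero).measurableEmbedding
  rw [transformA, ← measurePreserving_double.integral_comp hdouble,
    measureOmega_quarter (mehtaConst_pos h𝓡 hμ).le, integral_smul_measure,
    ENNReal.toReal_ofReal (sq_nonneg _), Complex.real_smul, ← integral_const_mul]
  simp only [kernelA_mul_dilation_rescaling h𝓡 hμ, transformBSO]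

end

end Transforms

end Dunkl

end

theorem mainTheorem7 {N : ℕ} (hN : 1 ≤ N) (𝓡 : Finset (Dunkl.ConfigSpace N))
    (h𝓡 : Dunkl.IsRootSystem 𝓡) (μ : Dunkl.ConfigSpace N → ℝ) (hμ : Dunkl.IsMultiplicity 𝓡 μ) :
    ∃ _ : Fact (Dunkl.sbKernel 𝓡 μ 1).PosSemidef,
    ∃ (R : Lp ℂ 2 (Dunkl.measureTilde 𝓡 μ 1) ≃ₗᵢ[ℂ] Lp ℂ 2 (Dunkl.measureOmega 𝓡 μ (1 / 4)))
      (δ : Lp ℂ 2 (Dunkl.measureOmega 𝓡 μ (1 / 4)) ≃ₗᵢ[ℂ] Lp ℂ 2 (Dunkl.measureOmega 𝓡 μ 1))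
      (A : Lp ℂ 2 (Dunkl.measureOmega 𝓡 μ 1) →L[ℂ] Dunkl.SegalBargmannSpace 𝓡 μ 1)
      (BSO : Lp ℂ 2 (Dunkl.measureTilde 𝓡 μ 1) →L[ℂ] Dunkl.SegalBargmannSpace 𝓡 μ 1),
      (∀ φ, R φ =ᵐ[Dunkl.measureOmega 𝓡 μ (1 / 4)] Dunkl.rescaling 𝓡 μ φ) ∧
      (∀ ψ, δ ψ =ᵐ[Dunkl.measureOmega 𝓡 μ 1] Dunkl.dilation (1 / 2) ψ) ∧
      (∀ ψ z, Integrable (fun q => Dunkl.kernelA 𝓡 μ 1 z q * ψ q) (Dunkl.measureOmega 𝓡 μ 1) ∧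
        A ψ z = Dunkl.transformA 𝓡 μ 1 ψ z) ∧
      (∀ φ z, Integrable (fun y => Dunkl.kernelBSO 𝓡 μ z y * φ y) (Dunkl.measureTilde 𝓡 μ 1) ∧
        BSO φ z = Dunkl.transformBSO 𝓡 μ φ z) ∧
      ∀ φ, BSO φ = A (δ (R φ)) := by
  have hc := Dunkl.mehtaConst_pos h𝓡 hμ
  have hmem := Dunkl.memLp_kernelA_one h𝓡 hμ
  have hgram := Dunkl.sbKernel_one_eq_integralGramKernel h𝓡 hμ
  have hpos : Fact (Dunkl.sbKernel 𝓡 μ 1).PosSemidef :=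
    ⟨hgram ▸ Dunkl.posSemidef_integralGramKernel hmem⟩
  obtain ⟨R, hR⟩ := Dunkl.exists_rescaling_linearIsometryEquiv hc
  obtain ⟨δ, hδ⟩ := Dunkl.exists_dilation_linearIsometryEquiv (𝓡 := 𝓡) (μ := μ)
  obtain ⟨A, hA⟩ := Dunkl.exists_integralOperator hmem hgram
  have hkernel φ z : (fun q => Dunkl.kernelA 𝓡 μ 1 z q * δ (R φ) q) =ᵐ[Dunkl.measureOmega 𝓡 μ 1]
      fun q => Dunkl.kernelA 𝓡 μ 1 z q * Dunkl.dilation (1 / 2) (Dunkl.rescaling 𝓡 μ φ) q :=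
    Filter.EventuallyEq.rfl.mul <| (hδ _).trans <|
      Dunkl.measurePreserving_half.quasiMeasurePreserving.ae_eq_comp (hR φ)
  refine ⟨hpos, R, δ, A, A ∘L (R.trans δ).toContinuousLinearEquiv, hR, hδ, hA,
    fun φ z => ⟨Dunkl.integrable_kernelBSO_mul h𝓡 hμ ((hA _ z).1.congr (hkernel φ z)), ?_⟩,
    fun _ => rfl⟩
  exact (hA _ z).2.trans <| (integral_congr_ae (hkernel φ z)).trans <|
    Dunkl.transformA_dilation_rescaling h𝓡 hμ φ z
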